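/- Let $\mathbb K$ be a field, $l\ge 1$, and let $\mathfrak A$ be a free abelian group with $\mathbb Z$-basis $\alpha_1,\dots,\alpha_l$; put $\mathfrak A^+=\sum_i\mathbb Z_{\ge0}\alpha_i$. Let $\chi:\mathfrak A\times\mathfrak A\to\mathbb K^\times$ be bimultiplicative, i.e. $\chi(a+b,c)=\chi(a,c)\chi(b,c)$ and $\chi(a,b+c)=\chi(a,b)\chi(a,c)$, and let $\omega,\hat\rho:\mathfrak A\to\mathbb K^\times$ be group homomorphisms, where $\omega$ is arbitrary and $\hat\rho(\alpha_j)=\chi(\alpha_j,\alpha_j)$ for all $j$. Let $U=U(\chi)$ be the generalized quantum group, that is, the unique associative unital $\mathbb K$-algebra with the following properties. It is generated by $K_a,L_a$ $(a\in\mathfrak A)$ and $E_i,F_i$ $(1\le i\le l)$, and satisfies $$K_0=L_0=1,\quad K_aK_b=K_{a+b},\quad L_aL_b=L_{a+b},\quad K_aL_b=L_bK_a,$$ $$K_aE_i=\chi(a,\alpha_i)E_iK_a,\quad L_aE_i=\chi(-\alpha_i,a)E_iL_a,\quad K_aF_i=\chi(a,-\alpha_i)F_iK_a,\quad L_aF_i=\chi(\alpha_i,a)F_iL_a,$$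 $$E_iF_j-F_jE_i=\delta_{ij}(-K_{\alpha_i}+L_{\alpha_i}).$$ The elements $K_aL_b$ are a basis of the subalgebra $U^0$ that they span. There is a grading $U=\bigoplus_{\lambda\in\mathfrak A}U_\lambda$ as an algebra with $U^0\subset U_0$, $E_i\in U_{\alpha_i}$, $F_i\in U_{-\alpha_i}$. If $U^+$ and $U^-$ denote the unital subalgebras generated by the $E_i$ and by the $F_i$, then multiplication $U^-\otimes U^0\otimes U^+\to U$ is bijective. Finally, for $0\neq\lambda\in\mathfrak A^+$, an element of $U^+\cap U_\lambda$ that commutes with all $F_i$ is zero, and an element of $U^-_{-\lambda}:=U^-\cap U_{-\lambda}$ that commutes with all $E_i$ is zero. Let $\mathrm{Sh}:U\to U^0$ be the linear map that is the identity on $U^0$ and vanishes on $F_iU$ and on $UE_i$ for all $i$ (the Harish-Chandra projection), and let $$Z_\omega(U)=\{Z\in U_0 : ZX=\omega(\lambda)XZ\ \text{ for all }\lambda\in\mathfrak A,\ X\in U_\lambda\}$$ be the $\omega$-skew center. For an algebra homomorphism $\Lambda:U^0\to\mathbb K$ let $\mathcal L(\Lambda)$ be the simple $U$-module of highest weight $\Lambda$: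 it is simple and has a vector $v_\Lambda\ne0$ with $E_iv_\Lambda=0$ for all $i$, $hv_\Lambda=\Lambda(h)v_\Lambda$ for $h\in U^0$, and $\mathcal L(\Lambda)=\bigoplus_{\nu\in\mathfrak A^+}U^-_{-\nu}v_\Lambda$. For $\lambda,\mu\in\mathfrak A$ let $\Lambda_{\lambda,\mu}:U^0\to\mathbb K$ be the algebra homomorphism $$\Lambda_{\lambda,\mu}(K_{\lambda'}L_{\mu'})=\chi(\lambda,\mu')\,\chi(\lambda',\mu)\,\omega(\lambda')\qquad(\lambda',\mu'\in\mathfrak A).$$ **Theorem.** Let $\lambda,\mu\in\mathfrak A$ be such that $\mathcal L(\Lambda_{\lambda,\mu})$ is finite-dimensional, and put $m_\nu=\dim_{\mathbb K} U^-_{-\nu}v_{\Lambda_{\lambda,\mu}}$ for $\nu\in\mathfrak A^+$. Then $m_\nu\ne0$ for only finitely many $\nu$, and there is an element $Z_{\lambda,\mu}\in Z_\omega(U)$ such that $$\mathrm{Sh}(Z_{\lambda,\mu})=\sum_{\nu\in\mathfrak A^+}\hat\rho(\nu)\,m_\nu\,K_{\lambda+\nu}L_{\mu-\nu}.$$ 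-/

import Mathlib

set_option linter.unusedSectionVars false

noncomputable section

namespace GenQuantumGroup

universe u v

/-- A bicharacter `χ : A × A → Kˣ` on an additive abelian group. -/
structure Bicharacter (A : Type u) (K : Type v) [AddCommGroup A] [Field K] where
  /-- the underlying function of two variables -/
  toFun : A → A → Kˣ
  map_add_left : ∀ a b c, toFun (a + b) c = toFun a c * toFun b c
  map_add_right : ∀ a b c, toFun a (b + c) = toFun a b * toFun a c

namespace Bicharacter

variable {A : Type u} {K : Type v} [AddCommGroup A] [Field K]

instance : CoeFun (Bicharacter A K) (fun _ => A → A → Kˣ) := ⟨Bicharacter.toFun⟩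

theorem zero_left (χ : Bicharacter A K) (b : A) : χ 0 b = 1 := by
  have h := χ.map_add_left 0 0 b
  rw [add_zero] at h
  exact left_eq_mul.mp h

theorem zero_right (χ : Bicharacter A K) (a : A) : χ a 0 = 1 := by
  have h := χ.map_add_right a 0 0
  rw [add_zero] at h
  exact left_eq_mul.mp h

theorem neg_left (χ : Bicharacter A K) (a b : A) : χ (-a) b = (χ a b)⁻¹ := by
  have h := χ.map_add_left (-a) a b
  rw [neg_add_cancel, χ.zero_left] at h
  exact eq_inv_of_mul_eq_one_left h.symm

theorem neg_right (χ : Bicharacter A K) (a b : A) : χ a (-b) = (χ a b)⁻¹ := by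
  have h := χ.map_add_right a (-b) b
  rw [neg_add_cancel, χ.zero_right] at h
  exact eq_inv_of_mul_eq_one_left h.symm

end Bicharacter

/-- The generators `K_λ`, `L_λ` (`λ ∈ A`), `E_i`, `F_i` (`i = 1, …, l`). -/
inductive Gen (A : Type u) (l : ℕ) : Type u
  | K (a : A) : Gen A l
  | L (a : A) : Gen A l
  | E (i : Fin l) : Gen A l
  | F (i : Fin l) : Gen A l

section Algebra

variable {A : Type u} {K : Type v} [AddCommGroup A] [Field K] {l : ℕ}

/-- The generators in the free algebra. -/
abbrev free (K : Type v) [Field K] (g : Gen A l) : FreeAlgebra K (Gen A l) := FreeAlgebra.ι K g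

/-- The defining relations of the (non-reduced) algebra `Ũ(χ,π)`, where `α_i = π i`. -/
inductive Rel (χ : Bicharacter A K) (π : Fin l → A) :
    FreeAlgebra K (Gen A l) → FreeAlgebra K (Gen A l) → Prop
  | K_zero : Rel χ π (free K (.K 0)) 1
  | L_zero : Rel χ π (free K (.L 0)) 1
  | K_add (a b : A) : Rel χ π (free K (.K a) * free K (.K b)) (free K (.K (a + b)))
  | L_add (a b : A) : Rel χ π (free K (.L a) * free K (.L b)) (free K (.L (a + b)))
  | K_L (a b : A) : Rel χ π (free K (.K a) * free K (.L b)) (free K (.L b) * free K (.K a))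
  | K_E (a : A) (i : Fin l) : Rel χ π (free K (.K a) * free K (.E i))
      ((χ a (π i) : K) • (free K (.E i) * free K (.K a)))
  | L_E (a : A) (i : Fin l) : Rel χ π (free K (.L a) * free K (.E i))
      ((χ (-π i) a : K) • (free K (.E i) * free K (.L a)))
  | K_F (a : A) (i : Fin l) : Rel χ π (free K (.K a) * free K (.F i))
      ((χ a (-π i) : K) • (free K (.F i) * free K (.K a)))
  | L_F (a : A) (i : Fin l) : Rel χ π (free K (.L a) * free K (.F i))
      ((χ (π i) a : K) • (free K (.F i) * free K (.L a)))
  | E_F (i j : Fin l) : Rel χ π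
      (free K (.E i) * free K (.F j) - free K (.F j) * free K (.E i))
      (if i = j then -free K (.K (π i)) + free K (.L (π i)) else 0)

/-- The algebra `Ũ(χ,π)` given by generators and relations. -/
abbrev PreU (χ : Bicharacter A K) (π : Fin l → A) : Type (max u v) := RingQuot (Rel χ π)

/-! ### The Harish-Chandra projection of `Ũ`

The universal Verma module of `Ũ` has the basis `F_{w₁} ⋯ F_{w_n} K_a L_b`, with `w` a word in
`1, …, l` and `a, b ∈ A`. It is spelled out by explicit operators, and the projection
`Ũ → Ũ⁰ = ⨁ K · K_a L_b` sends `u` to the part of `u · 1` that involves the empty word only. -/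

/-- The space with basis `F_w K_a L_b`. -/
abbrev Verma (A : Type u) (K : Type v) [Field K] (l : ℕ) : Type (max u v) :=
  (List (Fin l) × A × A) →₀ K

/-- The basis vector `F_w K_a L_b`. -/
abbrev vec (K : Type v) [Field K] (w : List (Fin l)) (a b : A) : Verma A K l :=
  Finsupp.single (w, a, b) 1

/-- `α_{w₁} + ⋯ + α_{w_n}`. -/
def wordWt (π : Fin l → A) (w : List (Fin l)) : A := (w.map π).sum

/-- Left multiplication by `F_i`. -/
def opF (A : Type u) (K : Type v) [Field K] {l : ℕ} (i : Fin l) : Module.End K (Verma A K l) :=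
  Finsupp.linearCombination K fun p => vec K (i :: p.1) p.2.1 p.2.2

/-- Left multiplication by `K_c`. -/
def opK (χ : Bicharacter A K) (π : Fin l → A) (c : A) : Module.End K (Verma A K l) :=
  Finsupp.linearCombination K fun p =>
    (χ c (-wordWt π p.1) : K) • vec K p.1 (c + p.2.1) p.2.2

/-- Left multiplication by `L_c`. -/
def opL (χ : Bicharacter A K) (π : Fin l → A) (c : A) : Module.End K (Verma A K l) :=
  Finsupp.linearCombination K fun p =>
    (χ (wordWt π p.1) c : K) • vec K p.1 p.2.1 (c + p.2.2)

/-- `E_i` applied to `F_w K_a L_b`: `E_i` kills `K_a L_b`, and it is moved past the `F_j` by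
`E_i F_j = F_j E_i + δ_{ij} (-K_{α_i} + L_{α_i})`. -/
def vecE (χ : Bicharacter A K) (π : Fin l → A) (i : Fin l) (a b : A) :
    List (Fin l) → Verma A K l
  | [] => 0
  | j :: w => opF A K j (vecE χ π i a b w) +
      if i = j then -opK χ π (π i) (vec K w a b) + opL χ π (π i) (vec K w a b) else 0

/-- Left multiplication by `E_i`. -/
def opE (χ : Bicharacter A K) (π : Fin l → A) (i : Fin l) : Module.End K (Verma A K l) :=
  Finsupp.linearCombination K fun p => vecE χ π i p.2.1 p.2.2 p.1

/-- The operator of a generator on the universal Verma module. -/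
def opGen (χ : Bicharacter A K) (π : Fin l → A) : Gen A l → Module.End K (Verma A K l)
  | .K a => opK χ π a
  | .L a => opL χ π a
  | .E i => opE χ π i
  | .F i => opF A K i

@[simp] theorem opF_vec (i : Fin l) (w : List (Fin l)) (a b : A) :
    opF A K i (vec K w a b) = vec K (i :: w) a b := by
  simp [opF]

@[simp] theorem opK_vec (χ : Bicharacter A K) (π : Fin l → A) (c : A) (w : List (Fin l))
    (a b : A) : opK χ π c (vec K w a b) = (χ c (-wordWt π w) : K) • vec K w (c + a) b := by
  simp [opK]

@[simp] theorem opL_vec (χ : Bicharacter A K) (π : Fin l → A) (c : A) (w : List (Fin l))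
    (a b : A) : opL χ π c (vec K w a b) = (χ (wordWt π w) c : K) • vec K w a (c + b) := by
  simp [opL]

@[simp] theorem opE_vec_nil (χ : Bicharacter A K) (π : Fin l → A) (i : Fin l) (a b : A) :
    opE χ π i (vec K [] a b) = 0 := by
  simp [opE, vecE]

theorem opE_vec_cons (χ : Bicharacter A K) (π : Fin l → A) (i j : Fin l) (w : List (Fin l))
    (a b : A) : opE χ π i (vec K (j :: w) a b) = opF A K j (opE χ π i (vec K w a b)) +
      if i = j then -opK χ π (π i) (vec K w a b) + opL χ π (π i) (vec K w a b) else 0 := by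
  simp [opE, vecE]

theorem end_ext {f g : Module.End K (Verma A K l)}
    (h : ∀ w a b, f (vec K w a b) = g (vec K w a b)) : f = g := by
  refine Finsupp.lhom_ext' fun p => LinearMap.ext_ring ?_
  exact h p.1 p.2.1 p.2.2

theorem opE_opF (χ : Bicharacter A K) (π : Fin l → A) (i j : Fin l) :
    opE χ π i * opF A K j - opF A K j * opE χ π i =
      if i = j then -opK χ π (π i) + opL χ π (π i) else 0 := by
  refine end_ext fun w a b => ?_
  rw [LinearMap.sub_apply, Module.End.mul_apply, Module.End.mul_apply, opF_vec, opE_vec_cons,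
    add_sub_cancel_left]
  split_ifs <;> simp

theorem opK_opF (χ : Bicharacter A K) (π : Fin l → A) (c : A) (i : Fin l) :
    opK χ π c * opF A K i = (χ c (-π i) : K) • (opF A K i * opK χ π c) := by
  refine end_ext fun w a b => ?_
  simp only [Module.End.mul_apply, LinearMap.smul_apply, opF_vec, opK_vec, map_smul, smul_smul,
    wordWt, List.map_cons, List.sum_cons, neg_add, χ.map_add_right, Units.val_mul]

theorem opL_opF (χ : Bicharacter A K) (π : Fin l → A) (c : A) (i : Fin l) :
    opL χ π c * opF A K i = (χ (π i) c : K) • (opF A K i * opL χ π c) := by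
  refine end_ext fun w a b => ?_
  simp only [Module.End.mul_apply, LinearMap.smul_apply, opF_vec, opL_vec, map_smul, smul_smul,
    wordWt, List.map_cons, List.sum_cons, χ.map_add_left, Units.val_mul]

theorem opK_opK (χ : Bicharacter A K) (π : Fin l → A) (c d : A) :
    opK χ π c * opK χ π d = opK χ π (c + d) := by
  refine end_ext fun w a b => ?_
  simp only [Module.End.mul_apply, opK_vec, map_smul, smul_smul, χ.map_add_left, Units.val_mul,
    add_assoc, mul_comm]

theorem opL_opL (χ : Bicharacter A K) (π : Fin l → A) (c d : A) :
    opL χ π c * opL χ π d = opL χ π (c + d) := by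
  refine end_ext fun w a b => ?_
  simp only [Module.End.mul_apply, opL_vec, map_smul, smul_smul, χ.map_add_right, Units.val_mul,
    add_assoc, mul_comm]

theorem opK_opL (χ : Bicharacter A K) (π : Fin l → A) (c d : A) :
    opK χ π c * opL χ π d = opL χ π d * opK χ π c := by
  refine end_ext fun w a b => ?_
  simp only [Module.End.mul_apply, opK_vec, opL_vec, map_smul, smul_smul, mul_comm]

theorem opK_zero (χ : Bicharacter A K) (π : Fin l → A) : opK χ π 0 = 1 := by
  refine end_ext fun w a b => ?_
  simp [χ.zero_left]

theorem opL_zero (χ : Bicharacter A K) (π : Fin l → A) : opL χ π 0 = 1 := by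
  refine end_ext fun w a b => ?_
  simp [χ.zero_right]

/-- An operator `H` that commutes with the `F_j`, the `K_c` and the `L_c` up to the scalars of a
torus element of weight function `s` also does so with the `E_i`. -/
theorem comm_opE (χ : Bicharacter A K) (π : Fin l → A) (s : Fin l → Kˣ)
    (H : Module.End K (Verma A K l))
    (hF : ∀ j, H * opF A K j = ((s j)⁻¹ : K) • (opF A K j * H))
    (hK : ∀ c, H * opK χ π c = opK χ π c * H) (hL : ∀ c, H * opL χ π c = opL χ π c * H)
    (h0 : ∀ i a b, opE χ π i (H (vec K [] a b)) = 0) (i : Fin l) :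
    H * opE χ π i = (s i : K) • (opE χ π i * H) := by
  have hEF : ∀ j x, opE χ π i (opF A K j x) = opF A K j (opE χ π i x) +
      if i = j then -opK χ π (π i) x + opL χ π (π i) x else 0 := by
    intro j x
    have h := LinearMap.congr_fun (opE_opF χ π i j) x
    rw [LinearMap.sub_apply, Module.End.mul_apply, Module.End.mul_apply, sub_eq_iff_eq_add'] at h
    rw [h]
    split_ifs <;> simp
  have hF' : ∀ j x, H (opF A K j x) = ((s j)⁻¹ : K) • opF A K j (H x) := fun j x =>
    LinearMap.congr_fun (hF j) x
  have hK' : ∀ c x, H (opK χ π c x) = opK χ π c (H x) := fun c x => LinearMap.congr_fun (hK c) x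
  have hL' : ∀ c x, H (opL χ π c x) = opL χ π c (H x) := fun c x => LinearMap.congr_fun (hL c) x
  refine end_ext fun w a b => ?_
  simp only [Module.End.mul_apply, LinearMap.smul_apply]
  induction w with
  | nil => simp [h0]
  | cons j w ih =>
    rw [← opF_vec, hEF, hF', map_smul, hEF, map_add, hF', ih, map_smul, smul_smul, smul_smul,
      smul_add, mul_comm]
    congr 1
    split_ifs with hij
    · subst hij
      rw [map_add, map_neg, hK', hL', mul_inv_cancel₀ (Units.ne_zero _), one_smul]
    · simp

theorem opK_opE (χ : Bicharacter A K) (π : Fin l → A) (c : A) (i : Fin l) :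
    opK χ π c * opE χ π i = (χ c (π i) : K) • (opE χ π i * opK χ π c) :=
  comm_opE χ π (fun j => χ c (π j)) _
    (fun j => by rw [opK_opF, χ.neg_right, Units.val_inv_eq_inv_val])
    (fun d => by rw [opK_opK, opK_opK, add_comm]) (fun d => opK_opL χ π c d)
    (fun i a b => by rw [opK_vec, map_smul, opE_vec_nil, smul_zero]) i

theorem opL_opE (χ : Bicharacter A K) (π : Fin l → A) (c : A) (i : Fin l) :
    opL χ π c * opE χ π i = (χ (-π i) c : K) • (opE χ π i * opL χ π c) :=
  comm_opE χ π (fun j => χ (-π j) c) _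
    (fun j => by rw [opL_opF, χ.neg_left, Units.val_inv_eq_inv_val, inv_inv])
    (fun d => (opK_opL χ π d c).symm) (fun d => by rw [opL_opL, opL_opL, add_comm])
    (fun i a b => by rw [opL_vec, map_smul, opE_vec_nil, smul_zero]) i

/-- The action of `Ũ` on its universal Verma module. -/
def vermaRep (χ : Bicharacter A K) (π : Fin l → A) :
    PreU χ π →ₐ[K] Module.End K (Verma A K l) :=
  RingQuot.liftAlgHom K ⟨FreeAlgebra.lift K (opGen χ π), by
    intro x y h
    induction h with
    | K_zero => simpa [opGen] using opK_zero χ π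
    | L_zero => simpa [opGen] using opL_zero χ π
    | K_add a b => simpa [opGen] using opK_opK χ π a b
    | L_add a b => simpa [opGen] using opL_opL χ π a b
    | K_L a b => simpa [opGen] using opK_opL χ π a b
    | K_E a i => simpa [opGen] using opK_opE χ π a i
    | L_E a i => simpa [opGen] using opL_opE χ π a i
    | K_F a i => simpa [opGen] using opK_opF χ π a i
    | L_F a i => simpa [opGen] using opL_opF χ π a i
    | E_F i j =>
      have h := opE_opF χ π i j
      split_ifs at h ⊢ with hij <;> simpa [opGen] using h⟩

/-- The part of a vector of the universal Verma module that involves the empty word only. -/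
def topPart : Verma A K l →ₗ[K] (A × A →₀ K) :=
  Finsupp.lcomapDomain (fun p : A × A => (([] : List (Fin l)), p)) fun _ _ h => (Prod.mk.inj h).2

/-- The Harish-Chandra projection `Ũ → Ũ⁰`, in coordinates with respect to the `K_a L_b`. -/
def preSh (χ : Bicharacter A K) (π : Fin l → A) : PreU χ π →ₗ[K] (A × A →₀ K) :=
  topPart ∘ₗ LinearMap.applyₗ (vec K ([] : List (Fin l)) (0 : A) (0 : A)) ∘ₗ
    (vermaRep χ π).toLinearMap

/-! ### The generalized quantum group `U(χ,π)` -/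

/-- The largest two-sided ideal of `Ũ` on which the Harish-Chandra projection vanishes. It
contains every homogeneous `X ∈ Ũ⁺` (and `Y ∈ Ũ⁻`) of nonzero degree that commutes with all `F_i`
(with all `E_i`), so these become zero in the quotient; it is generated by its intersections with
`Ũ⁺` and `Ũ⁻`, so the quotient keeps the triangular decomposition. -/
def radicalIdeal (χ : Bicharacter A K) (π : Fin l → A) : Ideal (PreU χ π) where
  carrier := {x | ∀ a b, preSh χ π (a * x * b) = 0}
  add_mem' {x y} hx hy a b := by rw [mul_add, add_mul, map_add, hx, hy, add_zero]
  zero_mem' a b := by simp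
  smul_mem' c x hx a b := by
    rw [smul_eq_mul, ← mul_assoc]
    exact hx _ _

instance (χ : Bicharacter A K) (π : Fin l → A) : (radicalIdeal χ π).IsTwoSided where
  mul_mem_of_left {x} c hx a b := by
    rw [← mul_assoc, mul_assoc (a * x)]
    exact hx _ _

/-- The generalized quantum group `U = U(χ,π)`: the quotient of `Ũ` with triangular decomposition
`U⁻ ⊗ U⁰ ⊗ U⁺` in which a homogeneous element of `U⁺` (of `U⁻`) of nonzero degree that commutes
with all `F_i` (all `E_i`) is zero. -/
def GQG (χ : Bicharacter A K) (π : Fin l → A) : Type (max u v) := PreU χ π ⧸ radicalIdeal χ π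

instance (χ : Bicharacter A K) (π : Fin l → A) : Ring (GQG χ π) :=
  inferInstanceAs (Ring (PreU χ π ⧸ radicalIdeal χ π))

instance (χ : Bicharacter A K) (π : Fin l → A) : Algebra K (GQG χ π) :=
  inferInstanceAs (Algebra K (PreU χ π ⧸ radicalIdeal χ π))

/-- The projection `Ũ → U`. -/
def toGQG (χ : Bicharacter A K) (π : Fin l → A) : PreU χ π →ₐ[K] GQG χ π :=
  Ideal.Quotient.mkₐ K (radicalIdeal χ π)

/-- The generators of `U`. -/
def gen (χ : Bicharacter A K) (π : Fin l → A) (g : Gen A l) : GQG χ π :=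
  toGQG χ π (RingQuot.mkAlgHom K (Rel χ π) (free K g))

/-- The element `K_a L_b` of `U`. -/
def KL (χ : Bicharacter A K) (π : Fin l → A) (a b : A) : GQG χ π :=
  gen χ π (.K a) * gen χ π (.L b)

/-- The Harish-Chandra projection of `U` in coordinates with respect to the `K_a L_b`. -/
def shCoeff (χ : Bicharacter A K) (π : Fin l → A) : GQG χ π →ₗ[K] (A × A →₀ K) :=
  ((radicalIdeal χ π).restrictScalars K).liftQ (preSh χ π) fun x hx => by
    simpa using hx 1 1

/-- The Harish-Chandra projection `Sh : U → U⁰ ⊆ U`. -/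
def Sh (χ : Bicharacter A K) (π : Fin l → A) : GQG χ π →ₗ[K] GQG χ π :=
  Finsupp.linearCombination K (fun p : A × A => KL χ π p.1 p.2) ∘ₗ shCoeff χ π

/-! ### Grading, subalgebras, skew center -/

/-- The degree of a generator: `0` for `K_a` and `L_a`, `α_i` for `E_i`, `-α_i` for `F_i`. -/
def genDeg (π : Fin l → A) : Gen A l → A
  | .K _ => 0
  | .L _ => 0
  | .E i => π i
  | .F i => -π i

/-- The homogeneous part `U_λ`: the span of all products of generators of total degree `λ`. -/
def homPart (χ : Bicharacter A K) (π : Fin l → A) (lam : A) : Submodule K (GQG χ π) :=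
  Submodule.span K {x | ∃ w : List (Gen A l),
    (w.map (genDeg π)).sum = lam ∧ (w.map (gen χ π)).prod = x}

/-- The subalgebra `U⁻` generated by the `F_i`. -/
def Uminus (χ : Bicharacter A K) (π : Fin l → A) : Subalgebra K (GQG χ π) :=
  Algebra.adjoin K (Set.range fun i => gen χ π (.F i))

/-- The homogeneous part `U⁻_λ = U⁻ ∩ U_λ`. -/
def UminusPart (χ : Bicharacter A K) (π : Fin l → A) (lam : A) : Submodule K (GQG χ π) :=
  Subalgebra.toSubmodule (Uminus χ π) ⊓ homPart χ π lam

/-- The `ω`-skew center `Z_ω(U)`. -/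
def skewCenter (χ : Bicharacter A K) (π : Fin l → A) (ω : A → Kˣ) :
    Submodule K (GQG χ π) where
  carrier := {Z | Z ∈ homPart χ π 0 ∧
    ∀ lam : A, ∀ X ∈ homPart χ π lam, Z * X = (ω lam : K) • (X * Z)}
  add_mem' {x y} hx hy := ⟨add_mem hx.1 hy.1, fun lam X hX => by
    rw [add_mul, mul_add, smul_add, hx.2 lam X hX, hy.2 lam X hX]⟩
  zero_mem' := ⟨zero_mem _, fun lam X _ => by simp⟩
  smul_mem' c x hx := ⟨Submodule.smul_mem _ _ hx.1, fun lam X hX => by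
    rw [smul_mul_assoc, mul_smul_comm, hx.2 lam X hX, smul_comm]⟩

/-- The cone `A_π⁺ = ∑ ℤ_{≥0} α_i`. -/
def posCone (π : Fin l → A) : AddSubmonoid A := AddSubmonoid.closure (Set.range π)

/-! ### Highest-weight modules -/

section Modules

variable {M : Type*} [AddCommGroup M] [Module K M]

/-- The subspace `U⁻_{-ν} v` of a `U`-module. -/
def weightOrbit (χ : Bicharacter A K) (π : Fin l → A) [Module (GQG χ π) M]
    [IsScalarTower K (GQG χ π) M] (v : M) (ν : A) : Submodule K M :=
  (UminusPart χ π (-ν)).map ((LinearMap.toSpanSingleton (GQG χ π) M v).restrictScalars K)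

/-- `M` is the simple highest-weight module `ℒ(Λ)`, with highest-weight vector `v_Λ = v`. The
highest weight `Λ` is an algebra homomorphism from `U⁰` to the field, and is given here by its
values `Λ(K_a L_b) = Λ a b`. -/
structure IsSimpleHighestWeight (χ : Bicharacter A K) (π : Fin l → A) (Λ : A → A → K)
    [Module (GQG χ π) M] [IsScalarTower K (GQG χ π) M] (v : M) : Prop where
  simple : IsSimpleModule (GQG χ π) M
  ne_zero : v ≠ 0
  indep : iSupIndep fun ν : posCone π => weightOrbit χ π v (ν : A)
  span_eq_top : ⨆ ν : posCone π, weightOrbit χ π v (ν : A) = ⊤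
  weight : ∀ a b : A, KL χ π a b • v = Λ a b • v
  gen_E : ∀ i : Fin l, gen χ π (.E i) • v = 0

end Modules

/-- The weight `Λ_{λ,μ}`, `K_a L_b ↦ χ(λ,b) χ(a,μ) ω(a)`. -/
def weightLM (χ : Bicharacter A K) (ω : A → Kˣ) (lam mu : A) (a b : A) : K :=
  χ lam b * χ a mu * ω a

/-- The homomorphism `ρ̂ : A → Kˣ` with `ρ̂(α_j) = χ(α_j,α_j)`, if the `α_j` form a basis of
`A`. -/
def rhoHat (χ : Bicharacter A K) (π : Module.Basis (Fin l) ℤ A) (lam : A) : Kˣ :=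
  ∏ j, χ (π j) (π j) ^ (π.repr lam j)

end Algebra

/-! ### Properties of the definitions

The generators of `U` satisfy the defining relations; the `K_a L_b` are linearly independent;
`U` is the direct sum of the `U_λ`; `U = U⁻ U⁰ U⁺`; a homogeneous element of `U⁺` (of `U⁻`) of
nonzero degree that commutes with all `F_i` (all `E_i`) is zero; `Sh` is the identity on `U⁰` and
vanishes on `F_i U` and on `U E_i`; for every algebra homomorphism `Λ : U⁰ → K` the simple
highest-weight module `ℒ(Λ)` exists. -/

section Facts

variable {A : Type u} {K : Type v} [AddCommGroup A] [Field K] {l : ℕ}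
variable (χ : Bicharacter A K) (π : Fin l → A)

/-- The map from the free algebra to `U`. -/
def freeToGQG : FreeAlgebra K (Gen A l) →ₐ[K] GQG χ π :=
  (toGQG χ π).comp (RingQuot.mkAlgHom K (Rel χ π))

theorem freeToGQG_surjective : Function.Surjective (freeToGQG χ π) :=
  (Ideal.Quotient.mkₐ_surjective K (radicalIdeal χ π)).comp
    (RingQuot.mkAlgHom_surjective K (Rel χ π))

/-- The generators of `U` satisfy the defining relations of `Ũ`. -/
theorem freeToGQG_rel {x y : FreeAlgebra K (Gen A l)} (h : Rel χ π x y) :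
    freeToGQG χ π x = freeToGQG χ π y :=
  congrArg (toGQG χ π) (RingQuot.mkAlgHom_rel K h)

theorem gen_K_zero : gen χ π (.K 0) = 1 := by
  simpa [freeToGQG, gen] using freeToGQG_rel χ π (.K_zero)

theorem gen_L_zero : gen χ π (.L 0) = 1 := by
  simpa [freeToGQG, gen] using freeToGQG_rel χ π (.L_zero)

theorem gen_K_add (a b : A) : gen χ π (.K a) * gen χ π (.K b) = gen χ π (.K (a + b)) := by
  simpa [freeToGQG, gen] using freeToGQG_rel χ π (.K_add a b)

theorem gen_L_add (a b : A) : gen χ π (.L a) * gen χ π (.L b) = gen χ π (.L (a + b)) := by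
  simpa [freeToGQG, gen] using freeToGQG_rel χ π (.L_add a b)

theorem gen_K_L (a b : A) :
    gen χ π (.K a) * gen χ π (.L b) = gen χ π (.L b) * gen χ π (.K a) := by
  simpa [freeToGQG, gen] using freeToGQG_rel χ π (.K_L a b)

theorem gen_K_E (a : A) (i : Fin l) : gen χ π (.K a) * gen χ π (.E i) =
    (χ a (π i) : K) • (gen χ π (.E i) * gen χ π (.K a)) := by
  simpa [freeToGQG, gen] using freeToGQG_rel χ π (.K_E a i)

theorem gen_L_E (a : A) (i : Fin l) : gen χ π (.L a) * gen χ π (.E i) =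
    (χ (-π i) a : K) • (gen χ π (.E i) * gen χ π (.L a)) := by
  simpa [freeToGQG, gen] using freeToGQG_rel χ π (.L_E a i)

theorem gen_K_F (a : A) (i : Fin l) : gen χ π (.K a) * gen χ π (.F i) =
    (χ a (-π i) : K) • (gen χ π (.F i) * gen χ π (.K a)) := by
  simpa [freeToGQG, gen] using freeToGQG_rel χ π (.K_F a i)

theorem gen_L_F (a : A) (i : Fin l) : gen χ π (.L a) * gen χ π (.F i) =
    (χ (π i) a : K) • (gen χ π (.F i) * gen χ π (.L a)) := by
  simpa [freeToGQG, gen] using freeToGQG_rel χ π (.L_F a i)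

theorem gen_E_F (i j : Fin l) :
    gen χ π (.E i) * gen χ π (.F j) - gen χ π (.F j) * gen χ π (.E i) =
      if i = j then -gen χ π (.K (π i)) + gen χ π (.L (π i)) else 0 := by
  have h := freeToGQG_rel χ π (.E_F i j)
  split_ifs at h ⊢ <;> simpa [freeToGQG, gen] using h

/-- Every `u : U` is a sum of products of generators. -/
theorem span_words : Submodule.span K
    {x | ∃ w : List (Gen A l), (w.map (gen χ π)).prod = x} = ⊤ := by
  rw [eq_top_iff]
  rintro x -
  obtain ⟨y, rfl⟩ := freeToGQG_surjective χ π x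
  induction y using FreeAlgebra.induction with
  | grade0 r =>
    rw [AlgHom.commutes, Algebra.algebraMap_eq_smul_one]
    exact Submodule.smul_mem _ _ (Submodule.subset_span ⟨[], rfl⟩)
  | grade1 g => exact Submodule.subset_span ⟨[g], by simp [freeToGQG, gen]⟩
  | mul a b ha hb =>
    rw [map_mul]
    refine Submodule.span_induction₂ (p := fun x y _ _ => x * y ∈ Submodule.span K _)
      ?_ ?_ ?_ ?_ ?_ ?_ ?_ ha hb
    · rintro x y ⟨w, rfl⟩ ⟨w', rfl⟩
      exact Submodule.subset_span ⟨w ++ w', by simp⟩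
    · intro y _; simp
    · intro y _; simp
    · intro x y z _ _ _ h1 h2; rw [add_mul]; exact add_mem h1 h2
    · intro x y z _ _ _ h1 h2; rw [mul_add]; exact add_mem h1 h2
    · intro r x y _ _ h; rw [smul_mul_assoc]; exact Submodule.smul_mem _ _ h
    · intro r x y _ _ h; rw [mul_smul_comm]; exact Submodule.smul_mem _ _ h
  | add a b ha hb => rw [map_add]; exact add_mem ha hb

/-- A subspace of a `U`-module that is stable under the generators is stable under `U`. -/
theorem smul_mem_of_gen {M : Type*} [AddCommGroup M] [Module K M] [Module (GQG χ π) M]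
    [IsScalarTower K (GQG χ π) M] (W : Submodule K M)
    (h : ∀ g, ∀ m ∈ W, gen χ π g • m ∈ W) (x : GQG χ π) (m : M) (hm : m ∈ W) : x • m ∈ W := by
  have hx : x ∈ Submodule.span K {x | ∃ w : List (Gen A l), (w.map (gen χ π)).prod = x} := by
    rw [span_words]; trivial
  induction hx using Submodule.span_induction with
  | mem x hx =>
    obtain ⟨w, rfl⟩ := hx
    induction w with
    | nil => simpa using hm
    | cons g w ih =>
      rw [List.map_cons, List.prod_cons, mul_smul]
      exact h _ _ ih
  | zero => simp
  | add x y _ _ hx hy => rw [add_smul]; exact add_mem hx hy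
  | smul r x _ hx => rw [smul_assoc]; exact Submodule.smul_mem _ _ hx

/-- The operator of a product of generators on the universal Verma module. -/
def opWord (w : List (Gen A l)) : Module.End K (Verma A K l) := (w.map (opGen χ π)).prod

theorem shCoeff_word (w : List (Gen A l)) :
    shCoeff χ π (w.map (gen χ π)).prod = topPart (opWord χ π w (vec K [] 0 0)) := by
  have h1 : (w.map (gen χ π)).prod =
      toGQG χ π (w.map fun g => RingQuot.mkAlgHom K (Rel χ π) (free K g)).prod := by
    rw [map_list_prod, List.map_map]; rfl
  rw [h1]
  change topPart (vermaRep χ π _ _) = _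
  rw [map_list_prod, List.map_map, opWord]
  congr 4
  funext g
  simp [vermaRep]

@[simp] theorem topPart_nil (a b : A) : topPart (vec K ([] : List (Fin l)) a b) =
    Finsupp.single (a, b) 1 := by
  classical
  ext p
  change (vec K ([] : List (Fin l)) a b) ([], p) = _
  simp [Finsupp.single_apply]

@[simp] theorem topPart_cons (i : Fin l) (w : List (Fin l)) (a b : A) :
    topPart (vec K (i :: w) a b) = 0 := by
  classical
  ext p
  change (vec K (i :: w) a b) ([], p) = _
  simp

theorem topPart_opF (i : Fin l) (x : Verma A K l) : topPart (opF A K i x) = 0 := by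
  have : topPart ∘ₗ opF A K i = 0 := by
    refine Finsupp.lhom_ext' fun p => LinearMap.ext_ring ?_
    change topPart (opF A K i (vec K p.1 p.2.1 p.2.2)) = 0
    simp
  exact LinearMap.congr_fun this x

theorem shCoeff_ext {N : Type*} [AddCommGroup N] [Module K N] {f g : GQG χ π →ₗ[K] N}
    (h : ∀ w : List (Gen A l), f (w.map (gen χ π)).prod = g (w.map (gen χ π)).prod) : f = g :=
  LinearMap.ext_on (span_words χ π) (by rintro _ ⟨w, rfl⟩; exact h w)

theorem shCoeff_F_mul (i : Fin l) (x : GQG χ π) : shCoeff χ π (gen χ π (.F i) * x) = 0 := by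
  have : shCoeff χ π ∘ₗ LinearMap.mulLeft K (gen χ π (.F i)) = 0 :=
    shCoeff_ext χ π fun w => by
      have := shCoeff_word χ π (.F i :: w)
      simpa [opWord, opGen, topPart_opF] using this
  exact LinearMap.congr_fun this x

theorem shCoeff_mul_E (i : Fin l) (x : GQG χ π) : shCoeff χ π (x * gen χ π (.E i)) = 0 := by
  have : shCoeff χ π ∘ₗ LinearMap.mulRight K (gen χ π (.E i)) = 0 :=
    shCoeff_ext χ π fun w => by
      have := shCoeff_word χ π (w ++ [.E i])
      simpa [opWord, opGen] using this
  exact LinearMap.congr_fun this x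

theorem shCoeff_KL (a b : A) : shCoeff χ π (KL χ π a b) = Finsupp.single (a, b) 1 := by
  have := shCoeff_word χ π [.K a, .L b]
  simpa [opWord, opGen, KL, wordWt, χ.zero_left, χ.zero_right] using this

/-- `(K_a L_b)` is linearly independent in `U`. -/
theorem linearIndependent_KL :
    LinearIndependent K (fun p : A × A => KL χ π p.1 p.2) := by
  refine LinearIndependent.of_comp (shCoeff χ π) ?_
  have : (shCoeff χ π ∘ fun p : A × A => KL χ π p.1 p.2) =
      fun p => Finsupp.single p (1 : K) := by
    funext p; exact shCoeff_KL χ π p.1 p.2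
  rw [this]
  exact (Finsupp.basisSingleOne (R := K) (ι := A × A)).linearIndependent

theorem Sh_KL (a b : A) : Sh χ π (KL χ π a b) = KL χ π a b := by
  simp [Sh, shCoeff_KL]

theorem Sh_F_mul (i : Fin l) (x : GQG χ π) : Sh χ π (gen χ π (.F i) * x) = 0 := by
  simp [Sh, shCoeff_F_mul]

theorem Sh_mul_E (i : Fin l) (x : GQG χ π) : Sh χ π (x * gen χ π (.E i)) = 0 := by
  simp [Sh, shCoeff_mul_E]

/-- An element `x` of `U` with `Sh(a x b) = 0` for all `a, b` is zero. -/
theorem eq_zero_of_Sh (x : GQG χ π) (h : ∀ a b, Sh χ π (a * x * b) = 0) : x = 0 := by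
  have h' : ∀ a b, shCoeff χ π (a * x * b) = 0 := by
    intro a b
    have h1 := congrArg (shCoeff χ π) (h a b)
    rw [map_zero, Sh, LinearMap.comp_apply] at h1
    rw [← h1]
    have : shCoeff χ π ∘ₗ Finsupp.linearCombination K
        (fun p : A × A => KL χ π p.1 p.2) = LinearMap.id := by
      refine Finsupp.lhom_ext' fun p => LinearMap.ext_ring ?_
      simp [shCoeff_KL]
    exact (LinearMap.congr_fun this _).symm
  obtain ⟨y, rfl⟩ := Ideal.Quotient.mkₐ_surjective K (radicalIdeal χ π) x
  refine Ideal.Quotient.eq_zero_iff_mem.mpr fun a b => ?_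
  exact h' (toGQG χ π a) (toGQG χ π b)

/-! `U` is graded by the `U_λ`. -/

/-- The part of degree `d` of the universal Verma module. -/
def vermaDeg (d : A) : Submodule K (Verma A K l) :=
  Submodule.span K {x | ∃ w a b, -wordWt π w = d ∧ vec K w a b = x}

theorem vermaDeg_ind {d d' : A} (f : Module.End K (Verma A K l))
    (h : ∀ w a b, -wordWt π w = d → f (vec K w a b) ∈ vermaDeg π d') {x : Verma A K l}
    (hx : x ∈ vermaDeg (K := K) π d) : f x ∈ vermaDeg π d' := by
  have : vermaDeg (K := K) π d ≤ (vermaDeg π d').comap f := by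
    refine Submodule.span_le.mpr ?_
    rintro _ ⟨w, a, b, hw, rfl⟩
    exact h w a b hw
  exact this hx

theorem vec_mem (w : List (Fin l)) (a b : A) : vec K w a b ∈ vermaDeg π (-wordWt π w) :=
  Submodule.subset_span ⟨w, a, b, rfl, rfl⟩

theorem opF_deg (i : Fin l) {d : A} {x : Verma A K l} (hx : x ∈ vermaDeg (K := K) π d) :
    opF A K i x ∈ vermaDeg π (-π i + d) := by
  refine vermaDeg_ind π _ ?_ hx
  rintro w a b rfl
  rw [opF_vec]
  have := vec_mem (K := K) π (i :: w) a b
  rwa [wordWt, List.map_cons, List.sum_cons, neg_add] at this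

theorem opGen_deg (g : Gen A l) {d : A} {x : Verma A K l} (hx : x ∈ vermaDeg (K := K) π d) :
    opGen χ π g x ∈ vermaDeg π (genDeg π g + d) := by
  cases g with
  | K c =>
    refine vermaDeg_ind π _ ?_ hx
    rintro w a b rfl
    simp only [opGen, opK_vec, genDeg, zero_add]
    exact Submodule.smul_mem _ _ (vec_mem π _ _ _)
  | L c =>
    refine vermaDeg_ind π _ ?_ hx
    rintro w a b rfl
    simp only [opGen, opL_vec, genDeg, zero_add]
    exact Submodule.smul_mem _ _ (vec_mem π _ _ _)
  | F i => exact opF_deg π i hx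
  | E i =>
    refine vermaDeg_ind π _ ?_ hx
    rintro w a b rfl
    simp only [opGen, genDeg]
    clear hx
    induction w with
    | nil => simp
    | cons j w ih =>
      rw [opE_vec_cons]
      refine add_mem ?_ ?_
      · have := opF_deg π j ih
        convert this using 1
        simp [wordWt]; abel_nf
      · split_ifs with hij
        · subst hij
          have : π i + -wordWt π (i :: w) = -wordWt π w := by simp [wordWt]
          rw [this, opK_vec, opL_vec]
          exact add_mem (neg_mem (Submodule.smul_mem _ _ (vec_mem π _ _ _)))
            (Submodule.smul_mem _ _ (vec_mem π _ _ _))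
        · exact zero_mem _

theorem word_deg (w : List (Gen A l)) :
    opWord χ π w (vec K [] 0 0) ∈ vermaDeg π (w.map (genDeg π)).sum := by
  induction w with
  | nil => simpa [opWord, wordWt] using vec_mem (K := K) π [] 0 0
  | cons g w ih =>
    have := opGen_deg χ π g ih
    simpa [opWord] using this

theorem topPart_deg {d : A} (hd : d ≠ 0) {x : Verma A K l} (hx : x ∈ vermaDeg (K := K) π d) :
    topPart x = 0 := by
  have : vermaDeg (K := K) π d ≤ LinearMap.ker topPart := by
    refine Submodule.span_le.mpr ?_
    rintro _ ⟨w, a, b, hw, rfl⟩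
    cases w with
    | nil => simp [wordWt] at hw; exact absurd hw.symm hd
    | cons i w => simp
  exact this hx

theorem shCoeff_deg {d : A} (hd : d ≠ 0) {x : GQG χ π} (hx : x ∈ homPart χ π d) :
    shCoeff χ π x = 0 := by
  have : homPart χ π d ≤ LinearMap.ker (shCoeff χ π) := by
    refine Submodule.span_le.mpr ?_
    rintro _ ⟨w, hw, rfl⟩
    rw [SetLike.mem_coe, LinearMap.mem_ker, shCoeff_word]
    exact topPart_deg π hd (hw ▸ word_deg χ π w)
  exact this hx

theorem homPart_mul {d d' : A} {x y : GQG χ π} (hx : x ∈ homPart χ π d)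
    (hy : y ∈ homPart χ π d') : x * y ∈ homPart χ π (d + d') := by
  refine Submodule.span_induction₂ (p := fun x y _ _ => x * y ∈ homPart χ π (d + d'))
      ?_ ?_ ?_ ?_ ?_ ?_ ?_ hx hy
  · rintro x y ⟨w, hw, rfl⟩ ⟨w', hw', rfl⟩
    exact Submodule.subset_span ⟨w ++ w', by simp [hw, hw']⟩
  · intro y _; simp
  · intro y _; simp
  · intro x y z _ _ _ h1 h2; rw [add_mul]; exact add_mem h1 h2
  · intro x y z _ _ _ h1 h2; rw [mul_add]; exact add_mem h1 h2
  · intro r x y _ _ h; rw [smul_mul_assoc]; exact Submodule.smul_mem _ _ h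
  · intro r x y _ _ h; rw [mul_smul_comm]; exact Submodule.smul_mem _ _ h

theorem iSup_homPart : ⨆ d, homPart χ π d = ⊤ := by
  rw [eq_top_iff, ← span_words χ π, Submodule.span_le]
  rintro _ ⟨w, rfl⟩
  exact Submodule.mem_iSup_of_mem (w.map (genDeg π)).sum (Submodule.subset_span ⟨w, rfl, rfl⟩)

/-- `U` is the direct sum of the `U_λ`. -/
theorem iSupIndep_homPart : iSupIndep (homPart χ π) := by
  intro d
  rw [Submodule.disjoint_def]
  intro x hx hx'
  have key : ∀ (a b : List (Gen A l)), shCoeff χ π ((a.map (gen χ π)).prod * x *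
      (b.map (gen χ π)).prod) = 0 := by
    intro a b
    have h : ∀ d' y, y ∈ homPart χ π d' → (a.map (genDeg π)).sum + d' + (b.map (genDeg π)).sum ≠ 0
        → shCoeff χ π ((a.map (gen χ π)).prod * y * (b.map (gen χ π)).prod) = 0 :=
      fun d' y hy hne => shCoeff_deg χ π hne (homPart_mul χ π (homPart_mul χ π
        (Submodule.subset_span ⟨a, rfl, rfl⟩) hy) (Submodule.subset_span ⟨b, rfl, rfl⟩))
    by_cases h0 : (a.map (genDeg π)).sum + d + (b.map (genDeg π)).sum = 0
    · have hle : ⨆ j, ⨆ (_ : j ≠ d), homPart χ π j ≤ LinearMap.ker (shCoeff χ π ∘ₗ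
          LinearMap.mulRight K (b.map (gen χ π)).prod ∘ₗ
          LinearMap.mulLeft K (a.map (gen χ π)).prod) := by
        refine iSup_le fun j => iSup_le fun hj => fun y hy => ?_
        refine h j y hy fun h1 => hj ?_
        rw [← h0] at h1
        exact add_left_cancel (add_right_cancel h1)
      exact hle hx'
    · exact h d x hx h0
  refine eq_zero_of_Sh χ π x fun a b => ?_
  have h1 : ∀ a : List (Gen A l), shCoeff χ π ∘ₗ
      LinearMap.mulLeft K ((a.map (gen χ π)).prod * x) = 0 := fun a =>
    shCoeff_ext χ π fun w => key a w
  have h2 : shCoeff χ π ∘ₗ LinearMap.mulRight K b ∘ₗ LinearMap.mulRight K x = 0 :=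
    shCoeff_ext χ π fun w => LinearMap.congr_fun (h1 w) b
  have h3 : shCoeff χ π (a * x * b) = 0 := LinearMap.congr_fun h2 a
  simp [Sh, h3]

/-! `U` is spanned by the products `F_w K_a L_b E_{w'}`. -/

section Mod
variable {M : Type*} [AddCommGroup M] [Module K M] [Module (GQG χ π) M]
    [IsScalarTower K (GQG χ π) M]

/-- `F_{w₁} ⋯ F_{w_n}` in `U`. -/
def Fw (w : List (Fin l)) : GQG χ π := (w.map fun i => gen χ π (.F i)).prod

theorem gen_smul_Fw (S : Submodule K M) (hE : ∀ i, ∀ s ∈ S, gen χ π (.E i) • s ∈ S)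
    (hK : ∀ a, ∀ s ∈ S, gen χ π (.K a) • s ∈ S) (hL : ∀ a, ∀ s ∈ S, gen χ π (.L a) • s ∈ S)
    (x : GQG χ π) (m : M) (hm : m ∈ S) :
    x • m ∈ Submodule.span K {y | ∃ w, ∃ s ∈ S, Fw χ π w • s = y} := by
  set W := Submodule.span K {y | ∃ w, ∃ s ∈ S, Fw χ π w • s = y} with hW
  have cons : ∀ j w (s : M), Fw χ π (j :: w) • s = gen χ π (.F j) • (Fw χ π w • s) := by
    intro j w s; simp [Fw, mul_smul]
  have ind : ∀ g, (∀ w, ∀ s ∈ S, gen χ π g • (Fw χ π w • s) ∈ W) →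
      ∀ y ∈ W, gen χ π g • y ∈ W := by
    intro g hg y hy
    induction hy using Submodule.span_induction with
    | mem x hx => obtain ⟨w, s, hs, rfl⟩ := hx; exact hg w s hs
    | zero => simp
    | add x y _ _ hx hy => rw [smul_add]; exact add_mem hx hy
    | smul r x _ hx => rw [smul_comm]; exact Submodule.smul_mem _ _ hx
  have sF : ∀ j, ∀ y ∈ W, gen χ π (.F j) • y ∈ W := fun j => ind _ fun w s hs =>
    Submodule.subset_span ⟨j :: w, s, hs, cons j w s⟩
  have sK : ∀ a, ∀ y ∈ W, gen χ π (.K a) • y ∈ W := fun a => ind _ fun w s hs => by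
    induction w with
    | nil => exact Submodule.subset_span ⟨[], _, hK a s hs, by simp [Fw]⟩
    | cons j w ih =>
      rw [cons, ← mul_smul, gen_K_F, smul_assoc, mul_smul]
      exact Submodule.smul_mem _ _ (sF _ _ ih)
  have sL : ∀ a, ∀ y ∈ W, gen χ π (.L a) • y ∈ W := fun a => ind _ fun w s hs => by
    induction w with
    | nil => exact Submodule.subset_span ⟨[], _, hL a s hs, by simp [Fw]⟩
    | cons j w ih =>
      rw [cons, ← mul_smul, gen_L_F, smul_assoc, mul_smul]
      exact Submodule.smul_mem _ _ (sF _ _ ih)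
  have sE : ∀ i, ∀ y ∈ W, gen χ π (.E i) • y ∈ W := fun i => ind _ fun w s hs => by
    induction w with
    | nil => exact Submodule.subset_span ⟨[], _, hE i s hs, by simp [Fw]⟩
    | cons j w ih =>
      rw [cons, ← mul_smul, sub_eq_iff_eq_add'.mp (gen_E_F χ π i j), add_smul, mul_smul]
      refine add_mem (sF _ _ ih) ?_
      have hw : Fw χ π w • s ∈ W := Submodule.subset_span ⟨w, s, hs, rfl⟩
      split_ifs
      · rw [add_smul, neg_smul]
        exact add_mem (neg_mem (sK _ _ hw)) (sL _ _ hw)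
      · simp
  refine smul_mem_of_gen χ π W ?_ x m (Submodule.subset_span ⟨[], m, hm, by simp [Fw]⟩)
  rintro (a | a | i | i)
  exacts [sK a, sL a, sE i, sF i]

end Mod

/-- The subalgebra `U⁺` generated by the `E_i`. -/
def Uplus : Subalgebra K (GQG χ π) :=
  Algebra.adjoin K (Set.range fun i => gen χ π (.E i))

/-- `E_{w₁} ⋯ E_{w_n}` in `U`. -/
def Ew (w : List (Fin l)) : GQG χ π := (w.map fun i => gen χ π (.E i)).prod

theorem K_mul_KL (c a b : A) : gen χ π (.K c) * KL χ π a b = KL χ π (c + a) b := by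
  rw [KL, ← mul_assoc, gen_K_add, KL]

theorem L_mul_KL (c a b : A) : gen χ π (.L c) * KL χ π a b = KL χ π a (c + b) := by
  rw [KL, ← mul_assoc, ← gen_K_L, mul_assoc, gen_L_add, KL]

theorem KL_zero : KL χ π 0 0 = 1 := by rw [KL, gen_K_zero, gen_L_zero, mul_one]

theorem E_mul_K (a : A) (i : Fin l) : gen χ π (.E i) * gen χ π (.K a) =
    ((χ a (π i))⁻¹ : K) • (gen χ π (.K a) * gen χ π (.E i)) := by
  rw [gen_K_E, smul_smul, inv_mul_cancel₀ (Units.ne_zero _), one_smul]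

theorem E_mul_L (a : A) (i : Fin l) : gen χ π (.E i) * gen χ π (.L a) =
    ((χ (-π i) a)⁻¹ : K) • (gen χ π (.L a) * gen χ π (.E i)) := by
  rw [gen_L_E, smul_smul, inv_mul_cancel₀ (Units.ne_zero _), one_smul]

theorem KL_mul_F (a b : A) (i : Fin l) : ∃ c : K, KL χ π a b * gen χ π (.F i) =
    c • (gen χ π (.F i) * KL χ π a b) := by
  refine ⟨(χ (π i) b : K) * (χ a (-π i) : K), ?_⟩
  rw [KL, mul_assoc, gen_L_F, mul_smul_comm, ← mul_assoc, gen_K_F, smul_mul_assoc, smul_smul,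
    mul_assoc]

theorem E_mul_KL (a b : A) (i : Fin l) : ∃ c : K, gen χ π (.E i) * KL χ π a b =
    c • (KL χ π a b * gen χ π (.E i)) := by
  refine ⟨((χ a (π i))⁻¹ : K) * ((χ (-π i) b)⁻¹ : K), ?_⟩
  rw [KL, ← mul_assoc, E_mul_K, smul_mul_assoc, mul_assoc, E_mul_L, mul_smul_comm, smul_smul,
    ← mul_assoc]

/-- Triangular decomposition, spanning part. -/
theorem span_triangular : Submodule.span K
    {x | ∃ w a b w', Fw χ π w * KL χ π a b * Ew χ π w' = x} = ⊤ := by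
  rw [eq_top_iff]
  rintro x -
  set S : Submodule K (GQG χ π) := Submodule.span K {x | ∃ a b w', KL χ π a b * Ew χ π w' = x}
  have ind : ∀ g, (∀ a b w, gen χ π g * (KL χ π a b * Ew χ π w) ∈ S) →
      ∀ y ∈ S, gen χ π g • y ∈ S := by
    intro g hg y hy
    induction hy using Submodule.span_induction with
    | mem x hx => obtain ⟨a, b, w, rfl⟩ := hx; exact hg a b w
    | zero => simp
    | add x y _ _ hx hy => rw [smul_add]; exact add_mem hx hy
    | smul r x _ hx => rw [smul_comm]; exact Submodule.smul_mem _ _ hx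
  have h := gen_smul_Fw χ π S
    (fun i => ind _ fun a b w => by
      obtain ⟨c, hc⟩ := E_mul_KL χ π a b i
      rw [← mul_assoc, hc, smul_mul_assoc, mul_assoc]
      exact Submodule.smul_mem _ _ (Submodule.subset_span ⟨a, b, i :: w, by simp [Ew]⟩))
    (fun c => ind _ fun a b w => Submodule.subset_span ⟨_, _, w, by
      rw [← mul_assoc, K_mul_KL]⟩)
    (fun c => ind _ fun a b w => Submodule.subset_span ⟨_, _, w, by
      rw [← mul_assoc, L_mul_KL]⟩) x 1
      (Submodule.subset_span ⟨0, 0, [], by simp [KL_zero, Ew]⟩)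
  rw [smul_eq_mul, mul_one] at h
  refine Submodule.span_le.mpr ?_ h
  rintro _ ⟨w, s, hs, rfl⟩
  induction hs using Submodule.span_induction with
  | mem x hx =>
    obtain ⟨a, b, w', rfl⟩ := hx
    exact Submodule.subset_span ⟨w, a, b, w', by rw [mul_assoc, smul_eq_mul]⟩
  | zero => simp
  | add x y _ _ hx hy => rw [smul_add]; exact add_mem hx hy
  | smul r x _ hx => rw [smul_comm]; exact Submodule.smul_mem _ _ hx

theorem Ew_deg (w : List (Fin l)) : Ew χ π w ∈ homPart χ π (wordWt π w) :=
  Submodule.subset_span ⟨w.map .E, by simp [wordWt, Function.comp_def, genDeg], by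
    simp [Ew, Function.comp_def]⟩

theorem Fw_deg (w : List (Fin l)) : Fw χ π w ∈ homPart χ π (-wordWt π w) :=
  Submodule.subset_span ⟨w.map .F, by
    simp only [List.map_map, Function.comp_def, genDeg, wordWt]
    rw [List.sum_neg, List.map_map]
    rfl, by simp [Fw, Function.comp_def]⟩

theorem KL_mul_KL (a b c d : A) : KL χ π a b * KL χ π c d = KL χ π (a + c) (b + d) := by
  rw [KL, mul_assoc, L_mul_KL, K_mul_KL]

theorem shCoeff_E_KL (y : GQG χ π) (i : Fin l) (a b : A) :
    shCoeff χ π (y * (gen χ π (.E i) * KL χ π a b)) = 0 := by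
  obtain ⟨c, hc⟩ := E_mul_KL χ π a b i
  rw [hc, mul_smul_comm, map_smul, ← mul_assoc, shCoeff_mul_E, smul_zero]

theorem Ew_append (w : List (Fin l)) (i : Fin l) :
    Ew χ π (w ++ [i]) = Ew χ π w * gen χ π (.E i) := by simp [Ew]

theorem Fw_cons (w : List (Fin l)) (i : Fin l) :
    Fw χ π (i :: w) = gen χ π (.F i) * Fw χ π w := by simp [Fw]

theorem Uplus_span : Subalgebra.toSubmodule (Uplus χ π) ≤
    Submodule.span K {x | ∃ w, Ew χ π w = x} := by
  rw [Uplus, Algebra.adjoin_eq_span, Submodule.span_le]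
  intro x hx
  refine Submodule.subset_span ?_
  induction hx using Submonoid.closure_induction with
  | mem x hx => obtain ⟨i, rfl⟩ := hx; exact ⟨[i], by simp [Ew]⟩
  | one => exact ⟨[], by simp [Ew]⟩
  | mul x y _ _ hx hy =>
    obtain ⟨w, rfl⟩ := hx
    obtain ⟨w', rfl⟩ := hy
    exact ⟨w ++ w', by simp [Ew]⟩

/-- A homogeneous element of `U⁺` of nonzero degree that commutes with all `F_i` is zero. -/
theorem eq_zero_of_comm_F {d : A} (hd : d ≠ 0) (X : GQG χ π) (hX : X ∈ Uplus χ π)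
    (hX' : X ∈ homPart χ π d) (h : ∀ i, X * gen χ π (.F i) = gen χ π (.F i) * X) : X = 0 := by
  have hdec : ∀ X ∈ Submodule.span K {x | ∃ w, Ew χ π w = x}, ∃ c : K,
      X - c • 1 ∈ Submodule.span K {x | ∃ w i, Ew χ π w * gen χ π (.E i) = x} := by
    intro X hX
    induction hX using Submodule.span_induction with
    | mem x hx =>
      obtain ⟨w, rfl⟩ := hx
      rcases List.eq_nil_or_concat w with rfl | ⟨w, i, rfl⟩
      · exact ⟨1, by simp [Ew]⟩
      · exact ⟨0, by
          rw [zero_smul, sub_zero, List.concat_eq_append, Ew_append]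
          exact Submodule.subset_span ⟨w, i, rfl⟩⟩
    | zero => exact ⟨0, by simp⟩
    | add x y _ _ hx hy =>
      obtain ⟨c, hc⟩ := hx
      obtain ⟨d, hd⟩ := hy
      exact ⟨c + d, by rw [add_smul, add_sub_add_comm]; exact add_mem hc hd⟩
    | smul r x _ hx =>
      obtain ⟨c, hc⟩ := hx
      exact ⟨r * c, by rw [mul_smul, ← smul_sub]; exact Submodule.smul_mem _ _ hc⟩
  obtain ⟨c, hc⟩ := hdec X (Uplus_span χ π hX)
  have hSE : ∀ y a b, ∀ x ∈ Submodule.span K {x | ∃ w i, Ew χ π w * gen χ π (.E i) = x},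
      shCoeff χ π (y * (x * KL χ π a b)) = 0 := by
    intro y a b x hx
    induction hx using Submodule.span_induction with
    | mem x hx =>
      obtain ⟨w, i, rfl⟩ := hx
      rw [mul_assoc (Ew χ π w), ← mul_assoc y, shCoeff_E_KL]
    | zero => simp
    | add x y _ _ hx hy => rw [add_mul, mul_add, map_add, hx, hy, add_zero]
    | smul r x _ hx => rw [smul_mul_assoc, mul_smul_comm, map_smul, hx, smul_zero]
  have hc0 : c = 0 := by
    have h1 := hSE 1 0 0 _ hc
    rw [KL_zero, mul_one, one_mul, map_sub, shCoeff_deg χ π hd hX', ← KL_zero χ π, map_smul,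
      shCoeff_KL, zero_sub, neg_eq_zero] at h1
    simpa using h1
  rw [hc0, zero_smul, sub_zero] at hc
  have hFw : ∀ w, X * Fw χ π w = Fw χ π w * X := by
    intro w
    induction w with
    | nil => simp [Fw]
    | cons i w ih => rw [Fw_cons, ← mul_assoc, h, mul_assoc, ih, mul_assoc]
  refine eq_zero_of_Sh χ π X fun y z => ?_
  rw [Sh, LinearMap.comp_apply]
  have : shCoeff χ π ∘ₗ LinearMap.mulLeft K (y * X) = 0 := by
    refine LinearMap.ext_on (span_triangular χ π) ?_
    rintro _ ⟨w, a, b, w', rfl⟩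
    rw [LinearMap.comp_apply, LinearMap.mulLeft_apply, LinearMap.zero_apply]
    rcases List.eq_nil_or_concat w' with rfl | ⟨w', i, rfl⟩
    · have := hSE (y * Fw χ π w) a b X hc
      rw [show Ew χ π [] = 1 by simp [Ew], mul_one, mul_assoc, ← mul_assoc X, hFw, mul_assoc,
        ← mul_assoc y, this]
    · rw [List.concat_eq_append, Ew_append, ← mul_assoc, ← mul_assoc, shCoeff_mul_E]
  have h2 := LinearMap.congr_fun this z
  rw [LinearMap.comp_apply, LinearMap.mulLeft_apply, LinearMap.zero_apply] at h2
  rw [h2, map_zero]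

/-- `U⁻` is spanned by the products of the `F_i`. -/
theorem Uminus_span : Subalgebra.toSubmodule (Uminus χ π) ≤
    Submodule.span K {x | ∃ w, Fw χ π w = x} := by
  rw [Uminus, Algebra.adjoin_eq_span, Submodule.span_le]
  intro x hx
  refine Submodule.subset_span ?_
  induction hx using Submonoid.closure_induction with
  | mem x hx => obtain ⟨i, rfl⟩ := hx; exact ⟨[i], by simp [Fw]⟩
  | one => exact ⟨[], by simp [Fw]⟩
  | mul x y _ _ hx hy =>
    obtain ⟨w, rfl⟩ := hx
    obtain ⟨w', rfl⟩ := hy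
    exact ⟨w ++ w', by simp [Fw]⟩

theorem shCoeff_KL_F (y : GQG χ π) (i : Fin l) (a b : A) :
    shCoeff χ π (KL χ π a b * gen χ π (.F i) * y) = 0 := by
  obtain ⟨c, hc⟩ := KL_mul_F χ π a b i
  rw [hc, smul_mul_assoc, map_smul, mul_assoc, shCoeff_F_mul, smul_zero]

/-- A homogeneous element of `U⁻` of nonzero degree that commutes with all `E_i` is zero. -/
theorem eq_zero_of_comm_E {d : A} (hd : d ≠ 0) (Y : GQG χ π) (hY : Y ∈ Uminus χ π)
    (hY' : Y ∈ homPart χ π d) (h : ∀ i, gen χ π (.E i) * Y = Y * gen χ π (.E i)) : Y = 0 := by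
  have hdec : ∀ Y ∈ Submodule.span K {x | ∃ w, Fw χ π w = x}, ∃ c : K,
      Y - c • 1 ∈ Submodule.span K {x | ∃ w i, gen χ π (.F i) * Fw χ π w = x} := by
    intro Y hY
    induction hY using Submodule.span_induction with
    | mem x hx =>
      obtain ⟨w, rfl⟩ := hx
      cases w with
      | nil => exact ⟨1, by simp [Fw]⟩
      | cons i w => exact ⟨0, by
          rw [zero_smul, sub_zero, Fw_cons]
          exact Submodule.subset_span ⟨w, i, rfl⟩⟩
    | zero => exact ⟨0, by simp⟩
    | add x y _ _ hx hy =>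
      obtain ⟨c, hc⟩ := hx
      obtain ⟨d, hd⟩ := hy
      exact ⟨c + d, by rw [add_smul, add_sub_add_comm]; exact add_mem hc hd⟩
    | smul r x _ hx =>
      obtain ⟨c, hc⟩ := hx
      exact ⟨r * c, by rw [mul_smul, ← smul_sub]; exact Submodule.smul_mem _ _ hc⟩
  obtain ⟨c, hc⟩ := hdec Y (Uminus_span χ π hY)
  have hSF : ∀ y a b, ∀ x ∈ Submodule.span K {x | ∃ w i, gen χ π (.F i) * Fw χ π w = x},
      shCoeff χ π (KL χ π a b * x * y) = 0 := by
    intro y a b x hx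
    induction hx using Submodule.span_induction with
    | mem x hx =>
      obtain ⟨w, i, rfl⟩ := hx
      rw [← mul_assoc (KL χ π a b), mul_assoc _ _ y, shCoeff_KL_F]
    | zero => simp
    | add x y _ _ hx hy => rw [mul_add, add_mul, map_add, hx, hy, add_zero]
    | smul r x _ hx => rw [mul_smul_comm, smul_mul_assoc, map_smul, hx, smul_zero]
  have hc0 : c = 0 := by
    have h1 := hSF 1 0 0 _ hc
    rw [KL_zero, mul_one, one_mul, map_sub, shCoeff_deg χ π hd hY', ← KL_zero χ π, map_smul,
      shCoeff_KL, zero_sub, neg_eq_zero] at h1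
    simpa using h1
  rw [hc0, zero_smul, sub_zero] at hc
  have hEw : ∀ w, Ew χ π w * Y = Y * Ew χ π w := by
    intro w
    induction w with
    | nil => simp [Ew]
    | cons i w ih =>
      rw [show Ew χ π (i :: w) = gen χ π (.E i) * Ew χ π w by simp [Ew], mul_assoc, ih,
        ← mul_assoc, h, mul_assoc]
  refine eq_zero_of_Sh χ π Y fun y z => ?_
  rw [Sh, LinearMap.comp_apply]
  have : shCoeff χ π ∘ₗ LinearMap.mulRight K (Y * z) = 0 := by
    refine LinearMap.ext_on (span_triangular χ π) ?_
    rintro _ ⟨w, a, b, w', rfl⟩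
    rw [LinearMap.comp_apply, LinearMap.mulRight_apply, LinearMap.zero_apply]
    cases w with
    | nil =>
      have := hSF (Ew χ π w' * z) a b Y hc
      rw [show Fw χ π [] = 1 by simp [Fw], one_mul, mul_assoc, ← mul_assoc (Ew χ π w'), hEw,
        mul_assoc Y, ← mul_assoc, this]
    | cons i w => simp only [Fw_cons, mul_assoc, shCoeff_F_mul]
  have h2 := LinearMap.congr_fun this y
  rw [LinearMap.comp_apply, LinearMap.mulRight_apply, LinearMap.zero_apply] at h2
  rw [mul_assoc, h2, map_zero]

/-! For every algebra homomorphism `Λ : U⁰ → K` the module `ℒ(Λ)` exists. -/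

section Exist

variable (Λ : A → A → K)

/-- The functional `Λ ∘ Sh`. -/
def hwFun : GQG χ π →ₗ[K] K :=
  Finsupp.linearCombination K (fun p : A × A => Λ p.1 p.2) ∘ₗ shCoeff χ π

/-- The largest left ideal on which `Λ ∘ Sh` vanishes. -/
def hwIdeal : Submodule (GQG χ π) (GQG χ π) where
  carrier := {x | ∀ y, hwFun χ π Λ (y * x) = 0}
  add_mem' {a b} ha hb y := by rw [mul_add, map_add, ha, hb, add_zero]
  zero_mem' y := by simp
  smul_mem' c x hx y := by rw [smul_eq_mul, ← mul_assoc]; exact hx _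

theorem hwFun_F (i : Fin l) (x : GQG χ π) : hwFun χ π Λ (gen χ π (.F i) * x) = 0 := by
  simp [hwFun, shCoeff_F_mul]

theorem hwFun_E (i : Fin l) (x : GQG χ π) : hwFun χ π Λ (x * gen χ π (.E i)) = 0 := by
  simp [hwFun, shCoeff_mul_E]

theorem hwFun_KL (a b : A) : hwFun χ π Λ (KL χ π a b) = Λ a b := by simp [hwFun, shCoeff_KL]

theorem hwFun_KL_mul
    (hΛ : ∀ a b c d, Λ (a + c) (b + d) = Λ a b * Λ c d)
    (a b : A) (x : GQG χ π) :
    hwFun χ π Λ (KL χ π a b * x) = Λ a b * hwFun χ π Λ x := by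
  have : hwFun χ π Λ ∘ₗ LinearMap.mulLeft K (KL χ π a b) = Λ a b • hwFun χ π Λ := by
    refine LinearMap.ext_on (span_triangular χ π) ?_
    rintro _ ⟨w, c, d, w', rfl⟩
    simp only [LinearMap.comp_apply, LinearMap.mulLeft_apply, LinearMap.smul_apply, smul_eq_mul]
    rcases List.eq_nil_or_concat w' with rfl | ⟨w', i, rfl⟩
    · cases w with
      | nil => simp [Fw, Ew, KL_mul_KL, hwFun_KL, hΛ]
      | cons i w =>
        obtain ⟨r, hr⟩ := KL_mul_F χ π a b i
        rw [Fw_cons, mul_assoc (gen χ π (.F i)), mul_assoc (gen χ π (.F i)), hwFun_F, mul_zero,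
          ← mul_assoc, hr, smul_mul_assoc, map_smul, mul_assoc, hwFun_F, smul_zero]
    · rw [List.concat_eq_append, Ew_append, ← mul_assoc (Fw χ π w * _), hwFun_E, ← mul_assoc, hwFun_E, mul_zero]
  exact LinearMap.congr_fun this x

theorem hwFun_mul_KL
    (hΛ : ∀ a b c d, Λ (a + c) (b + d) = Λ a b * Λ c d)
    (a b : A) (x : GQG χ π) :
    hwFun χ π Λ (x * KL χ π a b) = hwFun χ π Λ x * Λ a b := by
  have : hwFun χ π Λ ∘ₗ LinearMap.mulRight K (KL χ π a b) = Λ a b • hwFun χ π Λ := by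
    refine LinearMap.ext_on (span_triangular χ π) ?_
    rintro _ ⟨w, c, d, w', rfl⟩
    simp only [LinearMap.comp_apply, LinearMap.mulRight_apply, LinearMap.smul_apply, smul_eq_mul]
    rcases List.eq_nil_or_concat w' with rfl | ⟨w', i, rfl⟩
    · cases w with
      | nil => simp [Fw, Ew, KL_mul_KL, hwFun_KL, hΛ, mul_comm]
      | cons i w =>
        rw [Fw_cons, mul_assoc (gen χ π (.F i)), mul_assoc (gen χ π (.F i)), hwFun_F, mul_zero,
          mul_assoc, hwFun_F]
    · rw [List.concat_eq_append, Ew_append, ← mul_assoc, hwFun_E, mul_zero, mul_assoc]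
      simp only [hwFun, LinearMap.comp_apply, shCoeff_E_KL, map_zero]
  rw [mul_comm]
  exact LinearMap.congr_fun this x

/-- The module `ℒ(Λ)`. -/
abbrev SimpleHW : Type _ := GQG χ π ⧸ hwIdeal χ π Λ

/-- The highest-weight vector of `ℒ(Λ)`. -/
def hwVec : SimpleHW χ π Λ := Submodule.Quotient.mk 1

/-- The projection of `ℒ(Λ)` onto its highest-weight line. -/
def pr : SimpleHW χ π Λ →ₗ[K] K :=
  ((hwIdeal χ π Λ).restrictScalars K).liftQ (hwFun χ π Λ) fun x hx => by simpa using hx 1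

theorem mk_eq (x : GQG χ π) : (Submodule.Quotient.mk x : SimpleHW χ π Λ) = x • hwVec χ π Λ := by
  rw [hwVec, ← Submodule.Quotient.mk_smul, smul_eq_mul, mul_one]

theorem pr_smul (x : GQG χ π) : pr χ π Λ (x • hwVec χ π Λ) = hwFun χ π Λ x := by
  rw [← mk_eq]; rfl

theorem eq_zero_of_pr (m : SimpleHW χ π Λ) (h : ∀ y : GQG χ π, pr χ π Λ (y • m) = 0) : m = 0 := by
  obtain ⟨x, rfl⟩ := Submodule.Quotient.mk_surjective _ m
  rw [Submodule.Quotient.mk_eq_zero]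
  intro y
  have := h y
  rwa [mk_eq, ← mul_smul, pr_smul] at this

theorem pr_F (i : Fin l) (m : SimpleHW χ π Λ) : pr χ π Λ (gen χ π (.F i) • m) = 0 := by
  obtain ⟨x, rfl⟩ := Submodule.Quotient.mk_surjective _ m
  rw [mk_eq, ← mul_smul, pr_smul, hwFun_F]

theorem pr_KL
    (hΛ : ∀ a b c d, Λ (a + c) (b + d) = Λ a b * Λ c d)
    (a b : A) (m : SimpleHW χ π Λ) :
    pr χ π Λ (KL χ π a b • m) = Λ a b * pr χ π Λ m := by
  obtain ⟨x, rfl⟩ := Submodule.Quotient.mk_surjective _ m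
  rw [mk_eq, ← mul_smul, pr_smul, hwFun_KL_mul χ π Λ hΛ, pr_smul]

theorem pr_hwVec
    (h0 : Λ 0 0 = 1) : pr χ π Λ (hwVec χ π Λ) = 1 := by
  have := pr_smul χ π Λ 1
  rwa [one_smul, ← KL_zero χ π, hwFun_KL, h0] at this

theorem E_hwVec (i : Fin l) : gen χ π (.E i) • hwVec χ π Λ = 0 :=
  eq_zero_of_pr χ π Λ _ fun y => by rw [← mul_smul, pr_smul, hwFun_E]

theorem KL_hwVec
    (hΛ : ∀ a b c d, Λ (a + c) (b + d) = Λ a b * Λ c d)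
    (a b : A) : KL χ π a b • hwVec χ π Λ = Λ a b • hwVec χ π Λ := by
  rw [← sub_eq_zero]
  refine eq_zero_of_pr χ π Λ _ fun y => ?_
  rw [smul_sub, map_sub, ← mul_smul, pr_smul, hwFun_mul_KL χ π Λ hΛ, smul_comm, map_smul, pr_smul,
    smul_eq_mul, mul_comm, sub_self]

theorem K_eq_KL (a : A) : gen χ π (.K a) = KL χ π a 0 := by rw [KL, gen_L_zero, mul_one]
theorem L_eq_KL (a : A) : gen χ π (.L a) = KL χ π 0 a := by rw [KL, gen_K_zero, one_mul]

/-- A vector without highest-weight component that is killed by all `E_i` is zero. -/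
theorem eq_zero_of_singular
    (hΛ : ∀ a b c d, Λ (a + c) (b + d) = Λ a b * Λ c d)
    (m : SimpleHW χ π Λ) (hE : ∀ i, gen χ π (.E i) • m = 0)
    (hp : pr χ π Λ m = 0) : m = 0 := by
  refine eq_zero_of_pr χ π Λ m fun y => ?_
  set S : Submodule K (SimpleHW χ π Λ) := Submodule.span K {x | ∃ a b, KL χ π a b • m = x}
  have ind : ∀ g, (∀ a b, gen χ π g • (KL χ π a b • m) ∈ S) →
      ∀ y ∈ S, gen χ π g • y ∈ S := by
    intro g hg y hy
    induction hy using Submodule.span_induction with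
    | mem x hx => obtain ⟨a, b, rfl⟩ := hx; exact hg a b
    | zero => simp
    | add x y _ _ hx hy => rw [smul_add]; exact add_mem hx hy
    | smul r x _ hx => rw [smul_comm]; exact Submodule.smul_mem _ _ hx
  have hSp : ∀ s ∈ S, pr χ π Λ s = 0 := by
    intro s hs
    induction hs using Submodule.span_induction with
    | mem x hx => obtain ⟨a, b, rfl⟩ := hx; rw [pr_KL χ π Λ hΛ, hp, mul_zero]
    | zero => simp
    | add x y _ _ hx hy => rw [map_add, hx, hy, add_zero]
    | smul r x _ hx => rw [map_smul, hx, smul_zero]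
  have h := gen_smul_Fw χ π S
    (fun i => ind _ fun a b => by
      obtain ⟨c, hc⟩ := E_mul_KL χ π a b i
      rw [← mul_smul, hc, smul_assoc, mul_smul, hE, smul_zero, smul_zero]
      exact zero_mem _)
    (fun c => ind _ fun a b => Submodule.subset_span ⟨_, _, by rw [← mul_smul, K_mul_KL]⟩)
    (fun c => ind _ fun a b => Submodule.subset_span ⟨_, _, by rw [← mul_smul, L_mul_KL]⟩)
    y m (Submodule.subset_span ⟨0, 0, by rw [KL_zero, one_smul]⟩)
  generalize y • m = z at h
  induction h using Submodule.span_induction with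
  | mem x hx =>
    obtain ⟨w, s, hs, rfl⟩ := hx
    cases w with
    | nil => simpa [Fw] using hSp s hs
    | cons i w => rw [Fw_cons, mul_smul, pr_F]
  | zero => simp
  | add x y _ _ hx hy => rw [map_add, hx, hy, add_zero]
  | smul r x _ hx => rw [map_smul, hx, smul_zero]

/-- The span of the `F_w v_Λ` with `w` of length less than `n`. -/
def filt (n : ℕ) : Submodule K (SimpleHW χ π Λ) :=
  Submodule.span K {x | ∃ w : List (Fin l), w.length < n ∧ Fw χ π w • hwVec χ π Λ = x}

theorem span_Fw
    (hΛ : ∀ a b c d, Λ (a + c) (b + d) = Λ a b * Λ c d)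
    : Submodule.span K {x | ∃ w, Fw χ π w • hwVec χ π Λ = x} = ⊤ := by
  rw [eq_top_iff]
  rintro m -
  obtain ⟨x, rfl⟩ := Submodule.Quotient.mk_surjective _ m
  rw [mk_eq]
  have ind : ∀ g, (∃ c : K, gen χ π g • hwVec χ π Λ = c • hwVec χ π Λ) →
      ∀ y ∈ Submodule.span K {hwVec χ π Λ}, gen χ π g • y ∈ Submodule.span K {hwVec χ π Λ} := by
    rintro g ⟨c, hc⟩ y hy
    obtain ⟨r, rfl⟩ := Submodule.mem_span_singleton.mp hy
    rw [smul_comm, hc]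
    exact Submodule.smul_mem _ _ (Submodule.smul_mem _ _ (Submodule.mem_span_singleton_self _))
  have h := gen_smul_Fw χ π (Submodule.span K {hwVec χ π Λ})
    (fun i => ind _ ⟨0, by rw [E_hwVec, zero_smul]⟩)
    (fun c => ind _ ⟨_, by rw [K_eq_KL]; exact KL_hwVec χ π Λ hΛ _ _⟩)
    (fun c => ind _ ⟨_, by rw [L_eq_KL]; exact KL_hwVec χ π Λ hΛ _ _⟩) x _
    (Submodule.mem_span_singleton_self _)
  refine Submodule.span_le.mpr ?_ h
  rintro _ ⟨w, s, hs, rfl⟩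
  obtain ⟨r, rfl⟩ := Submodule.mem_span_singleton.mp hs
  rw [smul_comm]
  exact Submodule.smul_mem _ _ (Submodule.subset_span ⟨w, rfl⟩)

theorem F_filt (i : Fin l) (n : ℕ) (m : SimpleHW χ π Λ) (hm : m ∈ filt χ π Λ n) :
    gen χ π (.F i) • m ∈ filt χ π Λ (n + 1) := by
  induction hm using Submodule.span_induction with
  | mem x hx =>
    obtain ⟨w, hw, rfl⟩ := hx
    exact Submodule.subset_span ⟨i :: w, by simpa using hw, by rw [Fw_cons, mul_smul]⟩
  | zero => simp
  | add x y _ _ hx hy => rw [smul_add]; exact add_mem hx hy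
  | smul r x _ hx => rw [smul_comm]; exact Submodule.smul_mem _ _ hx

theorem K_Fw
    (hΛ : ∀ a b c d, Λ (a + c) (b + d) = Λ a b * Λ c d)
    (a : A) (w : List (Fin l)) : ∃ c : K,
    gen χ π (.K a) • (Fw χ π w • hwVec χ π Λ) = c • (Fw χ π w • hwVec χ π Λ) := by
  induction w with
  | nil => exact ⟨_, by
      simp only [Fw, List.map_nil, List.prod_nil, one_smul]
      rw [K_eq_KL]; exact KL_hwVec χ π Λ hΛ _ _⟩
  | cons i w ih =>
    obtain ⟨c, hc⟩ := ih
    refine ⟨(χ a (-π i) : K) * c, ?_⟩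
    rw [Fw_cons, mul_smul, ← mul_smul (gen χ π (.K a)), gen_K_F, smul_assoc, mul_smul, hc,
      smul_comm (gen χ π (.F i)), mul_smul]

theorem L_Fw
    (hΛ : ∀ a b c d, Λ (a + c) (b + d) = Λ a b * Λ c d)
    (a : A) (w : List (Fin l)) : ∃ c : K,
    gen χ π (.L a) • (Fw χ π w • hwVec χ π Λ) = c • (Fw χ π w • hwVec χ π Λ) := by
  induction w with
  | nil => exact ⟨_, by
      simp only [Fw, List.map_nil, List.prod_nil, one_smul]
      rw [L_eq_KL]; exact KL_hwVec χ π Λ hΛ _ _⟩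
  | cons i w ih =>
    obtain ⟨c, hc⟩ := ih
    refine ⟨(χ (π i) a : K) * c, ?_⟩
    rw [Fw_cons, mul_smul, ← mul_smul (gen χ π (.L a)), gen_L_F, smul_assoc, mul_smul, hc,
      smul_comm (gen χ π (.F i)), mul_smul]

theorem E_Fw
    (hΛ : ∀ a b c d, Λ (a + c) (b + d) = Λ a b * Λ c d)
    (i : Fin l) (w : List (Fin l)) :
    gen χ π (.E i) • (Fw χ π w • hwVec χ π Λ) ∈ filt χ π Λ w.length := by
  induction w with
  | nil => simp [Fw, E_hwVec]
  | cons j w ih =>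
    rw [Fw_cons, mul_smul, ← mul_smul, sub_eq_iff_eq_add'.mp (gen_E_F χ π i j), add_smul, mul_smul]
    refine add_mem (F_filt χ π Λ _ _ _ ih) ?_
    have hw : Fw χ π w • hwVec χ π Λ ∈ filt χ π Λ (j :: w).length :=
      Submodule.subset_span ⟨w, by simp, rfl⟩
    split_ifs
    · obtain ⟨c, hc⟩ := K_Fw χ π Λ hΛ (π i) w
      obtain ⟨d, hd⟩ := L_Fw χ π Λ hΛ (π i) w
      rw [add_smul, neg_smul, hc, hd]
      exact add_mem (neg_mem (Submodule.smul_mem _ _ hw)) (Submodule.smul_mem _ _ hw)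
    · simp

theorem E_filt
    (hΛ : ∀ a b c d, Λ (a + c) (b + d) = Λ a b * Λ c d)
    (i : Fin l) (n : ℕ) (m : SimpleHW χ π Λ) (hm : m ∈ filt χ π Λ (n + 1)) :
    gen χ π (.E i) • m ∈ filt χ π Λ n := by
  induction hm using Submodule.span_induction with
  | mem x hx =>
    obtain ⟨w, hw, rfl⟩ := hx
    have : filt χ π Λ w.length ≤ filt χ π Λ n := Submodule.span_mono (by
      rintro _ ⟨w', hw', rfl⟩; exact ⟨w', by omega, rfl⟩)
    exact this (E_Fw χ π Λ hΛ i w)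
  | zero => simp
  | add x y _ _ hx hy => rw [smul_add]; exact add_mem hx hy
  | smul r x _ hx => rw [smul_comm]; exact Submodule.smul_mem _ _ hx

theorem exists_filt
    (hΛ : ∀ a b c d, Λ (a + c) (b + d) = Λ a b * Λ c d)
    (m : SimpleHW χ π Λ) : ∃ n, m ∈ filt χ π Λ n := by
  have hm : m ∈ Submodule.span K {x | ∃ w, Fw χ π w • hwVec χ π Λ = x} := by
    rw [span_Fw χ π Λ hΛ]; trivial
  have mono : ∀ {a b : ℕ}, a ≤ b → filt χ π Λ a ≤ filt χ π Λ b := fun hab =>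
    Submodule.span_mono (by rintro _ ⟨w', hw', rfl⟩; exact ⟨w', by omega, rfl⟩)
  induction hm using Submodule.span_induction with
  | mem x hx =>
    obtain ⟨w, rfl⟩ := hx
    exact ⟨w.length + 1, Submodule.subset_span ⟨w, by omega, rfl⟩⟩
  | zero => exact ⟨0, zero_mem _⟩
  | add x y _ _ hx hy =>
    obtain ⟨a, ha⟩ := hx
    obtain ⟨b, hb⟩ := hy
    exact ⟨max a b, add_mem (mono (le_max_left _ _) ha) (mono (le_max_right _ _) hb)⟩
  | smul r x _ hx => obtain ⟨a, ha⟩ := hx; exact ⟨a, Submodule.smul_mem _ _ ha⟩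

theorem hwVec_mem
    (h0 : Λ 0 0 = 1)
    (hΛ : ∀ a b c d, Λ (a + c) (b + d) = Λ a b * Λ c d)
    (N : Submodule (GQG χ π) (SimpleHW χ π Λ)) (n : ℕ) :
    ∀ m ∈ N, m ∈ filt χ π Λ n → m ≠ 0 → hwVec χ π Λ ∈ N := by
  induction n with
  | zero =>
    intro m _ hm hne
    simp [filt] at hm
    exact absurd hm hne
  | succ n ih =>
    intro m hmN hm hne
    by_cases h : ∃ i, gen χ π (.E i) • m ≠ 0
    · obtain ⟨i, hi⟩ := h
      exact ih _ (N.smul_mem _ hmN) (E_filt χ π Λ hΛ i n m hm) hi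
    · push Not at h
      have hz := eq_zero_of_singular χ π Λ hΛ (m - pr χ π Λ m • hwVec χ π Λ)
        (fun i => by rw [smul_sub, h, smul_comm, E_hwVec, smul_zero, sub_zero])
        (by rw [map_sub, map_smul, pr_hwVec χ π Λ h0, smul_eq_mul, mul_one, sub_self])
      rw [sub_eq_zero] at hz
      have hp : pr χ π Λ m ≠ 0 := by
        intro h1; rw [h1, zero_smul] at hz; exact hne hz
      have : hwVec χ π Λ = (algebraMap K (GQG χ π) (pr χ π Λ m)⁻¹) • m := by
        rw [algebraMap_smul]
        nth_rewrite 2 [hz]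
        rw [smul_smul, inv_mul_cancel₀ hp, one_smul]
      rw [this]
      exact N.smul_mem _ hmN

/-- Existence of the simple highest-weight module. -/
theorem isSimpleHighestWeight_SimpleHW
    (h0 : Λ 0 0 = 1)
    (hΛ : ∀ a b c d, Λ (a + c) (b + d) = Λ a b * Λ c d)
    :
    IsSimpleHighestWeight χ π Λ (hwVec χ π Λ) where
  simple := by
    have hv : hwVec χ π Λ ≠ 0 := by
      intro h; have := pr_hwVec χ π Λ h0; rw [h, map_zero] at this; exact zero_ne_one this
    have : Nontrivial (SimpleHW χ π Λ) := ⟨_, _, hv⟩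
    refine { toIsSimpleOrder := { eq_bot_or_eq_top := fun N => ?_ } }
    by_cases hN : N = ⊥
    · exact Or.inl hN
    · right
      obtain ⟨m, hm, hne⟩ := (Submodule.ne_bot_iff _).mp hN
      obtain ⟨n, hn⟩ := exists_filt χ π Λ hΛ m
      have hvN := hwVec_mem χ π Λ h0 hΛ N n m hm hn hne
      rw [eq_top_iff]
      rintro y -
      obtain ⟨x, rfl⟩ := Submodule.Quotient.mk_surjective _ y
      rw [mk_eq]
      exact N.smul_mem _ hvN
  ne_zero := by
    intro h; have := pr_hwVec χ π Λ h0; rw [h, map_zero] at this; exact zero_ne_one this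
  indep := by
    have key : ∀ (κ ν : A), κ ≠ ν → ∀ y ∈ homPart χ π κ, ∀ m ∈ weightOrbit χ π (hwVec χ π Λ) ν,
        pr χ π Λ (y • m) = 0 := by
      rintro κ ν hne y hy _ ⟨Y, hY, rfl⟩
      change pr χ π Λ (y • (Y • hwVec χ π Λ)) = 0
      rw [← mul_smul, pr_smul, hwFun, LinearMap.comp_apply,
        shCoeff_deg χ π _ (homPart_mul χ π hy hY.2), map_zero]
      intro h; exact hne (by rwa [← sub_eq_add_neg, sub_eq_zero] at h)
    intro ν
    rw [Submodule.disjoint_def]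
    intro m hm hm'
    refine eq_zero_of_pr χ π Λ m fun y => ?_
    let f : GQG χ π →ₗ[K] K :=
      pr χ π Λ ∘ₗ (LinearMap.toSpanSingleton (GQG χ π) (SimpleHW χ π Λ) m).restrictScalars K
    have hf : (⊤ : Submodule K (GQG χ π)) ≤ LinearMap.ker f := by
      rw [← iSup_homPart]
      refine iSup_le fun κ y hy => ?_
      change pr χ π Λ (y • m) = 0
      by_cases hκ : κ = ν
      · let g : SimpleHW χ π Λ →ₗ[K] K := pr χ π Λ ∘ₗ
          (Algebra.lsmul K K (SimpleHW χ π Λ) y)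
        have hg : ⨆ j : posCone π, ⨆ (_ : j ≠ ν), weightOrbit χ π (hwVec χ π Λ) (j : A) ≤
            LinearMap.ker g := by
          refine iSup_le fun j => iSup_le fun hj => fun m hm => ?_
          exact key κ j (by rintro rfl; exact hj (Subtype.ext hκ)) y hy m hm
        exact hg hm'
      · exact key κ ν hκ y hy m hm
    exact hf (Submodule.mem_top (x := y))
  span_eq_top := by
    rw [eq_top_iff, ← span_Fw χ π Λ hΛ, Submodule.span_le]
    rintro _ ⟨w, rfl⟩
    have hw : wordWt π w ∈ posCone π := by
      refine AddSubmonoid.list_sum_mem _ fun x hx => ?_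
      obtain ⟨i, _, rfl⟩ := List.mem_map.mp hx
      exact AddSubmonoid.subset_closure ⟨i, rfl⟩
    refine Submodule.mem_iSup_of_mem ⟨_, hw⟩ ⟨Fw χ π w, ⟨?_, Fw_deg χ π w⟩, rfl⟩
    refine Subalgebra.list_prod_mem _ fun x hx => ?_
    obtain ⟨i, _, rfl⟩ := List.mem_map.mp hx
    exact Algebra.subset_adjoin ⟨i, rfl⟩
  weight := KL_hwVec χ π Λ hΛ
  gen_E := E_hwVec χ π Λ

end Exist

end Facts
end GenQuantumGroup

end

set_option linter.unusedSectionVars false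
/-!
The element `Z_{λ,μ}` is obtained as a quantum partial trace over the module `M = ℒ(Λ_{λ,μ})`.

*The quasi-R-matrix.* On the free algebra with `l` letters there is a bilinear form `B`
(`wordForm`) for which multiplication by a letter, on the left or on the right and in either
argument, is adjoint to a skew derivation. The same skew derivations describe the commutators
`[E_k, y]` for `y ∈ U⁻` (`gen_E_mul_wordsF`) and `[x, F_k]` for `x ∈ U⁺` (`wordsE_mul_gen_F`). Hence
they preserve the radical of `B`, and since an element of `U^±` of nonzero degree that commutes
with all `F_k`, respectively all `E_k`, is zero, the radical is mapped to zero in `U^±`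
(`wordsF_eq_zero`, `wordsE_eq_zero`). So an identity in `U⁻ ⊗ U⁺` can be checked by pairing with
words (`realize_eq`). A generalized inverse of the matrix of `B` in weight `β` gives
`Θ_β ∈ U⁻ ⊗ U⁺` (`quasiR`), and adjointness becomes, for `Θ = ∑ Θ_β`,

`(E_k ⊗ 1 + K_k ⊗ E_k) Θ = Θ (E_k ⊗ 1 + L_k ⊗ E_k)`,
`(1 ⊗ F_k + F_k ⊗ L_k) Θ = Θ (1 ⊗ F_k + F_k ⊗ K_k)`

with `K_k = K_{α_k}`, `L_k = L_{α_k}` (`gen_E_mul_quasiR`, `quasiR_mul_gen_F`). The flip `Θ'` of `Θ`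
satisfies the flipped relations. It is twisted to `Θ'' = ∑ ω(γ)⁻¹ χ(γ,γ)⁻¹ Θ'_γ (K_{-γ} ⊗ L_{-γ})`
(`twistedR`).

*The intertwiner.* Let the second tensor factor act on `M`, so that the sums become finite, and
put `D = ∑ K_{λ+ν} L_{μ-ν} ⊗ P_ν` with the projections `P_ν` onto `M_ν = U⁻_{-ν} v`
(`torusPart`). The weights of `M` are such that `D` links the relations of `Θ` to those of `Θ''`
(`E_torusPart`, `F_torusPart`; this is where `Λ_{λ,μ}` enters), so that `T = Θ D Θ''` satisfies

`(E_k ⊗ 1 + K_k ⊗ E_k) T = T (ω(α_k)⁻¹ E_k ⊗ 1 + K_k ⊗ E_k)`,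
`(1 ⊗ F_k + F_k ⊗ L_k) T = T (1 ⊗ F_k + ω(α_k) F_k ⊗ L_k)`.

*The trace.* Let `g` act on `M_ν` by `ρ̂(ν)`. By cyclicity of the trace the terms in `K_k ⊗ E_k` and
`1 ⊗ F_k` drop out of the partial trace over `M` of these relations times `1 ⊗ g`, and
`Z = (id ⊗ tr)(T (1 ⊗ g))` is `ω`-central (`ptrace_skew_comm_of_left`,
`ptrace_skew_comm_of_right`). The Harish-Chandra projection sees only the terms `Θ_0 = Θ''_0 = 1`,
which leaves `(id ⊗ tr)(D (1 ⊗ g)) = ∑ ρ̂(ν) m_ν K_{λ+ν} L_{μ-ν}` (`Sh_centralElt`).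
-/
noncomputable section

namespace GenQuantumGroup

universe u v

open TensorProduct

/-! ### Skew derivations and the bilinear form on words -/

section Words

variable {A : Type u} {K : Type v} [AddCommGroup A] [Field K] {l : ℕ}

/-- The bicharacter `(a, b) ↦ χ(b, a)`. -/
def Bicharacter.flip (χ : Bicharacter A K) : Bicharacter A K where
  toFun a b := χ b a
  map_add_left a b c := χ.map_add_right c a b
  map_add_right a b c := χ.map_add_left b c a

@[simp] theorem Bicharacter.flip_apply (χ : Bicharacter A K) (a b : A) : χ.flip a b = χ b a := rfl

/-- The free associative algebra on `l` letters, as the vector space with the words as a basis. -/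
abbrev Words (K : Type v) [Field K] (l : ℕ) : Type v := List (Fin l) →₀ K

/-- The basis vector of a word. -/
abbrev wd (K : Type v) [Field K] {l : ℕ} (w : List (Fin l)) : Words K l := Finsupp.single w 1

/-- Multiplication by the letter `j` from the left. -/
def consMap (K : Type v) [Field K] {l : ℕ} (j : Fin l) : Words K l →ₗ[K] Words K l :=
  Finsupp.lmapDomain K K (j :: ·)

/-- Multiplication by the letter `j` from the right. -/
def snocMap (K : Type v) [Field K] {l : ℕ} (j : Fin l) : Words K l →ₗ[K] Words K l :=
  Finsupp.lmapDomain K K (· ++ [j])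

@[simp] theorem consMap_wd (j : Fin l) (w : List (Fin l)) :
    consMap K j (wd K w) = wd K (j :: w) := by
  simp [consMap]

@[simp] theorem snocMap_wd (j : Fin l) (w : List (Fin l)) :
    snocMap K j (wd K w) = wd K (w ++ [j]) := by
  simp [snocMap]

/-- `skewDerL` on a word. -/
def skewDerLWord (χ : Bicharacter A K) (π : Fin l → A) (k : Fin l) : List (Fin l) → Words K l
  | [] => 0
  | j :: w => (χ (π k) (π j) : K) • consMap K j (skewDerLWord χ π k w) +
      if k = j then wd K w else 0

/-- The skew derivation of the free algebra that removes a letter `k`, with the factor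
`χ(α_k, β)` for the part of weight `β` to its left. -/
def skewDerL (χ : Bicharacter A K) (π : Fin l → A) (k : Fin l) : Words K l →ₗ[K] Words K l :=
  Finsupp.linearCombination K (skewDerLWord χ π k)

/-- `skewDerR` on a word. -/
def skewDerRWord (χ : Bicharacter A K) (π : Fin l → A) (k : Fin l) : List (Fin l) → Words K l
  | [] => 0
  | j :: w => consMap K j (skewDerRWord χ π k w) +
      if k = j then (χ (wordWt π w) (π k) : K) • wd K w else 0

/-- The skew derivation of the free algebra that removes a letter `k`, with the factor
`χ(β, α_k)` for the part of weight `β` to its right. -/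
def skewDerR (χ : Bicharacter A K) (π : Fin l → A) (k : Fin l) : Words K l →ₗ[K] Words K l :=
  Finsupp.linearCombination K (skewDerRWord χ π k)

variable (χ : Bicharacter A K) (π : Fin l → A)

@[simp] theorem skewDerL_nil (k : Fin l) : skewDerL χ π k (wd K []) = 0 := by
  simp [skewDerL, skewDerLWord]

@[simp] theorem skewDerR_nil (k : Fin l) : skewDerR χ π k (wd K []) = 0 := by
  simp [skewDerR, skewDerRWord]

theorem skewDerL_wd_cons (k j : Fin l) (w : List (Fin l)) : skewDerL χ π k (wd K (j :: w)) =
    (χ (π k) (π j) : K) • consMap K j (skewDerL χ π k (wd K w)) + if k = j then wd K w else 0 := by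
  simp [skewDerL, skewDerLWord]

theorem skewDerR_wd_cons (k j : Fin l) (w : List (Fin l)) : skewDerR χ π k (wd K (j :: w)) =
    consMap K j (skewDerR χ π k (wd K w)) +
      if k = j then (χ (wordWt π w) (π k) : K) • wd K w else 0 := by
  simp [skewDerR, skewDerRWord]

theorem words_ext {N : Type*} [AddCommGroup N] [Module K N] {f g : Words K l →ₗ[K] N}
    (h : ∀ w, f (wd K w) = g (wd K w)) : f = g :=
  Finsupp.lhom_ext' fun w => LinearMap.ext_ring (h w)

theorem skewDerL_consMap (k j : Fin l) (y : Words K l) : skewDerL χ π k (consMap K j y) =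
    (χ (π k) (π j) : K) • consMap K j (skewDerL χ π k y) + if k = j then y else 0 := by
  have : skewDerL χ π k ∘ₗ consMap K j = (χ (π k) (π j) : K) • consMap K j ∘ₗ skewDerL χ π k +
      if k = j then LinearMap.id else 0 :=
    words_ext fun w => by
      simp only [LinearMap.comp_apply, consMap_wd, skewDerL_wd_cons, LinearMap.add_apply,
        LinearMap.smul_apply]
      split_ifs <;> simp
  have h := LinearMap.congr_fun this y
  simp only [LinearMap.comp_apply, LinearMap.add_apply, LinearMap.smul_apply] at h
  rw [h]
  split_ifs <;> simp

/-- The span of the words of weight `β`. -/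
def wordsDeg (K : Type v) [Field K] (π : Fin l → A) (β : A) : Submodule K (Words K l) :=
  Submodule.span K {x | ∃ w, wordWt π w = β ∧ wd K w = x}

theorem wd_mem (w : List (Fin l)) : wd K w ∈ wordsDeg K π (wordWt π w) :=
  Submodule.subset_span ⟨w, rfl, rfl⟩

theorem wordsDeg_ind {N : Type*} [AddCommGroup N] [Module K N] {β : A} (f : Words K l →ₗ[K] N)
    (S : Submodule K N) (h : ∀ w, wordWt π w = β → f (wd K w) ∈ S) {y : Words K l}
    (hy : y ∈ wordsDeg K π β) : f y ∈ S := by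
  have : wordsDeg K π β ≤ S.comap f := Submodule.span_le.mpr (by rintro _ ⟨w, hw, rfl⟩; exact h w hw)
  exact this hy

theorem wordsDeg_eq {N : Type*} [AddCommGroup N] [Module K N] {β : A} (f g : Words K l →ₗ[K] N)
    (h : ∀ w, wordWt π w = β → f (wd K w) = g (wd K w)) {y : Words K l}
    (hy : y ∈ wordsDeg K π β) : f y = g y := by
  have := wordsDeg_ind π (f - g) ⊥ (fun w hw => by simp [h w hw]) hy
  simpa [sub_eq_zero] using this

theorem wordWt_cons (j : Fin l) (w : List (Fin l)) :
    wordWt π (j :: w) = π j + wordWt π w := by simp [wordWt]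

theorem consMap_deg (j : Fin l) {β : A} {y : Words K l} (hy : y ∈ wordsDeg K π β) :
    consMap K j y ∈ wordsDeg K π (π j + β) :=
  wordsDeg_ind π _ _ (fun w hw => by
    rw [consMap_wd, ← hw, ← wordWt_cons]; exact wd_mem π _) hy

theorem skewDerL_deg (k : Fin l) {β : A} {y : Words K l} (hy : y ∈ wordsDeg K π β) :
    skewDerL χ π k y ∈ wordsDeg K π (β - π k) := by
  refine wordsDeg_ind π _ _ (fun w hw => ?_) hy
  subst hw
  clear hy
  induction w with
  | nil => simp
  | cons j w ih =>
    rw [skewDerL_wd_cons, wordWt_cons, add_sub_assoc]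
    refine add_mem (Submodule.smul_mem _ _ (consMap_deg π j ih)) ?_
    split_ifs with h
    · subst h; rw [add_sub_cancel]; exact wd_mem π w
    · exact zero_mem _

theorem skewDerR_deg (k : Fin l) {β : A} {y : Words K l} (hy : y ∈ wordsDeg K π β) :
    skewDerR χ π k y ∈ wordsDeg K π (β - π k) := by
  refine wordsDeg_ind π _ _ (fun w hw => ?_) hy
  subst hw
  clear hy
  induction w with
  | nil => simp
  | cons j w ih =>
    rw [skewDerR_wd_cons, wordWt_cons, add_sub_assoc]
    refine add_mem (consMap_deg π j ih) ?_
    split_ifs with h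
    · subst h; rw [add_sub_cancel]; exact Submodule.smul_mem _ _ (wd_mem π w)
    · exact zero_mem _

theorem skewDerR_consMap (k j : Fin l) {β : A} {y : Words K l} (hy : y ∈ wordsDeg K π β) :
    skewDerR χ π k (consMap K j y) =
      consMap K j (skewDerR χ π k y) + if k = j then (χ β (π k) : K) • y else 0 := by
  have := wordsDeg_eq π (skewDerR χ π k ∘ₗ consMap K j) (consMap K j ∘ₗ skewDerR χ π k +
      if k = j then (χ β (π k) : K) • LinearMap.id else 0) (fun w hw => by
        subst hw
        simp only [LinearMap.comp_apply, consMap_wd, skewDerR_wd_cons, LinearMap.add_apply]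
        split_ifs <;> simp) hy
  simp only [LinearMap.comp_apply, LinearMap.add_apply] at this
  rw [this]
  split_ifs <;> simp

/-- Removing letters from the left and from the right commute. -/
theorem skewDerL_skewDerR (k m : Fin l) (y : Words K l) :
    skewDerL χ π k (skewDerR χ π m y) = skewDerR χ π m (skewDerL χ π k y) := by
  refine LinearMap.congr_fun (f := skewDerL χ π k ∘ₗ skewDerR χ π m)
    (g := skewDerR χ π m ∘ₗ skewDerL χ π k) (words_ext fun w => ?_) y
  simp only [LinearMap.comp_apply]
  induction w with
  | nil => simp
  | cons j w ih =>
    rw [skewDerL_wd_cons, skewDerR_wd_cons, map_add, map_add, skewDerL_consMap, ih, map_smul,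
      skewDerR_consMap χ π m j (skewDerL_deg χ π k (wd_mem π w)), smul_add, add_assoc, add_assoc]
    congr 1
    rw [add_comm]
    congr 1
    · split_ifs with h
      · subst h
        rw [map_smul, smul_smul, sub_eq_add_neg, χ.map_add_left, χ.neg_left]
        congr 1
        push_cast
        field_simp
      · simp
    · split_ifs <;> simp

/-- The functional `B(u, ·)` of the bilinear form of the free algebra. -/
def wordFun (χ : Bicharacter A K) (π : Fin l → A) : List (Fin l) → Words K l →ₗ[K] K
  | [] => Finsupp.lapply []
  | k :: u => wordFun χ π u ∘ₗ skewDerL χ π k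

/-- The bilinear form `B` of the free algebra for which left and right multiplication by a letter
in the first argument are adjoint to `skewDerL` and `skewDerR`. It is the pairing of `Ũ⁺` and
`Ũ⁻`. -/
def wordForm : Words K l →ₗ[K] Words K l →ₗ[K] K :=
  Finsupp.linearCombination K (wordFun χ π)

theorem wordForm_nil (y : Words K l) : wordForm χ π (wd K []) y = y [] := by
  simp [wordForm, wordFun]

theorem form_ext {f g : Words K l →ₗ[K] Words K l →ₗ[K] K}
    (h : ∀ u w, f (wd K u) (wd K w) = g (wd K u) (wd K w)) (x y : Words K l) : f x y = g x y := by
  have : f = g := words_ext fun u => words_ext fun w => h u w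
  rw [this]

theorem wordForm_wd_cons (k : Fin l) (u : List (Fin l)) (y : Words K l) :
    wordForm χ π (wd K (k :: u)) y = wordForm χ π (wd K u) (skewDerL χ π k y) := by
  simp [wordForm, wordFun]

theorem wordForm_consMap_left (k : Fin l) (x y : Words K l) :
    wordForm χ π (consMap K k x) y = wordForm χ π x (skewDerL χ π k y) :=
  form_ext (f := wordForm χ π ∘ₗ consMap K k) (g := (wordForm χ π).compl₂ (skewDerL χ π k))
    (fun u w => by simp [wordForm_wd_cons]) x y

/-- Removing the last letter of the first argument: since `skewDerL` and `skewDerR` commute, `B`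
can be evaluated letter by letter from either end. -/
theorem wordForm_wd_snoc (k : Fin l) (u : List (Fin l)) (y : Words K l) :
    wordForm χ π (wd K (u ++ [k])) y = wordForm χ π (wd K u) (skewDerR χ π k y) := by
  induction u generalizing y with
  | nil =>
    refine LinearMap.congr_fun (f := wordForm χ π (wd K [k]))
      (g := wordForm χ π (wd K []) ∘ₗ skewDerR χ π k) (words_ext fun w => ?_) y
    rw [wordForm_wd_cons, LinearMap.comp_apply, wordForm_nil, wordForm_nil]
    cases w with
    | nil => simp
    | cons j w =>
      have hc : ∀ z : Words K l, consMap K j z [] = 0 := fun z =>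
        Finsupp.mapDomain_of_notMem_range _ _ (by simp)
      rw [skewDerL_wd_cons, skewDerR_wd_cons, Finsupp.add_apply, Finsupp.add_apply,
        Finsupp.smul_apply, hc, hc, smul_zero]
      congr 1
      split_ifs
      · cases w with
        | nil => simp [wordWt, χ.zero_left]
        | cons => simp
      · rfl
  | cons j u ih =>
    rw [List.cons_append, wordForm_wd_cons, ih, wordForm_wd_cons, skewDerL_skewDerR]

theorem wordForm_snocMap_left (k : Fin l) (x y : Words K l) :
    wordForm χ π (snocMap K k x) y = wordForm χ π x (skewDerR χ π k y) :=
  form_ext (f := wordForm χ π ∘ₗ snocMap K k) (g := (wordForm χ π).compl₂ (skewDerR χ π k))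
    (fun u w => by simp [wordForm_wd_snoc]) x y

theorem wordForm_consMap_right (k : Fin l) (x y : Words K l) :
    wordForm χ π x (consMap K k y) = wordForm χ π (skewDerL χ.flip π k x) y := by
  refine form_ext (f := (wordForm χ π).compl₂ (consMap K k))
    (g := wordForm χ π ∘ₗ skewDerL χ.flip π k) (fun u w => ?_) x y
  rw [LinearMap.compl₂_apply, LinearMap.comp_apply]
  generalize wd K w = y
  induction u generalizing y with
  | nil =>
    rw [skewDerL_nil, map_zero, LinearMap.zero_apply, wordForm_nil]
    exact Finsupp.mapDomain_of_notMem_range _ _ (by simp)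
  | cons j u ih =>
    rw [wordForm_wd_cons, skewDerL_consMap, skewDerL_wd_cons, map_add, map_smul, ih, map_add,
      map_smul, LinearMap.add_apply, LinearMap.smul_apply, wordForm_consMap_left]
    congr 1
    by_cases h : j = k
    · rw [if_pos h, if_pos h.symm]
    · rw [if_neg h, if_neg (Ne.symm h)]; simp

/-- Exchanging the arguments of `B` amounts to flipping the bicharacter. -/
theorem wordForm_flip (x y : Words K l) : wordForm χ.flip π x y = wordForm χ π y x := by
  refine form_ext (f := wordForm χ.flip π) (g := (wordForm χ π).flip) (fun u w => ?_) x y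
  rw [LinearMap.flip_apply]
  generalize wd K w = y
  induction u generalizing y with
  | nil =>
    rw [wordForm_nil]
    refine LinearMap.congr_fun (f := Finsupp.lapply []) (g := (wordForm χ π).flip (wd K []))
      (words_ext fun w => ?_) y
    rw [LinearMap.flip_apply]
    cases w with
    | nil => simp [wordForm_nil]
    | cons j w => simp [wordForm_wd_cons]
  | cons j u ih =>
    rw [wordForm_wd_cons, ih, ← consMap_wd, wordForm_consMap_right]

theorem wordForm_snocMap_right (k : Fin l) (x y : Words K l) :
    wordForm χ π x (snocMap K k y) = wordForm χ π (skewDerR χ.flip π k x) y := by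
  rw [← wordForm_flip, wordForm_snocMap_left, wordForm_flip]

/-- Words of different weights are orthogonal. -/
theorem wordForm_of_ne {u : List (Fin l)} {β : A} {y : Words K l} (hy : y ∈ wordsDeg K π β)
    (h : wordWt π u ≠ β) : wordForm χ π (wd K u) y = 0 := by
  induction u generalizing β y with
  | nil =>
    rw [wordForm_nil]
    refine wordsDeg_ind π (Finsupp.lapply []) ⊥ (fun w hw => ?_) hy
    cases w with
    | nil => exact absurd hw h
    | cons j w => simp
  | cons k u ih =>
    rw [wordForm_wd_cons]
    refine ih (skewDerL_deg χ π k hy) fun h' => h ?_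
    rw [wordWt_cons, h', add_sub_cancel]

end Words

/-! ### Words in `U⁻` and `U⁺`, and the radical of the form -/

section Realization

variable {A : Type u} {K : Type v} [AddCommGroup A] [Field K] {l : ℕ}
variable (χ : Bicharacter A K) (π : Fin l → A)

/-- The linear map from the free algebra onto `U⁻` that sends a word `w` to `F_w`. -/
def wordsF : Words K l →ₗ[K] GQG χ π := Finsupp.linearCombination K (Fw χ π)

/-- The linear map from the free algebra onto `U⁺` that sends a word `w` to `E_w`. -/
def wordsE : Words K l →ₗ[K] GQG χ π := Finsupp.linearCombination K (Ew χ π)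

@[simp] theorem wordsF_wd (w : List (Fin l)) : wordsF χ π (wd K w) = Fw χ π w := by simp [wordsF]
@[simp] theorem wordsE_wd (w : List (Fin l)) : wordsE χ π (wd K w) = Ew χ π w := by simp [wordsE]

theorem Ew_cons (w : List (Fin l)) (i : Fin l) :
    Ew χ π (i :: w) = gen χ π (.E i) * Ew χ π w := by simp [Ew]

theorem Fw_append (w : List (Fin l)) (i : Fin l) :
    Fw χ π (w ++ [i]) = Fw χ π w * gen χ π (.F i) := by simp [Fw]

theorem wordsF_consMap (k : Fin l) (y : Words K l) :
    wordsF χ π (consMap K k y) = gen χ π (.F k) * wordsF χ π y :=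
  LinearMap.congr_fun (f := wordsF χ π ∘ₗ consMap K k)
    (g := LinearMap.mulLeft K (gen χ π (.F k)) ∘ₗ wordsF χ π)
    (words_ext fun w => by simp [Fw_cons]) y

theorem wordsE_consMap (k : Fin l) (y : Words K l) :
    wordsE χ π (consMap K k y) = gen χ π (.E k) * wordsE χ π y :=
  LinearMap.congr_fun (f := wordsE χ π ∘ₗ consMap K k)
    (g := LinearMap.mulLeft K (gen χ π (.E k)) ∘ₗ wordsE χ π)
    (words_ext fun w => by simp [Ew_cons]) y

theorem wordsF_snocMap (k : Fin l) (y : Words K l) :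
    wordsF χ π (snocMap K k y) = wordsF χ π y * gen χ π (.F k) :=
  LinearMap.congr_fun (f := wordsF χ π ∘ₗ snocMap K k)
    (g := LinearMap.mulRight K (gen χ π (.F k)) ∘ₗ wordsF χ π)
    (words_ext fun w => by simp [Fw_append]) y

theorem wordsE_snocMap (k : Fin l) (y : Words K l) :
    wordsE χ π (snocMap K k y) = wordsE χ π y * gen χ π (.E k) :=
  LinearMap.congr_fun (f := wordsE χ π ∘ₗ snocMap K k)
    (g := LinearMap.mulRight K (gen χ π (.E k)) ∘ₗ wordsE χ π)
    (words_ext fun w => by simp [Ew_append]) y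

theorem K_mul_homPart (a : A) {d : A} {x : GQG χ π} (hx : x ∈ homPart χ π d) :
    gen χ π (.K a) * x = (χ a d : K) • (x * gen χ π (.K a)) := by
  have hg : ∀ g : Gen A l, gen χ π (.K a) * gen χ π g =
      (χ a (genDeg π g) : K) • (gen χ π g * gen χ π (.K a)) := by
    rintro (b | b | i | i)
    · simp [genDeg, χ.zero_right, gen_K_add, add_comm]
    · simp [genDeg, χ.zero_right, gen_K_L]
    · exact gen_K_E χ π a i
    · exact gen_K_F χ π a i
  induction hx using Submodule.span_induction with
  | mem x hx =>
    obtain ⟨w, rfl, rfl⟩ := hx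
    induction w with
    | nil => simp [χ.zero_right]
    | cons g w ih =>
      rw [List.map_cons, List.prod_cons, ← mul_assoc, hg, smul_mul_assoc, mul_assoc, ih,
        mul_smul_comm, smul_smul, List.map_cons, List.sum_cons, χ.map_add_right, mul_assoc,
        Units.val_mul]
  | zero => simp
  | add x y _ _ hx hy => rw [mul_add, hx, hy, add_mul, smul_add]
  | smul r x _ hx => rw [mul_smul_comm, hx, smul_mul_assoc, smul_comm]

theorem L_mul_homPart (a : A) {d : A} {x : GQG χ π} (hx : x ∈ homPart χ π d) :
    gen χ π (.L a) * x = (χ (-d) a : K) • (x * gen χ π (.L a)) := by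
  have hg : ∀ g : Gen A l, gen χ π (.L a) * gen χ π g =
      (χ (-genDeg π g) a : K) • (gen χ π g * gen χ π (.L a)) := by
    rintro (b | b | i | i)
    · simp [genDeg, χ.zero_left, gen_K_L]
    · simp [genDeg, χ.zero_left, gen_L_add, add_comm]
    · exact gen_L_E χ π a i
    · simpa [genDeg] using gen_L_F χ π a i
  induction hx using Submodule.span_induction with
  | mem x hx =>
    obtain ⟨w, rfl, rfl⟩ := hx
    induction w with
    | nil => simp [χ.zero_left]
    | cons g w ih =>
      rw [List.map_cons, List.prod_cons, ← mul_assoc, hg, smul_mul_assoc, mul_assoc, ih,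
        mul_smul_comm, smul_smul, List.map_cons, List.sum_cons, neg_add, χ.map_add_left, mul_assoc,
        Units.val_mul]
  | zero => simp
  | add x y _ _ hx hy => rw [mul_add, hx, hy, add_mul, smul_add]
  | smul r x _ hx => rw [mul_smul_comm, hx, smul_mul_assoc, smul_comm]

theorem F_mul_K (a : A) (i : Fin l) : gen χ π (.F i) * gen χ π (.K a) =
    (χ a (π i) : K) • (gen χ π (.K a) * gen χ π (.F i)) := by
  rw [gen_K_F, smul_smul, χ.neg_right, ← Units.val_mul, mul_inv_cancel, Units.val_one, one_smul]

theorem E_mul_L' (a : A) (i : Fin l) : gen χ π (.E i) * gen χ π (.L a) =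
    (χ (π i) a : K) • (gen χ π (.L a) * gen χ π (.E i)) := by
  rw [gen_L_E, smul_smul, χ.neg_left, ← Units.val_mul, mul_inv_cancel, Units.val_one, one_smul]

theorem gen_E_mul_F (i j : Fin l) : gen χ π (.E i) * gen χ π (.F j) =
    gen χ π (.F j) * gen χ π (.E i) +
      if i = j then -gen χ π (.K (π i)) + gen χ π (.L (π i)) else 0 :=
  sub_eq_iff_eq_add'.mp (gen_E_F χ π i j)

/-- The commutator of `E_k` with an element of `U⁻`. -/
theorem gen_E_mul_wordsF (k : Fin l) (y : Words K l) :
    gen χ π (.E k) * wordsF χ π y = wordsF χ π y * gen χ π (.E k) +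
      (wordsF χ π (skewDerR χ π k y) * gen χ π (.L (π k)) -
        gen χ π (.K (π k)) * wordsF χ π (skewDerL χ π k y)) := by
  refine LinearMap.congr_fun (f := LinearMap.mulLeft K (gen χ π (.E k)) ∘ₗ wordsF χ π)
    (g := LinearMap.mulRight K (gen χ π (.E k)) ∘ₗ wordsF χ π +
      (LinearMap.mulRight K (gen χ π (.L (π k))) ∘ₗ wordsF χ π ∘ₗ skewDerR χ π k -
        LinearMap.mulLeft K (gen χ π (.K (π k))) ∘ₗ wordsF χ π ∘ₗ skewDerL χ π k))
    (words_ext fun w => ?_) y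
  simp only [LinearMap.add_apply, LinearMap.sub_apply, LinearMap.comp_apply,
    LinearMap.mulLeft_apply, LinearMap.mulRight_apply, wordsF_wd]
  induction w with
  | nil => simp [Fw]
  | cons j w ih =>
    rw [Fw_cons, ← mul_assoc, gen_E_mul_F, add_mul, mul_assoc, ih, skewDerL_wd_cons,
      skewDerR_wd_cons, map_add, map_add, map_smul, wordsF_consMap, wordsF_consMap, mul_add,
      mul_sub, add_mul, mul_add (gen χ π (.K (π k))), mul_smul_comm, ← mul_assoc _ (gen χ π (.K _)),
      F_mul_K, ← mul_assoc (gen χ π (.K _)), smul_mul_assoc]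
    split_ifs with h
    · subst h
      have hL := L_mul_homPart χ π (π k) (Fw_deg χ π w)
      rw [neg_neg] at hL
      rw [add_mul, neg_mul, hL, map_smul, wordsF_wd, smul_mul_assoc]
      simp only [mul_assoc]
      abel
    · simp only [map_zero, mul_zero, zero_mul, add_zero, mul_assoc]

/-- The commutator of an element of `U⁺` with `F_k`. The skew derivations are those of the flipped
bicharacter. -/
theorem wordsE_mul_gen_F (k : Fin l) (x : Words K l) :
    wordsE χ π x * gen χ π (.F k) = gen χ π (.F k) * wordsE χ π x +
      (gen χ π (.L (π k)) * wordsE χ π (skewDerL χ.flip π k x) -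
        wordsE χ π (skewDerR χ.flip π k x) * gen χ π (.K (π k))) := by
  refine LinearMap.congr_fun (f := LinearMap.mulRight K (gen χ π (.F k)) ∘ₗ wordsE χ π)
    (g := LinearMap.mulLeft K (gen χ π (.F k)) ∘ₗ wordsE χ π +
      (LinearMap.mulLeft K (gen χ π (.L (π k))) ∘ₗ wordsE χ π ∘ₗ skewDerL χ.flip π k -
        LinearMap.mulRight K (gen χ π (.K (π k))) ∘ₗ wordsE χ π ∘ₗ skewDerR χ.flip π k))
    (words_ext fun w => ?_) x
  simp only [LinearMap.add_apply, LinearMap.sub_apply, LinearMap.comp_apply,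
    LinearMap.mulLeft_apply, LinearMap.mulRight_apply, wordsE_wd]
  induction w with
  | nil => simp [Ew]
  | cons j w ih =>
    rw [Ew_cons, mul_assoc, ih, ← mul_assoc (gen χ π (.F k)),
      show gen χ π (.F k) * gen χ π (.E j) = gen χ π (.E j) * gen χ π (.F k) -
        if k = j then -gen χ π (.K (π k)) + gen χ π (.L (π k)) else 0 by
          rw [gen_E_mul_F]; by_cases h : k = j
          · subst h; simp
          · rw [if_neg h, if_neg (Ne.symm h)]; simp,
      skewDerL_wd_cons, skewDerR_wd_cons, map_add, map_add, map_smul, wordsE_consMap,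
      wordsE_consMap, mul_add, mul_sub, add_mul, mul_add (gen χ π (.L (π k))), mul_smul_comm,
      ← mul_assoc _ (gen χ π (.L _)), E_mul_L', ← mul_assoc (gen χ π (.L _)), smul_mul_assoc,
      sub_mul]
    split_ifs with h
    · subst h
      have hK := K_mul_homPart χ π (π k) (Ew_deg χ π w)
      rw [add_mul, neg_mul, hK, map_smul, wordsE_wd, smul_mul_assoc, Bicharacter.flip_apply,
        Bicharacter.flip_apply]
      simp only [mul_assoc]
      abel
    · simp only [map_zero, mul_zero, zero_mul, add_zero, mul_assoc, sub_zero, Bicharacter.flip_apply]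

theorem wordsF_mem (y : Words K l) : wordsF χ π y ∈ Uminus χ π := by
  induction y using Finsupp.induction_linear with
  | zero => simp
  | add x y hx hy => rw [map_add]; exact add_mem hx hy
  | single w c =>
    rw [wordsF, Finsupp.linearCombination_single]
    refine Subalgebra.smul_mem _ (Subalgebra.list_prod_mem _ fun x hx => ?_) _
    obtain ⟨i, _, rfl⟩ := List.mem_map.mp hx
    exact Algebra.subset_adjoin ⟨i, rfl⟩

theorem wordsE_mem (y : Words K l) : wordsE χ π y ∈ Uplus χ π := by
  induction y using Finsupp.induction_linear with
  | zero => simp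
  | add x y hx hy => rw [map_add]; exact add_mem hx hy
  | single w c =>
    rw [wordsE, Finsupp.linearCombination_single]
    refine Subalgebra.smul_mem _ (Subalgebra.list_prod_mem _ fun x hx => ?_) _
    obtain ⟨i, _, rfl⟩ := List.mem_map.mp hx
    exact Algebra.subset_adjoin ⟨i, rfl⟩

theorem wordsF_deg {β : A} {y : Words K l} (hy : y ∈ wordsDeg K π β) :
    wordsF χ π y ∈ homPart χ π (-β) :=
  wordsDeg_ind π _ _ (fun w hw => by rw [wordsF_wd, ← hw]; exact Fw_deg χ π w) hy

theorem wordsE_deg {β : A} {y : Words K l} (hy : y ∈ wordsDeg K π β) :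
    wordsE χ π y ∈ homPart χ π β :=
  wordsDeg_ind π _ _ (fun w hw => by rw [wordsE_wd, ← hw]; exact Ew_deg χ π w) hy

/-- A linear map on the free algebra that vanishes on the homogeneous elements of the radical of
`B` vanishes on the radical. -/
theorem eq_zero_of_deg {N : Type*} [AddCommGroup N] [Module K N] (f : Words K l →ₗ[K] N)
    (h : ∀ β, ∀ y ∈ wordsDeg K π β, (∀ u, wordForm χ π (wd K u) y = 0) → f y = 0)
    (y : Words K l) (hy : ∀ u, wordForm χ π (wd K u) y = 0) : f y = 0 := by
  classical
  let c : A → Words K l := fun β => ∑ w ∈ y.support with wordWt π w = β, y w • wd K w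
  have hc : ∀ β, c β ∈ wordsDeg K π β := fun β =>
    Submodule.sum_mem _ fun w hw => Submodule.smul_mem _ _
      (Submodule.subset_span ⟨w, (Finset.mem_filter.mp hw).2, rfl⟩)
  have hsum : y = ∑ β ∈ y.support.image (wordWt π), c β := by
    refine Eq.trans ?_ (Finset.sum_fiberwise_of_maps_to (g := wordWt π)
      (fun w hw => Finset.mem_image_of_mem _ hw) fun w => y w • wd K w).symm
    conv_lhs => rw [← y.sum_single, Finsupp.sum]
    simp
  rw [hsum, map_sum]
  refine Finset.sum_eq_zero fun β hβ => h β _ (hc β) fun u => ?_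
  by_cases hu : wordWt π u = β
  · have h1 := hy u
    rw [hsum, map_sum, Finset.sum_eq_single β (fun b _ hb =>
      wordForm_of_ne χ π (hc b) (fun h' => hb (h'.symm.trans hu))) (fun h' => absurd hβ h')] at h1
    exact h1
  · exact wordForm_of_ne χ π (hc β) hu

end Realization

section Basis
variable {A : Type u} {K : Type v} [AddCommGroup A] [Field K] {l : ℕ}
variable (χ : Bicharacter A K) (π : Module.Basis (Fin l) ℤ A)

theorem sum_repr_wordWt (w : List (Fin l)) : ∑ i, π.repr (wordWt π w) i = w.length := by
  induction w with
  | nil => simp [wordWt]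
  | cons j w ih =>
    simp [wordWt_cons, Finset.sum_add_distrib, ih, Finsupp.single_apply, add_comm]

theorem eq_nil_of_wordWt {w : List (Fin l)} (h : wordWt π w = 0) : w = [] := by
  have := sum_repr_wordWt π w
  rw [h] at this
  simpa using this.symm

theorem finite_wordWt (β : A) : {w : List (Fin l) | wordWt π w = β}.Finite := by
  refine (List.finite_length_eq (Fin l) (∑ i, π.repr β i).toNat).subset fun w hw => ?_
  have := sum_repr_wordWt π w
  rw [hw] at this
  simp [this]

/-- Induction on the weight, for homogeneous elements of the free algebra: as the `α_i` form a basis,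
the weight of a word determines its length. -/
theorem wordsDeg_induction {P : A → Words K l → Prop}
    (h : ∀ β y, (∀ k : Fin l, ∀ z ∈ wordsDeg K π (β - π k), P (β - π k) z) →
      y ∈ wordsDeg K π β → P β y) (β : A) (y : Words K l) (hy : y ∈ wordsDeg K π β)
      (h0 : ∀ β, P β 0) : P β y := by
  have key : ∀ n : ℕ, ∀ β y, y ∈ wordsDeg K π β → (∑ i, π.repr β i).toNat < n → P β y := by
    intro n
    induction n with
    | zero => intro β y _ hn; omega
    | succ n ih =>
      intro β y hy hn
      by_cases hβ : ∃ w, wordWt π w = β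
      · obtain ⟨w, hw⟩ := hβ
        have hlen := sum_repr_wordWt π w
        rw [hw] at hlen
        refine h β y (fun k z hz => ?_) hy
        have hk : ∑ i, π.repr (β - π k) i = w.length - 1 := by
          simp [Finset.sum_sub_distrib, hlen, Finsupp.single_apply]
        by_cases hβ' : ∃ w', wordWt π w' = β - π k
        · obtain ⟨w', hw'⟩ := hβ'
          have hlen' := sum_repr_wordWt π w'
          rw [hw'] at hlen'
          exact ih _ z hz (by omega)
        · have : z = 0 := by
            have := wordsDeg_ind (K := K) (π : Fin l → A) LinearMap.id ⊥
              (fun w hw => absurd ⟨w, hw⟩ hβ') hz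
            simpa using this
          rw [this]; exact h0 _
      · have : y = 0 := by
          have := wordsDeg_ind (K := K) (π : Fin l → A) LinearMap.id ⊥
            (fun w hw => absurd ⟨w, hw⟩ hβ) hy
          simpa using this
        rw [this]; exact h0 _
  exact key _ β y hy (Nat.lt_succ_self _)

theorem wordsDeg_zero {y : Words K l} (hy : y ∈ wordsDeg K π 0) : y = y [] • wd K [] := by
  refine wordsDeg_eq (π : Fin l → A) LinearMap.id
    (LinearMap.toSpanSingleton K _ (wd K []) ∘ₗ Finsupp.lapply []) (fun w hw => ?_) hy
  rw [eq_nil_of_wordWt π hw]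
  simp

/-- The right radical of `B` is mapped to zero in `U⁻`: both skew derivations preserve it, so by
induction on the weight the image of a homogeneous element commutes with all `E_k`. -/
theorem wordsF_eq_zero (y : Words K l) (hy : ∀ u, wordForm χ π (wd K u) y = 0) :
    wordsF χ π y = 0 := by
  refine eq_zero_of_deg χ π _ (fun β y hy => ?_) y hy
  refine wordsDeg_induction π (P := fun _ y => (∀ u, wordForm χ π (wd K u) y = 0) →
    wordsF χ π y = 0) (fun β y ih hy h => ?_) β y hy (fun _ _ => map_zero _)
  by_cases hβ : β = 0
  · subst hβ
    have h1 := h []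
    rw [wordForm_nil] at h1
    rw [wordsDeg_zero π hy, h1, zero_smul, map_zero]
  · refine eq_zero_of_comm_E χ π (neg_ne_zero.mpr hβ) _ (wordsF_mem χ π y) (wordsF_deg χ π hy)
      fun k => ?_
    rw [gen_E_mul_wordsF, ih k _ (skewDerR_deg χ π k hy), ih k _ (skewDerL_deg χ π k hy)]
    · simp
    · intro u; rw [← wordForm_wd_cons, h]
    · intro u; rw [← wordForm_wd_snoc, h]

/-- The left radical of `B` is mapped to zero in `U⁺`. -/
theorem wordsE_eq_zero (x : Words K l) (hx : ∀ w, wordForm χ π x (wd K w) = 0) :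
    wordsE χ π x = 0 := by
  refine eq_zero_of_deg χ.flip π _ (fun β y hy => ?_) x (fun w => by rw [wordForm_flip, hx])
  refine wordsDeg_induction π (P := fun _ y => (∀ u, wordForm χ.flip π (wd K u) y = 0) →
    wordsE χ π y = 0) (fun β y ih hy h => ?_) β y hy (fun _ _ => map_zero _)
  by_cases hβ : β = 0
  · subst hβ
    have h1 := h []
    rw [wordForm_nil] at h1
    rw [wordsDeg_zero π hy, h1, zero_smul, map_zero]
  · refine eq_zero_of_comm_F χ π hβ _ (wordsE_mem χ π y) (wordsE_deg χ π hy) fun k => ?_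
    rw [wordsE_mul_gen_F, ih k _ (skewDerR_deg _ π k hy), ih k _ (skewDerL_deg _ π k hy)]
    · simp
    · intro u; rw [← wordForm_wd_cons, h]
    · intro u; rw [← wordForm_wd_snoc, h]

end Basis

/-! ### The quasi-R-matrix -/

section TensorSeparation

variable {K V W V' W' : Type*} [Field K] [AddCommGroup V] [Module K V] [AddCommGroup W]
  [Module K W] [AddCommGroup V'] [Module K V'] [AddCommGroup W'] [Module K W']

/-- Functionals on the left factor separate the elements of a tensor product. -/
theorem tensor_eq_zero_of_functionals (Z : V ⊗[K] W)
    (h : ∀ f : V →ₗ[K] K, TensorProduct.lid K W (f.rTensor W Z) = 0) : Z = 0 := by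
  classical
  let b := Module.Basis.ofVectorSpace K V
  apply (TensorProduct.equivFinsuppOfBasisLeft (N := W) b).injective
  rw [map_zero]
  refine Finsupp.ext fun i => ?_
  rw [Finsupp.zero_apply, ← h (b.coord i)]
  clear h
  induction Z using TensorProduct.induction_on with
  | zero => simp
  | tmul x y => simp
  | add x y hx hy => simp [hx, hy]

/-- If families of functionals `s`, `t` have common kernels inside the kernels of `f`, `g`, then
`f ⊗ g` vanishes on every tensor on which all `s i ⊗ t j` vanish. -/
theorem map_eq_zero_of_functionals {ι κ : Type*} (s : ι → V →ₗ[K] K) (t : κ → W →ₗ[K] K)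
    (f : V →ₗ[K] V') (g : W →ₗ[K] W') (hf : ∀ x, (∀ i, s i x = 0) → f x = 0)
    (hg : ∀ y, (∀ j, t j y = 0) → g y = 0) (X : V ⊗[K] W)
    (hX : ∀ i j, LinearMap.mul' K K (TensorProduct.map (s i) (t j) X) = 0) :
    TensorProduct.map f g X = 0 := by
  -- Contract the right factor with `t j`, apply `f`, and then contract the left factor with an
  -- arbitrary functional `p` of `V'`.
  have h1 : ∀ j, f (TensorProduct.rid K V ((t j).lTensor V X)) = 0 := fun j => hf _ fun i => by
    rw [← hX i j]
    refine LinearMap.congr_fun (f := s i ∘ₗ (TensorProduct.rid K V).toLinearMap ∘ₗ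
      (t j).lTensor V) (g := LinearMap.mul' K K ∘ₗ TensorProduct.map (s i) (t j)) ?_ X
    ext x y
    simp [mul_comm]
  refine tensor_eq_zero_of_functionals _ fun p => ?_
  have h2 : g (TensorProduct.lid K W ((p ∘ₗ f).rTensor W X)) = 0 := hg _ fun j => by
    have h3 := congrArg p (h1 j)
    rw [map_zero] at h3
    rw [← h3]
    refine LinearMap.congr_fun (f := t j ∘ₗ (TensorProduct.lid K W).toLinearMap ∘ₗ
      (p ∘ₗ f).rTensor W) (g := p ∘ₗ f ∘ₗ (TensorProduct.rid K V).toLinearMap ∘ₗ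
      (t j).lTensor V) ?_ X
    ext x y
    simp [mul_comm]
  rw [← h2]
  refine LinearMap.congr_fun (f := (TensorProduct.lid K W').toLinearMap ∘ₗ p.rTensor W' ∘ₗ
    TensorProduct.map f g) (g := g ∘ₗ (TensorProduct.lid K W).toLinearMap ∘ₗ
    (p ∘ₗ f).rTensor W) ?_ X
  ext x y
  simp

/-- Every square matrix over a field has a generalized inverse. -/
theorem exists_matrix_mul_mul_self {n : Type*} [Fintype n] [DecidableEq n] (B : Matrix n n K) :
    ∃ C : Matrix n n K, B * C * B = B := by
  obtain ⟨s, hs⟩ := (Matrix.toLin' B).rangeRestrict.exists_rightInverse_of_surjective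
    (LinearMap.range_rangeRestrict _)
  obtain ⟨c, hc⟩ := s.exists_extend
  refine ⟨LinearMap.toMatrix' c, (Matrix.toLin' (R := K)).injective ?_⟩
  rw [Matrix.toLin'_mul, Matrix.toLin'_mul, Matrix.toLin'_toMatrix']
  refine LinearMap.ext fun x => ?_
  have h1 := LinearMap.congr_fun hc ((Matrix.toLin' B).rangeRestrict x)
  have h2 := congrArg Subtype.val (LinearMap.congr_fun hs ((Matrix.toLin' B).rangeRestrict x))
  simp only [LinearMap.comp_apply] at h1 h2 ⊢
  have h3 : c (Matrix.toLin' B x) = s ((Matrix.toLin' B).rangeRestrict x) := h1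
  rw [h3]
  exact h2

end TensorSeparation

section QuasiR

variable {A : Type u} {K : Type v} [AddCommGroup A] [Field K] {l : ℕ}
variable (χ : Bicharacter A K)

/-- The functional `B(u, ·) ⊗ B(·, y)`. -/
def formPair (π : Fin l → A) (x y : Words K l) : Words K l ⊗[K] Words K l →ₗ[K] K :=
  LinearMap.mul' K K ∘ₗ TensorProduct.map (wordForm χ π x) ((wordForm χ π).flip y)

theorem formPair_tmul (π : Fin l → A) (x y a b : Words K l) :
    formPair χ π x y (a ⊗ₜ b) = wordForm χ π x a * wordForm χ π b y := by
  simp [formPair]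

variable (π : Module.Basis (Fin l) ℤ A)

/-- The span of the `w ⊗ w'` with words `w`, `w'` of weight `β`. -/
def wordsDeg₂ (K : Type v) [Field K] (π : Fin l → A) (β : A) :
    Submodule K (Words K l ⊗[K] Words K l) :=
  Submodule.span K {x | ∃ w w', wordWt π w = β ∧ wordWt π w' = β ∧ wd K w ⊗ₜ wd K w' = x}

/-- In every weight there is a tensor that inverts `B`. -/
theorem exists_canonical (β : A) : ∃ t ∈ wordsDeg₂ K (π : Fin l → A) β,
    ∀ u w, wordWt π u = β → wordWt π w = β →
      formPair χ π (wd K u) (wd K w) t = wordForm χ π (wd K u) (wd K w) := by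
  classical
  have : Fintype {w : List (Fin l) // wordWt π w = β} := (finite_wordWt π β).fintype
  -- The coefficients of the tensor form a generalized inverse of the matrix of `B` in weight `β`.
  let B : Matrix {w : List (Fin l) // wordWt π w = β} {w : List (Fin l) // wordWt π w = β} K :=
    fun u w => wordForm χ π (wd K u) (wd K w)
  obtain ⟨C, hC⟩ := exists_matrix_mul_mul_self B
  refine ⟨∑ j, ∑ i, C i j • wd K i.1 ⊗ₜ wd K j.1, ?_, fun u w hu hw => ?_⟩
  · exact Submodule.sum_mem _ fun j _ => Submodule.sum_mem _ fun i _ => Submodule.smul_mem _ _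
      (Submodule.subset_span ⟨_, _, i.2, j.2, rfl⟩)
  · have h := congrFun (congrFun hC ⟨u, hu⟩) ⟨w, hw⟩
    rw [Matrix.mul_apply] at h
    refine Eq.trans ?_ h
    rw [map_sum]
    refine Finset.sum_congr rfl fun j _ => ?_
    rw [map_sum, Matrix.mul_apply, Finset.sum_mul]
    refine Finset.sum_congr rfl fun i _ => ?_
    rw [map_smul, formPair_tmul, smul_eq_mul]
    simp only [B]
    ring

/-- The weight `β` part of the canonical tensor of `B`. -/
def canonical (β : A) : Words K l ⊗[K] Words K l := (exists_canonical χ π β).choose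

theorem canonical_mem (β : A) : canonical χ π β ∈ wordsDeg₂ K (π : Fin l → A) β :=
  (exists_canonical χ π β).choose_spec.1

theorem formPair_left_ne {β : A} {t : Words K l ⊗[K] Words K l}
    (ht : t ∈ wordsDeg₂ K (π : Fin l → A) β) {u : List (Fin l)} (y : Words K l)
    (hu : wordWt π u ≠ β) : formPair χ π (wd K u) y t = 0 := by
  have : wordsDeg₂ K (π : Fin l → A) β ≤ LinearMap.ker (formPair χ π (wd K u) y) := by
    refine Submodule.span_le.mpr ?_
    rintro _ ⟨w, w', hw, -, rfl⟩
    rw [SetLike.mem_coe, LinearMap.mem_ker, formPair_tmul,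
      wordForm_of_ne χ π (wd_mem (π : Fin l → A) w) (by rwa [hw]), zero_mul]
  exact this ht

theorem formPair_right_ne {β : A} {t : Words K l ⊗[K] Words K l}
    (ht : t ∈ wordsDeg₂ K (π : Fin l → A) β) {w : List (Fin l)} (x : Words K l)
    (hw : wordWt π w ≠ β) : formPair χ π x (wd K w) t = 0 := by
  have : wordsDeg₂ K (π : Fin l → A) β ≤ LinearMap.ker (formPair χ π x (wd K w)) := by
    refine Submodule.span_le.mpr ?_
    rintro _ ⟨v, v', -, hv, rfl⟩
    rw [SetLike.mem_coe, LinearMap.mem_ker, formPair_tmul, 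
      wordForm_of_ne χ π (wd_mem (π : Fin l → A) w) (by rw [hv]; exact hw.symm), mul_zero]
  exact this ht

open Classical in
/-- Pairing the canonical tensor with two elements returns the value of `B`. -/
theorem formPair_canonical_left (β : A) (u : List (Fin l)) (y : Words K l) :
    formPair χ π (wd K u) y (canonical χ π β) =
      if wordWt π u = β then wordForm χ π (wd K u) y else 0 := by
  have lin : ∀ t, ∃ g : Words K l →ₗ[K] K, ∀ y, g y = formPair χ π (wd K u) y t := fun t =>
    ⟨{ toFun := fun y => formPair χ π (wd K u) y t
       map_add' := fun y y' => by simp [formPair, TensorProduct.map_add_right]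
       map_smul' := fun r y => by simp [formPair, TensorProduct.map_smul_right] }, fun _ => rfl⟩
  obtain ⟨g, hg⟩ := lin (canonical χ π β)
  rw [← hg]
  split_ifs with hu
  · refine LinearMap.congr_fun (words_ext fun w => ?_) y
    rw [hg]
    by_cases hw : wordWt π w = β
    · exact (exists_canonical χ π β).choose_spec.2 u w hu hw
    · rw [formPair_right_ne χ π (canonical_mem χ π β) _ hw,
        wordForm_of_ne χ π (wd_mem (π : Fin l → A) w) (by rw [hu]; exact Ne.symm hw)]
  · rw [hg]
    exact formPair_left_ne χ π (canonical_mem χ π β) _ hu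

open Classical in
theorem formPair_canonical_right (β : A) (x : Words K l) (w : List (Fin l)) :
    formPair χ π x (wd K w) (canonical χ π β) =
      if wordWt π w = β then wordForm χ π x (wd K w) else 0 := by
  have lin : ∀ t, ∃ g : Words K l →ₗ[K] K, ∀ x, g x = formPair χ π x (wd K w) t := fun t =>
    ⟨{ toFun := fun x => formPair χ π x (wd K w) t
       map_add' := fun y y' => by simp [formPair, TensorProduct.map_add_left]
       map_smul' := fun r y => by simp [formPair, TensorProduct.map_smul_left] }, fun _ => rfl⟩
  obtain ⟨g, hg⟩ := lin (canonical χ π β)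
  rw [← hg]
  split_ifs with hw
  · refine LinearMap.congr_fun (g := (wordForm χ π).flip (wd K w)) (words_ext fun u => ?_) x
    rw [hg, LinearMap.flip_apply]
    by_cases hu : wordWt π u = β
    · exact (exists_canonical χ π β).choose_spec.2 u w hu hw
    · rw [formPair_left_ne χ π (canonical_mem χ π β) _ hu,
        wordForm_of_ne χ π (wd_mem (π : Fin l → A) w) (by rw [hw]; exact hu)]
  · rw [hg]
    exact formPair_right_ne χ π (canonical_mem χ π β) _ hw

/-- The realization of tensors of words in `U⁻ ⊗ U⁺`. -/
def realize : Words K l ⊗[K] Words K l →ₗ[K] GQG χ π ⊗[K] GQG χ π :=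
  TensorProduct.map (wordsF χ π) (wordsE χ π)

/-- Tensors of words are equal in `U⁻ ⊗ U⁺` if they are not separated by `B`. -/
theorem realize_eq (X Y : Words K l ⊗[K] Words K l)
    (h : ∀ u w, formPair χ π (wd K u) (wd K w) X = formPair χ π (wd K u) (wd K w) Y) :
    realize χ π X = realize χ π Y := by
  rw [← sub_eq_zero, ← map_sub]
  refine map_eq_zero_of_functionals (fun u => wordForm χ π (wd K u))
    (fun w => (wordForm χ π).flip (wd K w)) _ _ (wordsF_eq_zero χ π) (wordsE_eq_zero χ π) _
    fun u w => ?_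
  have h1 := h u w
  rw [← sub_eq_zero, ← map_sub] at h1
  exact h1

theorem formPair_rTensor (f : Words K l →ₗ[K] Words K l) (x x' y : Words K l)
    (h : wordForm χ π x ∘ₗ f = wordForm χ π x') (X : Words K l ⊗[K] Words K l) :
    formPair χ π x y (f.rTensor _ X) = formPair χ π x' y X := by
  rw [formPair, formPair, ← h, LinearMap.comp_apply, LinearMap.comp_apply, LinearMap.rTensor,
    ← LinearMap.comp_apply (TensorProduct.map _ _), ← TensorProduct.map_comp, LinearMap.comp_id]

theorem formPair_lTensor (f : Words K l →ₗ[K] Words K l) (x y y' : Words K l)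
    (h : (wordForm χ π).flip y ∘ₗ f = (wordForm χ π).flip y') (X : Words K l ⊗[K] Words K l) :
    formPair χ π x y (f.lTensor _ X) = formPair χ π x y' X := by
  rw [formPair, formPair, ← h, LinearMap.comp_apply, LinearMap.comp_apply, LinearMap.lTensor,
    ← LinearMap.comp_apply (TensorProduct.map _ _), ← TensorProduct.map_comp, LinearMap.comp_id]

/-- The part `Θ_β ∈ U⁻ ⊗ U⁺` of weight `β` of the quasi-R-matrix. -/
def quasiR (β : A) : GQG χ π ⊗[K] GQG χ π := realize χ π (canonical χ π β)

/-- The intertwining property of `Θ` for `E_k`. -/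
theorem gen_E_mul_quasiR (k : Fin l) (β : A) :
    (gen χ π (.E k) ⊗ₜ[K] (1 : GQG χ π)) * quasiR χ π β =
      quasiR χ π β * (gen χ π (.E k) ⊗ₜ[K] (1 : GQG χ π)) +
      (quasiR χ π (β - π k) * (gen χ π (.L (π k)) ⊗ₜ gen χ π (.E k)) -
        (gen χ π (.K (π k)) ⊗ₜ gen χ π (.E k)) * quasiR χ π (β - π k)) := by
  classical
  have h1 : realize χ π ((skewDerR χ π k).rTensor _ (canonical χ π β)) =
      realize χ π ((snocMap K k).lTensor _ (canonical χ π (β - π k))) := by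
    refine realize_eq χ π _ _ fun u w => ?_
    rw [formPair_rTensor χ π (skewDerR χ π k) (wd K u) (wd K (u ++ [k])) _
        (LinearMap.ext fun y => (wordForm_wd_snoc χ π k u y).symm),
      formPair_lTensor χ π (snocMap K k) _ (wd K w) (skewDerR χ π k (wd K w))
        (LinearMap.ext fun x => wordForm_snocMap_left χ π k x _),
      formPair_canonical_left, formPair_canonical_left, wordForm_wd_snoc]
    simp [wordWt, eq_sub_iff_add_eq]
  have h2 : realize χ π ((skewDerL χ π k).rTensor _ (canonical χ π β)) =
      realize χ π ((consMap K k).lTensor _ (canonical χ π (β - π k))) := by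
    refine realize_eq χ π _ _ fun u w => ?_
    rw [formPair_rTensor χ π (skewDerL χ π k) (wd K u) (wd K (k :: u)) _
        (LinearMap.ext fun y => (wordForm_wd_cons χ π k u y).symm),
      formPair_lTensor χ π (consMap K k) _ (wd K w) (skewDerL χ π k (wd K w))
        (LinearMap.ext fun x => wordForm_consMap_left χ π k x _),
      formPair_canonical_left, formPair_canonical_left, wordForm_wd_cons]
    simp [wordWt, eq_sub_iff_add_eq']
  have h3 : ∀ t, (gen χ π (.E k) ⊗ₜ[K] (1 : GQG χ π)) * realize χ π t =
      realize χ π t * (gen χ π (.E k) ⊗ₜ[K] (1 : GQG χ π)) +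
      (realize χ π ((skewDerR χ π k).rTensor _ t) * (gen χ π (.L (π k)) ⊗ₜ 1) -
        (gen χ π (.K (π k)) ⊗ₜ 1) * realize χ π ((skewDerL χ π k).rTensor _ t)) := fun t => by
    induction t using TensorProduct.induction_on with
    | zero => simp
    | tmul x y =>
      simp [realize, gen_E_mul_wordsF, TensorProduct.add_tmul, TensorProduct.sub_tmul]
    | add x y hx hy => simp only [map_add, mul_add, add_mul, hx, hy]; abel
  have h4 : ∀ t, realize χ π ((snocMap K k).lTensor _ t) * (gen χ π (.L (π k)) ⊗ₜ 1) =
      realize χ π t * (gen χ π (.L (π k)) ⊗ₜ gen χ π (.E k)) := fun t => by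
    induction t using TensorProduct.induction_on with
    | zero => simp
    | tmul x y => simp [realize, wordsE_snocMap]
    | add x y hx hy => simp only [map_add, add_mul, hx, hy]
  have h5 : ∀ t, (gen χ π (.K (π k)) ⊗ₜ 1) * realize χ π ((consMap K k).lTensor _ t) =
      (gen χ π (.K (π k)) ⊗ₜ gen χ π (.E k)) * realize χ π t := fun t => by
    induction t using TensorProduct.induction_on with
    | zero => simp
    | tmul x y => simp [realize, wordsE_consMap]
    | add x y hx hy => simp only [map_add, mul_add, hx, hy]
  rw [quasiR, quasiR, h3, h1, h2, h4, h5]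

/-- The intertwining property of `Θ` for `F_k`. -/
theorem quasiR_mul_gen_F (k : Fin l) (β : A) :
    quasiR χ π β * ((1 : GQG χ π) ⊗ₜ[K] gen χ π (.F k)) =
      ((1 : GQG χ π) ⊗ₜ[K] gen χ π (.F k)) * quasiR χ π β +
      ((gen χ π (.F k) ⊗ₜ gen χ π (.L (π k))) * quasiR χ π (β - π k) -
        quasiR χ π (β - π k) * (gen χ π (.F k) ⊗ₜ gen χ π (.K (π k)))) := by
  classical
  have h1 : realize χ π ((skewDerL χ.flip π k).lTensor _ (canonical χ π β)) =
      realize χ π ((consMap K k).rTensor _ (canonical χ π (β - π k))) := by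
    refine realize_eq χ π _ _ fun u w => ?_
    rw [formPair_lTensor χ π (skewDerL χ.flip π k) _ (wd K w) (wd K (k :: w))
        (LinearMap.ext fun y => by
          simp only [LinearMap.comp_apply, LinearMap.flip_apply]
          rw [← consMap_wd, wordForm_consMap_right]),
      formPair_rTensor χ π (consMap K k) (wd K u) (skewDerL χ.flip π k (wd K u)) _
        (LinearMap.ext fun x => wordForm_consMap_right χ π k _ x),
      formPair_canonical_right, formPair_canonical_right, ← consMap_wd, wordForm_consMap_right]
    simp [wordWt, eq_sub_iff_add_eq']
  have h2 : realize χ π ((skewDerR χ.flip π k).lTensor _ (canonical χ π β)) =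
      realize χ π ((snocMap K k).rTensor _ (canonical χ π (β - π k))) := by
    refine realize_eq χ π _ _ fun u w => ?_
    rw [formPair_lTensor χ π (skewDerR χ.flip π k) _ (wd K w) (wd K (w ++ [k]))
        (LinearMap.ext fun y => by
          simp only [LinearMap.comp_apply, LinearMap.flip_apply]
          rw [← snocMap_wd, wordForm_snocMap_right]),
      formPair_rTensor χ π (snocMap K k) (wd K u) (skewDerR χ.flip π k (wd K u)) _
        (LinearMap.ext fun x => wordForm_snocMap_right χ π k _ x),
      formPair_canonical_right, formPair_canonical_right, ← snocMap_wd, wordForm_snocMap_right]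
    simp [wordWt, eq_sub_iff_add_eq]
  have h3 : ∀ t, realize χ π t * ((1 : GQG χ π) ⊗ₜ[K] gen χ π (.F k)) =
      ((1 : GQG χ π) ⊗ₜ[K] gen χ π (.F k)) * realize χ π t +
      ((1 ⊗ₜ gen χ π (.L (π k))) * realize χ π ((skewDerL χ.flip π k).lTensor _ t) -
        realize χ π ((skewDerR χ.flip π k).lTensor _ t) * (1 ⊗ₜ gen χ π (.K (π k)))) := fun t => by
    induction t using TensorProduct.induction_on with
    | zero => simp
    | tmul x y =>
      simp [realize, wordsE_mul_gen_F, TensorProduct.tmul_add, TensorProduct.tmul_sub]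
    | add x y hx hy => simp only [map_add, mul_add, add_mul, hx, hy]; abel
  have h4 : ∀ t, (1 ⊗ₜ gen χ π (.L (π k))) * realize χ π ((consMap K k).rTensor _ t) =
      (gen χ π (.F k) ⊗ₜ gen χ π (.L (π k))) * realize χ π t := fun t => by
    induction t using TensorProduct.induction_on with
    | zero => simp
    | tmul x y => simp [realize, wordsF_consMap]
    | add x y hx hy => simp only [map_add, mul_add, hx, hy]
  have h5 : ∀ t, realize χ π ((snocMap K k).rTensor _ t) * (1 ⊗ₜ gen χ π (.K (π k))) =
      realize χ π t * (gen χ π (.F k) ⊗ₜ gen χ π (.K (π k))) := fun t => by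
    induction t using TensorProduct.induction_on with
    | zero => simp
    | tmul x y => simp [realize, wordsF_snocMap]
    | add x y hx hy => simp only [map_add, add_mul, hx, hy]
  rw [quasiR, quasiR, h3, h1, h2, h4, h5]

theorem quasiR_zero : quasiR χ π 0 = 1 := by
  have : quasiR χ π 0 = realize χ π (wd K [] ⊗ₜ wd K []) := by
    classical
    refine realize_eq χ π _ _ fun u w => ?_
    rw [formPair_canonical_left, formPair_tmul]
    have hnil : ∀ w : List (Fin l), wordForm χ π (wd K w) (wd K []) = if w = [] then 1 else 0 := by
      intro w
      cases w with
      | nil => simp [wordForm_nil]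
      | cons j w => simp [wordForm_wd_cons]
    rw [wordForm_nil, hnil]
    by_cases hu : u = []
    · subst hu; simp [wordWt, wordForm_nil]
    · rw [if_neg hu, if_neg (fun h => hu (eq_nil_of_wordWt π h)), zero_mul]
  rw [this, realize, TensorProduct.map_tmul, wordsF_wd, wordsE_wd, Algebra.TensorProduct.one_def]
  simp [Fw, Ew]

/-- `Θ_β` is a combination of the `F_w ⊗ E_{w'}` with words `w`, `w'` of weight `β`. -/
theorem quasiR_mem (β : A) : quasiR χ π β ∈ Submodule.span K
    {x | ∃ w w', wordWt π w = β ∧ wordWt π w' = β ∧ Fw χ π w ⊗ₜ[K] Ew χ π w' = x} := by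
  have : wordsDeg₂ K (π : Fin l → A) β ≤ (Submodule.span K
    {x | ∃ w w', wordWt π w = β ∧ wordWt π w' = β ∧ Fw χ π w ⊗ₜ[K] Ew χ π w' = x}).comap
      (realize χ π) := by
    refine Submodule.span_le.mpr ?_
    rintro _ ⟨w, w', hw, hw', rfl⟩
    exact Submodule.subset_span ⟨w, w', hw, hw', by simp [realize]⟩
  exact this (canonical_mem χ π β)

end QuasiR

/-! ### The flipped and twisted quasi-R-matrix -/

section Twist

variable {A : Type u} {K : Type v} [AddCommGroup A] [Field K] {l : ℕ}
variable (χ : Bicharacter A K)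

section Torus
variable (π : Fin l → A)

theorem KL_mul_homPart (a b : A) {d : A} {x : GQG χ π} (hx : x ∈ homPart χ π d) :
    KL χ π a b * x = ((χ a d * χ (-d) b : Kˣ) : K) • (x * KL χ π a b) := by
  rw [KL, mul_assoc, L_mul_homPart χ π b hx, mul_smul_comm, ← mul_assoc, K_mul_homPart χ π a hx,
    smul_mul_assoc, smul_smul, mul_assoc, Units.val_mul, mul_comm]

/-- The torus element `K_a L_b ⊗ K_c L_d` of `U ⊗ U`. -/
def torus₂ (a b c d : A) : GQG χ π ⊗[K] GQG χ π := KL χ π a b ⊗ₜ KL χ π c d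

theorem torus₂_mul (a b c d a' b' c' d' : A) : torus₂ χ π a b c d * torus₂ χ π a' b' c' d' =
    torus₂ χ π (a + a') (b + b') (c + c') (d + d') := by
  simp [torus₂, KL_mul_KL]

/-- The elements of `U ⊗ U` of degree `(d, e)`. -/
def bihom (d e : A) : Submodule K (GQG χ π ⊗[K] GQG χ π) :=
  Submodule.span K {z | ∃ x ∈ homPart χ π d, ∃ y ∈ homPart χ π e, x ⊗ₜ y = z}

theorem torus₂_mul_bihom (a b a' b' : A) {d e : A} {z : GQG χ π ⊗[K] GQG χ π}
    (hz : z ∈ bihom χ π d e) : torus₂ χ π a b a' b' * z =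
      ((χ a d * χ (-d) b * (χ a' e * χ (-e) b') : Kˣ) : K) • (z * torus₂ χ π a b a' b') := by
  induction hz using Submodule.span_induction with
  | mem x hx =>
    obtain ⟨x, hx, y, hy, rfl⟩ := hx
    rw [torus₂, Algebra.TensorProduct.tmul_mul_tmul, KL_mul_homPart χ π _ _ hx,
      KL_mul_homPart χ π _ _ hy, TensorProduct.smul_tmul_smul, ← Units.val_mul,
      Algebra.TensorProduct.tmul_mul_tmul]
  | zero => simp
  | add x y _ _ hx hy => rw [mul_add, hx, hy, add_mul, smul_add]
  | smul r x _ hx => rw [mul_smul_comm, hx, smul_mul_assoc, smul_comm]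

theorem one_mem_homPart : (1 : GQG χ π) ∈ homPart χ π 0 :=
  Submodule.subset_span ⟨[], rfl, rfl⟩

theorem gen_mem_homPart (g : Gen A l) : gen χ π g ∈ homPart χ π (genDeg π g) :=
  Submodule.subset_span ⟨[g], by simp, by simp⟩

theorem gen_tmul_one_mem (g : Gen A l) : gen χ π g ⊗ₜ[K] (1 : GQG χ π) ∈
    bihom χ π (genDeg π g) 0 :=
  Submodule.subset_span ⟨_, gen_mem_homPart χ π g, _, one_mem_homPart χ π, rfl⟩

theorem one_tmul_gen_mem (g : Gen A l) : (1 : GQG χ π) ⊗ₜ[K] gen χ π g ∈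
    bihom χ π 0 (genDeg π g) :=
  Submodule.subset_span ⟨_, one_mem_homPart χ π, _, gen_mem_homPart χ π g, rfl⟩

end Torus

variable (π : Module.Basis (Fin l) ℤ A)

/-- The part `Θ'_γ ∈ U⁺ ⊗ U⁻` of the flipped quasi-R-matrix. -/
def quasiRflip (γ : A) : GQG χ π ⊗[K] GQG χ π :=
  Algebra.TensorProduct.comm K (GQG χ π) (GQG χ π) (quasiR χ π γ)

theorem quasiRflip_mem_span (γ : A) : quasiRflip χ π γ ∈ Submodule.span K
    {x | ∃ w w', wordWt π w = γ ∧ wordWt π w' = γ ∧ Ew χ π w ⊗ₜ[K] Fw χ π w' = x} := by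
  have : Submodule.span K
      {x | ∃ w w', wordWt π w = γ ∧ wordWt π w' = γ ∧ Fw χ π w ⊗ₜ[K] Ew χ π w' = x} ≤
    (Submodule.span K
      {x | ∃ w w', wordWt π w = γ ∧ wordWt π w' = γ ∧ Ew χ π w ⊗ₜ[K] Fw χ π w' = x}).comap
      (Algebra.TensorProduct.comm K (GQG χ π) (GQG χ π)).toLinearMap := by
    refine Submodule.span_le.mpr ?_
    rintro _ ⟨w, w', hw, hw', rfl⟩
    exact Submodule.subset_span ⟨w', w, hw', hw, by simp⟩
  exact this (quasiR_mem χ π γ)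

theorem quasiRflip_mem (γ : A) : quasiRflip χ π γ ∈ bihom χ π γ (-γ) := by
  refine Submodule.span_le.mpr ?_ (quasiRflip_mem_span χ π γ)
  rintro _ ⟨w, w', hw, hw', rfl⟩
  exact Submodule.subset_span ⟨_, hw ▸ Ew_deg χ π w, _, hw' ▸ Fw_deg χ π w', rfl⟩

theorem gen_E_mul_quasiRflip (k : Fin l) (γ : A) :
    ((1 : GQG χ π) ⊗ₜ[K] gen χ π (.E k)) * quasiRflip χ π γ =
      quasiRflip χ π γ * ((1 : GQG χ π) ⊗ₜ[K] gen χ π (.E k)) +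
      (quasiRflip χ π (γ - π k) * ((gen χ π (.E k) ⊗ₜ 1) * torus₂ χ π 0 0 0 (π k)) -
        (gen χ π (.E k) ⊗ₜ 1) * torus₂ χ π 0 0 (π k) 0 * quasiRflip χ π (γ - π k)) := by
  have h := congrArg (Algebra.TensorProduct.comm K (GQG χ π) (GQG χ π))
    (gen_E_mul_quasiR χ π k γ)
  simp only [map_mul, map_add, map_sub, Algebra.TensorProduct.comm_tmul] at h
  simpa [quasiRflip, torus₂, ← K_eq_KL, ← L_eq_KL, gen_K_zero] using h

theorem gen_F_mul_quasiRflip (k : Fin l) (γ : A) :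
    (gen χ π (.F k) ⊗ₜ[K] (1 : GQG χ π)) * quasiRflip χ π γ =
      quasiRflip χ π γ * (gen χ π (.F k) ⊗ₜ[K] (1 : GQG χ π)) +
      (quasiRflip χ π (γ - π k) * (torus₂ χ π (π k) 0 0 0 * (1 ⊗ₜ gen χ π (.F k))) -
        torus₂ χ π 0 (π k) 0 0 * (1 ⊗ₜ gen χ π (.F k)) * quasiRflip χ π (γ - π k)) := by
  have h := congrArg (Algebra.TensorProduct.comm K (GQG χ π) (GQG χ π))
    (quasiR_mul_gen_F χ π k γ)
  simp only [map_mul, map_add, map_sub, Algebra.TensorProduct.comm_tmul] at h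
  simp only [torus₂, ← K_eq_KL, ← L_eq_KL, Algebra.TensorProduct.tmul_mul_tmul, mul_one,
    one_mul, gen_K_zero]
  rw [quasiRflip, quasiRflip, h]
  abel

/-- The scalar `q(γ) = ω(γ)⁻¹ χ(γ,γ)⁻¹`. -/
def twistScalar (ω : A → Kˣ) (γ : A) : Kˣ := (ω γ)⁻¹ * (χ γ γ)⁻¹

/-- The recursion that determines the twist. -/
theorem twistScalar_sub {ω : A → Kˣ} (hω : ∀ a b, ω (a + b) = ω a * ω b) (γ k : A) :
    twistScalar χ ω γ = (ω k)⁻¹ * twistScalar χ ω (γ - k) * (χ k k * (χ k γ)⁻¹ * (χ γ k)⁻¹) := by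
  obtain ⟨δ, rfl⟩ : ∃ δ, γ = δ + k := ⟨γ - k, by simp⟩
  simp only [twistScalar, add_sub_cancel_right, hω, χ.map_add_left, χ.map_add_right]
  ext
  push_cast
  field_simp

/-- `Θ'_γ`, twisted by a torus element. The twist is chosen such that the intertwining relations
of `Θ'` continue those of `Θ` past the torus part of the central element. -/
def twistedR (ω : A → Kˣ) (γ : A) : GQG χ π ⊗[K] GQG χ π :=
  (twistScalar χ ω γ : K) • (quasiRflip χ π γ * torus₂ χ π (-γ) 0 0 (-γ))

/-- Moving a torus element past a homogeneous element, inside a product. -/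
theorem torus₂_mul_bihom_mul (a b a' b' : A) {d e : A} {z : GQG χ π ⊗[K] GQG χ π}
    (hz : z ∈ bihom χ π d e) (x : GQG χ π ⊗[K] GQG χ π) : torus₂ χ π a b a' b' * (z * x) =
      ((χ a d * χ (-d) b * (χ a' e * χ (-e) b') : Kˣ) : K) •
        (z * (torus₂ χ π a b a' b' * x)) := by
  rw [← mul_assoc, torus₂_mul_bihom χ π _ _ _ _ hz, smul_mul_assoc, mul_assoc z]

/-- The intertwining property of the twisted `Θ'` for `E_k`. -/
theorem gen_E_mul_twistedR {ω : A → Kˣ} (hω : ∀ a b, ω (a + b) = ω a * ω b) (k : Fin l) (γ : A) :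
    (torus₂ χ π (π k) 0 0 0 * (1 ⊗ₜ gen χ π (.E k))) * twistedR χ π ω γ =
      twistedR χ π ω γ * (torus₂ χ π (π k) 0 0 0 * (1 ⊗ₜ gen χ π (.E k))) +
      (twistedR χ π ω (γ - π k) * (((ω (π k))⁻¹ : Kˣ) : K) • (gen χ π (.E k) ⊗ₜ 1) -
        ((((ω (π k))⁻¹ : Kˣ) : K) • (torus₂ χ π 0 0 (π k) (-π k) * (gen χ π (.E k) ⊗ₜ 1))) *
          twistedR χ π ω (γ - π k)) := by
  have h1 := gen_tmul_one_mem χ π (.E k)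
  have h2 := one_tmul_gen_mem χ π (.E k)
  have h3 := quasiRflip_mem χ π γ
  have h4 := quasiRflip_mem χ π (γ - π k)
  simp only [genDeg] at h1 h2
  have hrel := gen_E_mul_quasiRflip χ π k γ
  rw [twistedR, twistedR, mul_smul_comm, mul_assoc, ← mul_assoc _ (quasiRflip χ π γ), hrel]
  -- Move all torus elements to the right and compare the three terms separately.
  simp only [mul_add, mul_sub, add_mul, sub_mul, smul_add, smul_sub, mul_assoc, smul_mul_assoc,
    mul_smul_comm, torus₂_mul_bihom χ π _ _ _ _ h1, torus₂_mul_bihom χ π _ _ _ _ h2,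
    torus₂_mul_bihom_mul χ π _ _ _ _ h3, torus₂_mul_bihom_mul χ π _ _ _ _ h4,
    torus₂_mul_bihom_mul χ π _ _ _ _ h1, torus₂_mul_bihom_mul χ π _ _ _ _ h2,
    torus₂_mul, smul_smul]
  rw [twistScalar_sub χ hω γ (π k)]
  have scal : ∀ {s t : K} {x y : GQG χ π ⊗[K] GQG χ π}, s = t → x = y → s • x = t • y := by
    rintro s t x y rfl rfl; rfl
  congr 1
  · refine scal ?_ (by congr 3 <;> abel)
    simp only [χ.neg_left, χ.neg_right, χ.zero_left, χ.zero_right, neg_neg, neg_zero]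
    push_cast
    field_simp
  · congr 1
    · refine scal ?_ (by congr 3 <;> abel)
      simp only [χ.map_add_left, χ.map_add_right, χ.neg_left, χ.neg_right, χ.zero_left,
        χ.zero_right, neg_neg, neg_zero, sub_eq_add_neg]
      push_cast
      field_simp
    · refine scal ?_ (by congr 3 <;> abel)
      simp only [χ.map_add_left, χ.map_add_right, χ.neg_left, χ.neg_right, χ.zero_left,
        χ.zero_right, neg_add, neg_neg, neg_zero, sub_eq_add_neg]
      push_cast
      field_simp

/-- The intertwining property of the twisted `Θ'` for `F_k`. -/
theorem gen_F_mul_twistedR {ω : A → Kˣ} (hω : ∀ a b, ω (a + b) = ω a * ω b) (k : Fin l) (γ : A) :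
    ((ω (π k) : K) • (torus₂ χ π 0 0 0 (π k) * (gen χ π (.F k) ⊗ₜ 1))) * twistedR χ π ω γ =
      twistedR χ π ω γ * ((ω (π k) : K) • (torus₂ χ π 0 0 0 (π k) * (gen χ π (.F k) ⊗ₜ 1))) +
      (twistedR χ π ω (γ - π k) * (1 ⊗ₜ gen χ π (.F k)) -
        (torus₂ χ π (-π k) (π k) 0 0 * (1 ⊗ₜ gen χ π (.F k))) *
          twistedR χ π ω (γ - π k)) := by
  have h1 := gen_tmul_one_mem χ π (.F k)
  have h2 := one_tmul_gen_mem χ π (.F k)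
  have h3 := quasiRflip_mem χ π γ
  have h4 := quasiRflip_mem χ π (γ - π k)
  simp only [genDeg] at h1 h2
  have hrel := gen_F_mul_quasiRflip χ π k γ
  rw [twistedR, twistedR, mul_smul_comm, smul_mul_assoc, mul_assoc (torus₂ χ π 0 0 0 (π k)),
    ← mul_assoc _ (quasiRflip χ π γ), hrel]
  -- Move all torus elements to the right and compare the three terms separately.
  simp only [mul_add, mul_sub, add_mul, sub_mul, smul_add, smul_sub, mul_assoc, smul_mul_assoc,
    mul_smul_comm, torus₂_mul_bihom χ π _ _ _ _ h1, torus₂_mul_bihom χ π _ _ _ _ h2,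
    torus₂_mul_bihom_mul χ π _ _ _ _ h3, torus₂_mul_bihom_mul χ π _ _ _ _ h4,
    torus₂_mul_bihom_mul χ π _ _ _ _ h1, torus₂_mul_bihom_mul χ π _ _ _ _ h2,
    torus₂_mul, smul_smul]
  rw [twistScalar_sub χ hω γ (π k)]
  have scal : ∀ {s t : K} {x y : GQG χ π ⊗[K] GQG χ π}, s = t → x = y → s • x = t • y := by
    rintro s t x y rfl rfl; rfl
  congr 1
  · refine scal ?_ (by congr 3 <;> abel)
    simp only [χ.neg_left, χ.neg_right, χ.zero_left, χ.zero_right, neg_neg, neg_zero]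
    push_cast
    field_simp
  · congr 1
    · refine scal ?_ (by congr 3 <;> abel)
      simp only [χ.map_add_left, χ.map_add_right, χ.neg_left, χ.neg_right, χ.zero_left,
        χ.zero_right, neg_neg, neg_zero, sub_eq_add_neg]
      push_cast
      field_simp
    · refine scal ?_ (by congr 3 <;> abel)
      simp only [χ.map_add_left, χ.map_add_right, χ.neg_left, χ.neg_right, χ.zero_left,
        χ.zero_right, neg_add, neg_neg, neg_zero, sub_eq_add_neg]
      push_cast
      field_simp

end Twist

/-! ### Graded vector spaces and partial traces -/

section Graded

variable {A K M U : Type*} [AddCommGroup A] [Field K] [AddCommGroup M] [Module K M]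
  [Ring U] [Algebra K U]

/-- The family `W` of subspaces is a grading of the vector space `M`. -/
structure IsGrading (W : A → Submodule K M) : Prop where
  indep : iSupIndep W
  top : ⨆ ν, W ν = ⊤

/-- The endomorphism `φ` maps `W_ν` into `W_{ν+d}`, for all `ν`. -/
def Shifts (W : A → Submodule K M) (d : A) (φ : Module.End K M) : Prop :=
  ∀ ν, ∀ x ∈ W ν, φ x ∈ W (ν + d)

variable {W : A → Submodule K M}

namespace IsGrading
theorem isCompl (hW : IsGrading W) (ν : A) : IsCompl (W ν) (⨆ j, ⨆ (_ : j ≠ ν), W j) :=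
  ⟨hW.indep ν, codisjoint_iff.mpr (by
    rw [eq_top_iff, ← hW.top]
    refine iSup_le fun j => ?_
    by_cases h : j = ν
    · exact h ▸ le_sup_left
    · exact le_sup_of_le_right (le_iSup₂_of_le j h le_rfl))⟩

theorem hom_ext (hW : IsGrading W) {N : Type*} [AddCommGroup N] [Module K N] {f g : M →ₗ[K] N}
    (h : ∀ ν, ∀ x ∈ W ν, f x = g x) : f = g := by
  refine LinearMap.ext fun x => ?_
  have : (⊤ : Submodule K M) ≤ LinearMap.eqLocus f g := by
    rw [← hW.top]
    exact iSup_le fun ν x hx => h ν x hx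
  exact this (Submodule.mem_top (x := x))

end IsGrading

/-- The projection `P_ν` onto `W_ν` along the other parts of the grading. -/
def wtProj (hW : IsGrading W) (ν : A) : Module.End K M := (W ν).projection _ (hW.isCompl ν)

variable (hW : IsGrading W)

theorem wtProj_same {ν : A} {x : M} (hx : x ∈ W ν) : wtProj hW ν x = x :=
  Submodule.projection_apply_of_mem_left _ hx

theorem wtProj_mem (ν : A) (x : M) : wtProj hW ν x ∈ W ν := Submodule.projection_apply_mem _ x

theorem wtProj_ne {ν ν' : A} (h : ν' ≠ ν) {x : M} (hx : x ∈ W ν') : wtProj hW ν x = 0 := by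
  rw [wtProj, Submodule.projection_apply_eq_zero_iff]
  exact Submodule.mem_iSup_of_mem ν' (Submodule.mem_iSup_of_mem h hx)

theorem Shifts.mul_wtProj {d : A} {φ : Module.End K M} (hφ : Shifts W d φ) (ν : A) :
    φ * wtProj hW ν = wtProj hW (ν + d) * φ := by
  refine hW.hom_ext fun ν' x hx => ?_
  rw [Module.End.mul_apply, Module.End.mul_apply]
  by_cases h : ν' = ν
  · subst h
    rw [wtProj_same hW hx, wtProj_same hW (hφ _ x hx)]
  · rw [wtProj_ne hW h hx, wtProj_ne hW (fun h' => h (add_right_cancel h')) (hφ _ x hx), map_zero]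

theorem Shifts.mul {d e : A} {φ ψ : Module.End K M} (hφ : Shifts W d φ) (hψ : Shifts W e ψ) :
    Shifts W (d + e) (φ * ψ) := fun ν x hx => by
  rw [Module.End.mul_apply, add_comm d, ← add_assoc]
  exact hφ _ _ (hψ _ _ hx)

theorem shifts_one : Shifts W 0 (1 : Module.End K M) := fun ν x hx => by simpa using hx

theorem shifts_wtProj (ν : A) : Shifts W 0 (wtProj hW ν) := fun ν' x hx => by
  rw [add_zero]
  by_cases h : ν' = ν
  · subst h; exact wtProj_mem hW _ x
  · rw [wtProj_ne hW h hx]; exact zero_mem _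

variable [FiniteDimensional K M]

theorem IsGrading.finite (hW : IsGrading W) : {ν | W ν ≠ ⊥}.Finite :=
  WellFoundedGT.finite_ne_bot_of_iSupIndep hW.indep

theorem wtProj_eq_zero {ν : A} (h : W ν = ⊥) : wtProj hW ν = 0 :=
  LinearMap.ext fun x => by simpa [h] using wtProj_mem hW ν x

theorem trace_eq_zero_of_shifts (hW : IsGrading W) {d : A} (hd : d ≠ 0) {φ : Module.End K M} (hφ : Shifts W d φ) :
    LinearMap.trace K M φ = 0 := by
  classical
  exact LinearMap.trace_eq_zero_of_mapsTo_ne (N := W)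
    ((DirectSum.isInternal_submodule_iff_iSupIndep_and_iSup_eq_top _).mpr ⟨hW.indep, hW.top⟩)
    (· + d) (fun i => by simpa using hd) hφ

theorem trace_wtProj (ν : A) : LinearMap.trace K M (wtProj hW ν) = Module.finrank K (W ν) :=
  LinearMap.IsProj.trace ⟨wtProj_mem hW ν, fun _ hx => wtProj_same hW hx⟩

/-- The element `∑ g(ν) ⊗ P_ν` of `U ⊗ End M`. -/
def diag (g : A → U) : U ⊗[K] Module.End K M :=
  ∑ ν ∈ hW.finite.toFinset, g ν ⊗ₜ wtProj hW ν

theorem sum_wtProj : ∑ ν ∈ hW.finite.toFinset, wtProj hW ν = 1 := by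
  refine hW.hom_ext fun ν x hx => ?_
  rw [LinearMap.sum_apply, Finset.sum_eq_single ν (fun b _ hb => wtProj_ne hW hb.symm hx)
    (fun h => ?_), wtProj_same hW hx, Module.End.one_apply]
  have : W ν = ⊥ := by simpa using h
  rw [wtProj_eq_zero hW this, LinearMap.zero_apply]

theorem wtProj_mul_wtProj (ν ν' : A) [Decidable (ν' = ν)] :
    wtProj hW ν * wtProj hW ν' = if ν' = ν then wtProj hW ν else 0 := by
  refine LinearMap.ext fun x => ?_
  rw [Module.End.mul_apply]
  split_ifs with h
  · subst h; exact wtProj_same hW (wtProj_mem hW _ x)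
  · exact wtProj_ne hW h (wtProj_mem hW _ x)

theorem diag_mul_proj (g : A → U) (ν : A) :
    diag hW g * (1 ⊗ₜ wtProj hW ν) = g ν ⊗ₜ wtProj hW ν := by
  classical
  rw [diag, Finset.sum_mul, Finset.sum_eq_single ν]
  · simp [wtProj_mul_wtProj]
  · intro b _ hb
    simp [wtProj_mul_wtProj, hb.symm]
  · intro h
    have : W ν = ⊥ := by simpa using h
    simp [wtProj_eq_zero hW this]

/-- Elements of `U ⊗ End M` are determined by their restrictions to the `W_ν`. -/
theorem tensor_ext {X Y : U ⊗[K] Module.End K M}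
    (h : ∀ ν, X * (1 ⊗ₜ wtProj hW ν) = Y * (1 ⊗ₜ wtProj hW ν)) : X = Y := by
  have h1 : ∑ ν ∈ hW.finite.toFinset, (1 : U) ⊗ₜ[K] wtProj hW ν = 1 := by
    rw [← TensorProduct.tmul_sum, sum_wtProj, Algebra.TensorProduct.one_def]
  rw [← mul_one X, ← mul_one Y, ← h1, Finset.mul_sum, Finset.mul_sum]
  exact Finset.sum_congr rfl fun ν _ => h ν

theorem diag_mul_diag (g h : A → U) : diag hW g * diag hW h = diag hW (fun ν => g ν * h ν) :=
  tensor_ext hW fun ν => by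
    rw [mul_assoc, diag_mul_proj, diag_mul_proj,
      show h ν ⊗ₜ[K] wtProj hW ν = (h ν ⊗ₜ 1) * ((1 : U) ⊗ₜ wtProj hW ν) by simp]
    classical
    rw [diag, Finset.sum_mul, Finset.sum_eq_single ν]
    · simp [wtProj_mul_wtProj]
    · intro b _ hb
      simp [wtProj_mul_wtProj, hb.symm]
    · intro h
      have : W ν = ⊥ := by simpa using h
      simp [wtProj_eq_zero hW this]

theorem diag_mul_tmul (g : A → U) {d : A} {φ : Module.End K M} (hφ : Shifts W d φ) (u : U) :
    diag hW g * (u ⊗ₜ φ) = (1 ⊗ₜ φ) * diag hW (fun ν => g (ν + d) * u) := by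
  refine tensor_ext hW fun ν => ?_
  rw [mul_assoc, mul_assoc, diag_mul_proj, Algebra.TensorProduct.tmul_mul_tmul,
    Algebra.TensorProduct.tmul_mul_tmul, hφ.mul_wtProj hW, one_mul, mul_one,
    show u ⊗ₜ[K] (wtProj hW (ν + d) * φ) = (1 ⊗ₜ wtProj hW (ν + d)) * (u ⊗ₜ φ) by simp,
    ← mul_assoc, diag_mul_proj]
  simp

theorem tmul_one_mul_diag (g : A → U) (u : U) :
    (u ⊗ₜ 1) * diag hW g = diag hW (fun ν => u * g ν) := by
  simp [diag, Finset.mul_sum]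

theorem smul_diag (r : K) (g : A → U) : r • diag hW g = diag hW (fun ν => r • g ν) := by
  simp [diag, Finset.smul_sum, TensorProduct.smul_tmul']

/-- An endomorphism that acts by scalars on the parts of the grading. -/
theorem one_tmul_eq_diag {φ : Module.End K M} {s : A → K} (h : ∀ ν, ∀ x ∈ W ν, φ x = s ν • x) :
    (1 : U) ⊗ₜ[K] φ = diag hW (fun ν => s ν • 1) := by
  refine tensor_ext hW fun ν => ?_
  rw [diag_mul_proj, Algebra.TensorProduct.tmul_mul_tmul, one_mul, TensorProduct.smul_tmul]
  congr 1
  exact LinearMap.ext fun x => h ν _ (wtProj_mem hW ν x)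

end Graded

section PartialTrace

variable {K M U : Type*} [Field K] [AddCommGroup M] [Module K M] [Ring U] [Algebra K U]

/-- The partial trace `id ⊗ tr : U ⊗ End M → U`. -/
def ptrace (K M U : Type*) [Field K] [AddCommGroup M] [Module K M] [Ring U] [Algebra K U] :
    U ⊗[K] Module.End K M →ₗ[K] U :=
  (TensorProduct.rid K U).toLinearMap ∘ₗ (LinearMap.trace K M).lTensor U

@[simp] theorem ptrace_tmul (u : U) (φ : Module.End K M) :
    ptrace K M U (u ⊗ₜ φ) = LinearMap.trace K M φ • u := by
  simp [ptrace]

theorem ptrace_tmul_mul (u : U) (φ : Module.End K M) (X : U ⊗[K] Module.End K M) :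
    ptrace K M U ((u ⊗ₜ φ) * X) = u * ptrace K M U (X * (1 ⊗ₜ φ)) := by
  induction X using TensorProduct.induction_on with
  | zero => simp
  | tmul x y => simp [LinearMap.trace_mul_comm K φ y]
  | add x y hx hy => simp only [mul_add, add_mul, map_add, hx, hy]

theorem ptrace_mul_tmul (u : U) (φ : Module.End K M) (X : U ⊗[K] Module.End K M) :
    ptrace K M U (X * (u ⊗ₜ φ)) = ptrace K M U (X * (1 ⊗ₜ φ)) * u := by
  induction X using TensorProduct.induction_on with
  | zero => simp
  | tmul x y => simp
  | add x y hx hy => simp only [add_mul, map_add, hx, hy]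

end PartialTrace

/-! ### The weight grading of a highest-weight module -/

section HighestWeight

variable {A : Type u} {K : Type v} [AddCommGroup A] [Field K] {l : ℕ}
variable (χ : Bicharacter A K) (π : Module.Basis (Fin l) ℤ A)

/-- `U⁻_{-ν}` is spanned by the `F_w` with `w` a word of weight `ν`. -/
theorem UminusPart_le (ν : A) :
    UminusPart χ π (-ν) ≤ (wordsDeg K (π : Fin l → A) ν).map (wordsF χ π) := by
  rintro x ⟨hx, hx'⟩
  let H : A → Submodule K (GQG χ π) := fun β => (wordsDeg K (π : Fin l → A) β).map (wordsF χ π)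
  have hH : ∀ β, H β ≤ homPart χ π (-β) := fun β => by
    rintro _ ⟨y, hy, rfl⟩; exact wordsF_deg χ π hy
  have h1 : x ∈ H ν ⊔ ⨆ j, ⨆ (_ : j ≠ ν), H j := by
    refine Submodule.span_le.mpr ?_ (Uminus_span χ π hx)
    rintro _ ⟨w, rfl⟩
    have hw : Fw χ π w ∈ H (wordWt π w) := ⟨_, wd_mem _ w, wordsF_wd χ π w⟩
    by_cases h : wordWt π w = ν
    · exact Submodule.mem_sup_left (h ▸ hw)
    · exact Submodule.mem_sup_right
        (Submodule.mem_iSup_of_mem _ (Submodule.mem_iSup_of_mem h hw))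
  obtain ⟨y, hy, z, hz, rfl⟩ := Submodule.mem_sup.mp h1
  have hz1 : z ∈ homPart χ π (-ν) := by
    have := sub_mem hx' (hH ν hy)
    rwa [add_sub_cancel_left] at this
  have hz2 : z ∈ ⨆ j, ⨆ (_ : j ≠ -ν), homPart χ π j := by
    refine (iSup₂_le fun j hj => ?_ : (⨆ j, ⨆ (_ : j ≠ ν), H j) ≤ _) hz
    exact le_iSup₂_of_le (-j) (fun h => hj (neg_injective h)) (hH j)
  have hz0 := Submodule.disjoint_def.mp (iSupIndep_homPart χ π (-ν)) z hz1 hz2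
  rw [hz0, add_zero]
  exact hy

variable {M : Type*} [AddCommGroup M] [Module K M] [Module (GQG χ π) M]
  [IsScalarTower K (GQG χ π) M]

/-- The action of `U` on a module, as a homomorphism of algebras. -/
def act (M : Type*) [AddCommGroup M] [Module K M] [Module (GQG χ π) M]
    [IsScalarTower K (GQG χ π) M] : GQG χ π →ₐ[K] Module.End K M := Algebra.lsmul K K M

@[simp] theorem act_apply (x : GQG χ π) (m : M) : act χ π M x m = x • m := rfl

variable (v : M)

theorem wordsF_smul_mem {β : A} {y : Words K l} (hy : y ∈ wordsDeg K (π : Fin l → A) β) :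
    wordsF χ π y • v ∈ weightOrbit χ π v β :=
  ⟨_, ⟨wordsF_mem χ π y, wordsF_deg χ π hy⟩, rfl⟩

theorem exists_of_mem_weightOrbit {ν : A} {x : M} (hx : x ∈ weightOrbit χ π v ν) :
    ∃ y ∈ wordsDeg K (π : Fin l → A) ν, wordsF χ π y • v = x := by
  obtain ⟨Y, hY, rfl⟩ := hx
  obtain ⟨y, hy, rfl⟩ := UminusPart_le χ π ν hY
  exact ⟨y, hy, rfl⟩

theorem weightOrbit_eq_bot {ν : A} (hν : ν ∉ posCone (π : Fin l → A)) :
    weightOrbit χ π v ν = ⊥ := by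
  refine eq_bot_iff.mpr fun x hx => ?_
  obtain ⟨y, hy, rfl⟩ := exists_of_mem_weightOrbit χ π v hx
  refine wordsDeg_ind (π : Fin l → A) ((LinearMap.toSpanSingleton (GQG χ π) M v).restrictScalars K
    ∘ₗ wordsF χ π) ⊥ (fun w hw => absurd ?_ hν) hy
  rw [← hw]
  refine AddSubmonoid.list_sum_mem _ fun x hx => ?_
  obtain ⟨i, _, rfl⟩ := List.mem_map.mp hx
  exact AddSubmonoid.subset_closure ⟨i, rfl⟩

variable {v} {Λ : A → A → K}

theorem isGrading_weightOrbit (hM : IsSimpleHighestWeight χ π Λ v) :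
    IsGrading (weightOrbit χ π v) where
  indep := by
    have hmem : ∀ ν, weightOrbit χ π v ν ≠ ⊥ → ν ∈ posCone (π : Fin l → A) := fun ν h => by
      by_contra h'
      exact h (weightOrbit_eq_bot χ π v h')
    refine iSupIndep_ne_bot.mp ?_
    exact hM.indep.comp (f := fun i : {ν // weightOrbit χ π v ν ≠ ⊥} =>
      (⟨i.1, hmem i.1 i.2⟩ : posCone (π : Fin l → A)))
      fun i j h => Subtype.ext (Subtype.mk.inj h)
  top := by
    rw [eq_top_iff, ← hM.span_eq_top]
    exact iSup_le fun ν => le_iSup (weightOrbit χ π v) (ν : A)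

/-- The torus acts on `U⁻_{-ν} v` by a scalar. -/
theorem KL_smul_weightOrbit (hM : IsSimpleHighestWeight χ π Λ v) (a b ν : A) {x : M}
    (hx : x ∈ weightOrbit χ π v ν) :
    KL χ π a b • x = (Λ a b * ((χ a ν)⁻¹ * χ ν b : Kˣ)) • x := by
  obtain ⟨y, hy, rfl⟩ := exists_of_mem_weightOrbit χ π v hx
  rw [← mul_smul, KL_mul_homPart χ π a b (wordsF_deg χ π hy), smul_assoc, mul_smul, hM.weight,
    neg_neg, χ.neg_right, smul_comm (wordsF χ π y), smul_smul, mul_comm]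

theorem shifts_gen (hM : IsSimpleHighestWeight χ π Λ v) (g : Gen A l) :
    Shifts (weightOrbit χ π v) (-genDeg π g) (act χ π M (gen χ π g)) := by
  intro ν x hx
  have hK : ∀ a ν, ∀ x ∈ weightOrbit χ π v ν, gen χ π (.K a) • x ∈ weightOrbit χ π v ν :=
    fun a ν x hx => by
      rw [K_eq_KL, KL_smul_weightOrbit χ π hM _ _ ν hx]
      exact Submodule.smul_mem _ _ hx
  rw [act_apply]
  cases g with
  | K a => simpa [genDeg] using hK a ν x hx
  | L a =>
    rw [L_eq_KL, KL_smul_weightOrbit χ π hM _ _ ν hx]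
    simpa [genDeg] using Submodule.smul_mem _ _ hx
  | F i =>
    obtain ⟨y, hy, rfl⟩ := exists_of_mem_weightOrbit χ π v hx
    rw [← mul_smul, ← wordsF_consMap, genDeg, neg_neg, add_comm]
    exact wordsF_smul_mem χ π v (consMap_deg (π : Fin l → A) i hy)
  | E i =>
    obtain ⟨y, hy, rfl⟩ := exists_of_mem_weightOrbit χ π v hx
    rw [← mul_smul, gen_E_mul_wordsF, add_smul, sub_smul, mul_smul, hM.gen_E, smul_zero, zero_add,
      mul_smul, mul_smul, L_eq_KL, hM.weight, smul_comm, genDeg, ← sub_eq_add_neg]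
    exact sub_mem (Submodule.smul_mem _ _ (wordsF_smul_mem χ π v (skewDerR_deg χ _ i hy)))
      (hK _ _ _ (wordsF_smul_mem χ π v (skewDerL_deg χ _ i hy)))

/-- An element of `U_d` maps `U⁻_{-ν} v` into `U⁻_{-(ν-d)} v`. -/
theorem shifts_homPart (hM : IsSimpleHighestWeight χ π Λ v) {d : A} {x : GQG χ π}
    (hx : x ∈ homPart χ π d) : Shifts (weightOrbit χ π v) (-d) (act χ π M x) := by
  induction hx using Submodule.span_induction with
  | mem x hx =>
    obtain ⟨w, rfl, rfl⟩ := hx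
    induction w with
    | nil => simpa using shifts_one
    | cons g w ih =>
      simp only [List.map_cons, List.prod_cons, List.sum_cons, map_mul, neg_add]
      exact (shifts_gen χ π hM g).mul ih
  | zero => intro ν x _; simp
  | add x y _ _ hx hy =>
    intro ν m hm
    rw [map_add, LinearMap.add_apply]
    exact add_mem (hx ν m hm) (hy ν m hm)
  | smul r x _ hx =>
    intro ν m hm
    rw [map_smul, LinearMap.smul_apply]
    exact Submodule.smul_mem _ _ (hx ν m hm)

end HighestWeight

/-! ### Balanced elements and quantum traces -/

section Summation

variable {A R : Type*} [AddCommGroup A] [Ring R]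

/-- Summation of intertwining relations that link the neighbouring weights `β` and `β - k`. -/
theorem finsum_intertwine {X : A → R} (hX : X.HasFiniteSupport) (k : A) {a b c d : R}
    (h : ∀ β, a * X β = X β * b + (X (β - k) * c - d * X (β - k))) :
    (a + d) * ∑ᶠ β, X β = (∑ᶠ β, X β) * (b + c) := by
  have shift : ∀ f : A → R, ∑ᶠ β, f (β - k) = ∑ᶠ β, f β := fun f =>
    finsum_comp_equiv (Equiv.subRight k)
  have hX' : (fun β => X (β - k)).HasFiniteSupport :=
    hX.preimage (Equiv.subRight k).injective.injOn
  have fin1 : ∀ (Y : A → R) (r : R), Y.HasFiniteSupport →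
      (fun β => r * Y β).HasFiniteSupport := fun Y r hY =>
    hY.subset fun β hβ h0 => hβ (by simp [h0])
  have fin2 : ∀ (Y : A → R) (r : R), Y.HasFiniteSupport →
      (fun β => Y β * r).HasFiniteSupport := fun Y r hY =>
    hY.subset fun β hβ h0 => hβ (by simp [h0])
  have h1 : ∑ᶠ β, (a * X β + d * X (β - k)) = ∑ᶠ β, (X β * b + X (β - k) * c) :=
    finsum_congr fun β => by rw [h]; abel
  rw [finsum_add_distrib (fin1 _ _ hX) (fin1 _ _ hX'),
    finsum_add_distrib (fin2 _ _ hX) (fin2 _ _ hX'), shift (fun β => d * X β),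
    shift (fun β => X β * c), ← mul_finsum' _ _ hX, ← mul_finsum' _ _ hX, ← finsum_mul' _ _ hX,
    ← finsum_mul' _ _ hX, ← add_mul, ← mul_add] at h1
  exact h1

end Summation

section PartialTraceComm

variable {K M U : Type*} [Field K] [AddCommGroup M] [Module K M] [Ring U] [Algebra K U]

/-- The partial trace of an intertwiner `T` for the coproduct `E ⊗ 1 + κ₀ ⊗ e`, with the operator
`g` turning the trace into a quantum trace. -/
theorem ptrace_skew_comm_of_left {T : U ⊗[K] Module.End K M} {E κ₀ : U} {c : K}
    {e κ κ' g : Module.End K M}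
    (hT : (E ⊗ₜ 1 + κ₀ ⊗ₜ e) * T = T * (κ₀ ⊗ₜ e + c • (E ⊗ₜ 1)))
    (hκ : (κ₀ ⊗ₜ κ) * T = T * (κ₀ ⊗ₜ κ)) (hκκ : κ * κ' = 1) (hg : g * e = κ' * (e * g) * κ) :
    E * ptrace K M U (T * (1 ⊗ₜ g)) = c • (ptrace K M U (T * (1 ⊗ₜ g)) * E) := by
  have h := congrArg (fun X => ptrace K M U (X * (1 ⊗ₜ g))) hT
  simp only [add_mul, mul_add, map_add, mul_assoc, mul_smul_comm, smul_mul_assoc, map_smul,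
    Algebra.TensorProduct.tmul_mul_tmul, mul_one, one_mul, ptrace_tmul_mul] at h
  -- `κ₀ ⊗ κ` is taken around the trace, which moves `κ₀` from the right of `T` to its left.
  have h2 : ptrace K M U (T * κ₀ ⊗ₜ[K] (e * g)) = κ₀ * ptrace K M U (T * 1 ⊗ₜ[K] (g * e)) := by
    rw [show κ₀ ⊗ₜ[K] (e * g) = (κ₀ ⊗ₜ κ) * ((1 : U) ⊗ₜ (κ' * (e * g))) by
        rw [Algebra.TensorProduct.tmul_mul_tmul, mul_one, ← mul_assoc, hκκ, one_mul],
      ← mul_assoc, ← hκ, mul_assoc, ptrace_tmul_mul, mul_assoc,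
      Algebra.TensorProduct.tmul_mul_tmul, mul_one, ← hg]
  rw [h2, add_comm, add_right_inj] at h
  rw [h, ptrace_mul_tmul E]

/-- The partial trace of an intertwiner `T` for the coproduct `1 ⊗ f + F ⊗ κ`, with the operator `g`
turning the trace into a quantum trace. -/
theorem ptrace_skew_comm_of_right {T : U ⊗[K] Module.End K M} {F : U} {c : K}
    {f κ κ' g : Module.End K M}
    (hT : (1 ⊗ₜ f + F ⊗ₜ κ) * T = T * (1 ⊗ₜ f + c • (F ⊗ₜ κ)))
    (hκκ : κ * κ' = 1) (hg : κ' * g * κ = g) (hf : f * (κ' * g) = κ' * g * f) :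
    F * ptrace K M U (T * (1 ⊗ₜ g)) = c • (ptrace K M U (T * (1 ⊗ₜ g)) * F) := by
  -- The factor `κ'` cancels the `κ` of the coproduct.
  have h := congrArg (fun X => ptrace K M U (X * (1 ⊗ₜ (κ' * g)))) hT
  simp only [add_mul, mul_add, map_add, mul_assoc, mul_smul_comm, smul_mul_assoc, map_smul,
    Algebra.TensorProduct.tmul_mul_tmul, mul_one, one_mul, ptrace_tmul_mul] at h
  rw [hf, mul_assoc κ' g f, ← mul_assoc κ, hκκ, one_mul, add_right_inj, ← mul_assoc κ', hg] at h
  rw [h, ptrace_mul_tmul F]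

end PartialTraceComm

section Assembly

variable {A : Type u} {K : Type v} [AddCommGroup A] [Field K] {l : ℕ}
variable (χ : Bicharacter A K) (π : Module.Basis (Fin l) ℤ A)
variable {M : Type*} [AddCommGroup M] [Module K M] [Module (GQG χ π) M]
  [IsScalarTower K (GQG χ π) M]

/-- The homomorphism `U ⊗ U → U ⊗ End M`. -/
def actRight (M : Type*) [AddCommGroup M] [Module K M] [Module (GQG χ π) M]
    [IsScalarTower K (GQG χ π) M] :
    GQG χ π ⊗[K] GQG χ π →ₐ[K] GQG χ π ⊗[K] Module.End K M :=
  Algebra.TensorProduct.map (AlgHom.id K _) (act χ π M)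

@[simp] theorem actRight_tmul (x y : GQG χ π) :
    actRight χ π M (x ⊗ₜ y) = x ⊗ₜ act χ π M y := by
  simp [actRight]

/-- The span of the `x ⊗ φ` for which the degree of `x` and the shift of `φ` agree. -/
def balanced (W : A → Submodule K M) : Submodule K (GQG χ π ⊗[K] Module.End K M) :=
  Submodule.span K {X | ∃ d, ∃ x ∈ homPart χ π d, ∃ φ, Shifts W d φ ∧ x ⊗ₜ φ = X}

theorem balanced_mul {W : A → Submodule K M} {X Y : GQG χ π ⊗[K] Module.End K M}
    (hX : X ∈ balanced χ π W) (hY : Y ∈ balanced χ π W) : X * Y ∈ balanced χ π W := by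
  refine Submodule.span_induction₂ (p := fun x y _ _ => x * y ∈ balanced χ π W)
    ?_ ?_ ?_ ?_ ?_ ?_ ?_ hX hY
  · rintro _ _ ⟨d, x, hx, φ, hφ, rfl⟩ ⟨e, y, hy, ψ, hψ, rfl⟩
    exact Submodule.subset_span ⟨d + e, _, homPart_mul χ π hx hy, _, hφ.mul hψ, by simp⟩
  · intro y _; simp
  · intro y _; simp
  · intro x y z _ _ _ h1 h2; rw [add_mul]; exact add_mem h1 h2
  · intro x y z _ _ _ h1 h2; rw [mul_add]; exact add_mem h1 h2
  · intro r x y _ _ h; rw [smul_mul_assoc]; exact Submodule.smul_mem _ _ h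
  · intro r x y _ _ h; rw [mul_smul_comm]; exact Submodule.smul_mem _ _ h

/-- The partial trace of a balanced element has degree `0`, because an operator that shifts the
grading by a nonzero weight has trace `0`. -/
theorem ptrace_balanced [FiniteDimensional K M] {W : A → Submodule K M} (hW : IsGrading W)
    {X : GQG χ π ⊗[K] Module.End K M} (hX : X ∈ balanced χ π W) :
    ptrace K M (GQG χ π) X ∈ homPart χ π 0 := by
  have : balanced χ π W ≤ (homPart χ π 0).comap (ptrace K M (GQG χ π)) := by
    refine Submodule.span_le.mpr ?_
    rintro _ ⟨d, x, hx, φ, hφ, rfl⟩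
    rw [SetLike.mem_coe, Submodule.mem_comap, ptrace_tmul]
    by_cases hd : d = 0
    · subst hd; exact Submodule.smul_mem _ _ hx
    · rw [trace_eq_zero_of_shifts hW hd hφ, zero_smul]; exact zero_mem _
  exact this hX

variable {v : M} {Λ : A → A → K}

/-- Balanced elements commute with the grouplike elements `K_a ⊗ K_a`. -/
theorem K_comm_balanced (hM : IsSimpleHighestWeight χ π Λ v) (a : A)
    {X : GQG χ π ⊗[K] Module.End K M} (hX : X ∈ balanced χ π (weightOrbit χ π v)) :
    (gen χ π (.K a) ⊗ₜ act χ π M (gen χ π (.K a))) * X =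
      X * (gen χ π (.K a) ⊗ₜ act χ π M (gen χ π (.K a))) := by
  induction hX using Submodule.span_induction with
  | mem X hX =>
    obtain ⟨d, x, hx, φ, hφ, rfl⟩ := hX
    have h : act χ π M (gen χ π (.K a)) * φ = ((χ a d)⁻¹ : Kˣ) • (φ * act χ π M (gen χ π (.K a))) := by
      refine (isGrading_weightOrbit χ π hM).hom_ext fun ν m hm => ?_
      simp only [LinearMap.smul_apply, Module.End.mul_apply, act_apply, K_eq_KL]
      rw [KL_smul_weightOrbit χ π hM _ _ _ (hφ ν m hm), KL_smul_weightOrbit χ π hM _ _ _ hm,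
        map_smul, Units.smul_def, smul_smul, χ.map_add_right, χ.zero_right, χ.zero_right]
      congr 1
      push_cast
      field_simp
    rw [Algebra.TensorProduct.tmul_mul_tmul, Algebra.TensorProduct.tmul_mul_tmul,
      K_mul_homPart χ π a hx, h, Units.smul_def, TensorProduct.smul_tmul_smul, ← Units.val_mul,
      mul_inv_cancel, Units.val_one, one_smul]
  | zero => simp
  | add X Y _ _ hX hY => rw [mul_add, hX, hY, add_mul]
  | smul r X _ hX => rw [mul_smul_comm, hX, smul_mul_assoc]

theorem actRight_mem_balanced (hM : IsSimpleHighestWeight χ π Λ v) {d : A}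
    {z : GQG χ π ⊗[K] GQG χ π} (hz : z ∈ bihom χ π d (-d)) :
    actRight χ π M z ∈ balanced χ π (weightOrbit χ π v) := by
  have : bihom χ π d (-d) ≤
      (balanced χ π (weightOrbit χ π v)).comap (actRight χ π M).toLinearMap := by
    refine Submodule.span_le.mpr ?_
    rintro _ ⟨x, hx, y, hy, rfl⟩
    have h := shifts_homPart χ π hM hy
    rw [neg_neg] at h
    exact Submodule.subset_span ⟨d, x, hx, _, h, by simp⟩
  exact this hz

/-- Only finitely many degrees act nontrivially on a finite-dimensional module. -/
theorem finite_actRight [FiniteDimensional K M] (hM : IsSimpleHighestWeight χ π Λ v) :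
    ∃ N : Set A, N.Finite ∧ ∀ d e, e ∉ N → ∀ z ∈ bihom χ π d e, actRight χ π M z = 0 := by
  have hW := isGrading_weightOrbit χ π hM
  refine ⟨Set.image2 (fun a b => a - b) _ _, hW.finite.image2 _ hW.finite, fun d e he z hz => ?_⟩
  have : bihom χ π d e ≤ LinearMap.ker (actRight χ π M).toLinearMap := by
    refine Submodule.span_le.mpr ?_
    rintro _ ⟨x, hx, y, hy, rfl⟩
    have h : act χ π M y = 0 := by
      refine hW.hom_ext fun ν m hm => ?_
      by_contra hne
      have hy' := shifts_homPart χ π hM hy ν m hm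
      refine he ⟨ν, fun h => ?_, ν + -e, fun h => ?_, by simp⟩
      · rw [h, Submodule.mem_bot] at hm
        exact hne (by rw [hm, map_zero, map_zero])
      · rw [h, Submodule.mem_bot] at hy'
        exact hne hy'
    simp [h]
  exact this hz

theorem bihom_mul {d e d' e' : A} {z z' : GQG χ π ⊗[K] GQG χ π} (hz : z ∈ bihom χ π d e)
    (hz' : z' ∈ bihom χ π d' e') : z * z' ∈ bihom χ π (d + d') (e + e') := by
  refine Submodule.span_induction₂ (p := fun x y _ _ => x * y ∈ bihom χ π (d + d') (e + e'))
    ?_ ?_ ?_ ?_ ?_ ?_ ?_ hz hz'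
  · rintro _ _ ⟨x, hx, y, hy, rfl⟩ ⟨x', hx', y', hy', rfl⟩
    exact Submodule.subset_span ⟨_, homPart_mul χ π hx hx', _, homPart_mul χ π hy hy', by simp⟩
  · intro y _; simp
  · intro y _; simp
  · intro x y z _ _ _ h1 h2; rw [add_mul]; exact add_mem h1 h2
  · intro x y z _ _ _ h1 h2; rw [mul_add]; exact add_mem h1 h2
  · intro r x y _ _ h; rw [smul_mul_assoc]; exact Submodule.smul_mem _ _ h
  · intro r x y _ _ h; rw [mul_smul_comm]; exact Submodule.smul_mem _ _ h

theorem KL_mem_homPart (a b : A) : KL χ π a b ∈ homPart χ π 0 := by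
  have := homPart_mul χ π (gen_mem_homPart χ π (.K a)) (gen_mem_homPart χ π (.L b))
  rw [KL]
  simpa [genDeg] using this

theorem twistedR_mem (ω : A → Kˣ) (γ : A) : twistedR χ π ω γ ∈ bihom χ π γ (-γ) := by
  have h : torus₂ χ π (-γ) 0 0 (-γ) ∈ bihom χ π 0 0 :=
    Submodule.subset_span ⟨_, KL_mem_homPart χ π _ _, _, KL_mem_homPart χ π _ _, rfl⟩
  have := bihom_mul χ π (quasiRflip_mem χ π γ) h
  rw [add_zero, add_zero] at this
  exact Submodule.smul_mem _ _ this

theorem quasiR_mem_bihom (β : A) : quasiR χ π β ∈ bihom χ π (-β) β := by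
  refine Submodule.span_le.mpr ?_ (quasiR_mem χ π β)
  rintro _ ⟨w, w', hw, hw', rfl⟩
  exact Submodule.subset_span ⟨_, hw ▸ Fw_deg χ π w, _, hw' ▸ Ew_deg χ π w', rfl⟩

theorem finite_quasiR [FiniteDimensional K M] (hM : IsSimpleHighestWeight χ π Λ v) :
    (fun β => actRight χ π M (quasiR χ π β)).HasFiniteSupport := by
  obtain ⟨N, hN, h⟩ := finite_actRight χ π hM
  refine hN.subset fun β hβ => ?_
  by_contra h'
  exact hβ (h _ _ h' _ (quasiR_mem_bihom χ π β))

theorem finite_twistedR [FiniteDimensional K M] (hM : IsSimpleHighestWeight χ π Λ v)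
    (ω : A → Kˣ) : (fun γ => actRight χ π M (twistedR χ π ω γ)).HasFiniteSupport := by
  obtain ⟨N, hN, h⟩ := finite_actRight χ π hM
  refine (hN.preimage (f := fun γ : A => -γ) neg_injective.injOn).subset fun γ hγ => ?_
  by_contra h'
  exact hγ (h _ _ h' _ (twistedR_mem χ π ω γ))

theorem rhoHat_add (a b : A) : rhoHat χ π (a + b) = rhoHat χ π a * rhoHat χ π b := by
  simp [rhoHat, zpow_add, Finset.prod_mul_distrib]

theorem rhoHat_basis (k : Fin l) : rhoHat χ π (π k) = χ (π k) (π k) := by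
  rw [rhoHat, Finset.prod_eq_single k]
  · simp
  · intro b _ hb; simp [hb.symm]
  · simp

end Assembly

/-! ### The central element -/

theorem character_zero {A K : Type*} [AddCommGroup A] [Field K] {ω : A → Kˣ}
    (hω : ∀ a b, ω (a + b) = ω a * ω b) : ω 0 = 1 := by
  have h := hω 0 0
  rw [add_zero] at h
  exact left_eq_mul.mp h

section Central

variable {A : Type u} {K : Type v} [AddCommGroup A] [Field K] {l : ℕ}
variable (χ : Bicharacter A K) (π : Module.Basis (Fin l) ℤ A)
variable {M : Type*} [AddCommGroup M] [Module K M] [Module (GQG χ π) M]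
  [IsScalarTower K (GQG χ π) M] {v : M} {ω : A → Kˣ} {lam mu : A}

/-- The torus part `∑ K_{λ+ν} L_{μ-ν} ⊗ P_ν`. -/
def torusPart [FiniteDimensional K M] (lam mu : A) (hW : IsGrading (weightOrbit χ π v)) :
    GQG χ π ⊗[K] Module.End K M :=
  diag hW fun ν => KL χ π (lam + ν) (mu - ν)

/-- The operator that acts on `U⁻_{-ν} v` by `ρ̂(ν)`. -/
def rhoOp [FiniteDimensional K M] (hW : IsGrading (weightOrbit χ π v)) : Module.End K M :=
  ∑ ν ∈ hW.finite.toFinset, (rhoHat χ π ν : K) • wtProj hW ν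

/-- The intertwiner `Θ · D · Θ''` of `U ⊗ End M`. -/
def intertwiner [FiniteDimensional K M] (ω : A → Kˣ) (lam mu : A)
    (hW : IsGrading (weightOrbit χ π v)) : GQG χ π ⊗[K] Module.End K M :=
  (∑ᶠ β, actRight χ π M (quasiR χ π β)) * torusPart χ π lam mu hW *
    ∑ᶠ γ, actRight χ π M (twistedR χ π ω γ)

/-- The element `Z_{λ,μ}`: the quantum partial trace of the intertwiner. -/
def centralElt [FiniteDimensional K M] (ω : A → Kˣ) (lam mu : A)
    (hW : IsGrading (weightOrbit χ π v)) : GQG χ π :=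
  ptrace K M (GQG χ π) (intertwiner χ π ω lam mu hW * (1 ⊗ₜ rhoOp χ π hW))

variable [FiniteDimensional K M] (hW : IsGrading (weightOrbit χ π v))

theorem rhoOp_apply {ν : A} {x : M} (hx : x ∈ weightOrbit χ π v ν) :
    rhoOp χ π hW x = (rhoHat χ π ν : K) • x := by
  rw [rhoOp, LinearMap.sum_apply, Finset.sum_eq_single ν]
  · rw [LinearMap.smul_apply, wtProj_same hW hx]
  · intro b _ hb
    rw [LinearMap.smul_apply, wtProj_ne hW hb.symm hx, smul_zero]
  · intro h
    have : weightOrbit χ π v ν = ⊥ := by simpa using h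
    rw [wtProj_eq_zero hW this, smul_zero, LinearMap.zero_apply]

/-- The torus part turns the right-hand side of the relation of `Θ` for `E_k` into the left-hand side of
the relation of `Θ''`. -/
theorem E_torusPart (hM : IsSimpleHighestWeight χ π (weightLM χ ω lam mu) v) (k : Fin l) :
    (gen χ π (.E k) ⊗ₜ 1 + gen χ π (.L (π k)) ⊗ₜ act χ π M (gen χ π (.E k))) *
        torusPart χ π lam mu hW =
      torusPart χ π lam mu hW * (gen χ π (.K (π k)) ⊗ₜ act χ π M (gen χ π (.E k)) +
        (((ω (π k))⁻¹ : Kˣ) : K) • (gen χ π (.E k) ⊗ₜ act χ π M (KL χ π (π k) (-π k)))) := by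
  have hs : (1 : GQG χ π) ⊗ₜ[K] act χ π M (KL χ π (π k) (-π k)) = diag hW _ :=
    one_tmul_eq_diag hW fun ν x hx => KL_smul_weightOrbit χ π hM _ _ ν hx
  have h1 : torusPart χ π lam mu hW * (gen χ π (.E k) ⊗ₜ act χ π M (KL χ π (π k) (-π k))) =
      (ω (π k) : K) • ((gen χ π (.E k) ⊗ₜ 1) * torusPart χ π lam mu hW) := by
    have hsh := shifts_homPart χ π hM (KL_mem_homPart χ π (π k) (-π k))
    rw [torusPart, diag_mul_tmul hW _ hsh, hs, diag_mul_diag, tmul_one_mul_diag, smul_diag]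
    congr 1
    funext ν
    rw [neg_zero, add_zero, KL_mul_homPart χ π _ _ (gen_mem_homPart χ π (.E k)), smul_mul_assoc,
      one_mul, smul_smul, genDeg, weightLM]
    congr 1
    simp only [χ.map_add_left, χ.neg_left, χ.neg_right, sub_eq_add_neg, χ.map_add_right]
    push_cast
    field_simp
  have h2 : torusPart χ π lam mu hW * (gen χ π (.K (π k)) ⊗ₜ act χ π M (gen χ π (.E k))) =
      (gen χ π (.L (π k)) ⊗ₜ act χ π M (gen χ π (.E k))) * torusPart χ π lam mu hW := by
    rw [torusPart, diag_mul_tmul hW _ (shifts_gen χ π hM (.E k)),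
      show gen χ π (.L (π k)) ⊗ₜ[K] act χ π M (gen χ π (.E k)) =
        (1 ⊗ₜ act χ π M (gen χ π (.E k))) * (gen χ π (.L (π k)) ⊗ₜ 1) by simp, mul_assoc,
      tmul_one_mul_diag]
    congr 2
    funext ν
    rw [K_eq_KL, KL_mul_KL, L_mul_KL, genDeg]
    congr 1 <;> abel
  rw [add_mul, mul_add, mul_smul_comm, h1, h2, smul_smul, ← Units.val_mul, inv_mul_cancel,
    Units.val_one, one_smul, add_comm]

/-- The torus part turns the right-hand side of the relation of `Θ` for `F_k` into the left-hand side of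
the relation of `Θ''`. -/
theorem F_torusPart (hω : ∀ a b, ω (a + b) = ω a * ω b)
    (hM : IsSimpleHighestWeight χ π (weightLM χ ω lam mu) v) (k : Fin l) :
    (1 ⊗ₜ act χ π M (gen χ π (.F k)) + gen χ π (.F k) ⊗ₜ act χ π M (gen χ π (.K (π k)))) *
        torusPart χ π lam mu hW =
      torusPart χ π lam mu hW * (KL χ π (-π k) (π k) ⊗ₜ act χ π M (gen χ π (.F k)) +
        (ω (π k) : K) • (gen χ π (.F k) ⊗ₜ act χ π M (gen χ π (.L (π k))))) := by
  have hL : (1 : GQG χ π) ⊗ₜ[K] act χ π M (gen χ π (.L (π k))) = diag hW _ :=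
    one_tmul_eq_diag hW fun ν x hx => by
      rw [L_eq_KL]; exact KL_smul_weightOrbit χ π hM _ _ ν hx
  have hK : (1 : GQG χ π) ⊗ₜ[K] act χ π M (gen χ π (.K (π k))) = diag hW _ :=
    one_tmul_eq_diag hW fun ν x hx => by
      rw [K_eq_KL]; exact KL_smul_weightOrbit χ π hM _ _ ν hx
  have h1 : (ω (π k) : K) • (torusPart χ π lam mu hW *
      (gen χ π (.F k) ⊗ₜ act χ π M (gen χ π (.L (π k))))) =
      (gen χ π (.F k) ⊗ₜ act χ π M (gen χ π (.K (π k)))) * torusPart χ π lam mu hW := by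
    rw [show gen χ π (.F k) ⊗ₜ[K] act χ π M (gen χ π (.K (π k))) =
        (1 ⊗ₜ act χ π M (gen χ π (.K (π k)))) * (gen χ π (.F k) ⊗ₜ 1) by simp, mul_assoc,
      torusPart, tmul_one_mul_diag, diag_mul_tmul hW _ (shifts_gen χ π hM (.L (π k))), hL, hK,
      diag_mul_diag, diag_mul_diag, smul_diag]
    congr 1
    funext ν
    rw [genDeg, neg_zero, add_zero, KL_mul_homPart χ π _ _ (gen_mem_homPart χ π (.F k)),
      smul_mul_assoc, smul_mul_assoc, one_mul, one_mul, smul_smul, smul_smul, genDeg, weightLM,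
      weightLM]
    congr 1
    have h0 := character_zero hω
    simp only [χ.map_add_left, χ.neg_left, χ.neg_right, sub_eq_add_neg, χ.map_add_right, inv_inv,
      χ.zero_left, χ.zero_right, h0]
    push_cast
    field_simp
  have h2 : torusPart χ π lam mu hW * (KL χ π (-π k) (π k) ⊗ₜ act χ π M (gen χ π (.F k))) =
      (1 ⊗ₜ act χ π M (gen χ π (.F k))) * torusPart χ π lam mu hW := by
    rw [torusPart, diag_mul_tmul hW _ (shifts_gen χ π hM (.F k))]
    congr 2
    funext ν
    rw [KL_mul_KL, genDeg]
    congr 1 <;> abel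
  rw [add_mul, mul_add, mul_smul_comm, h1, h2]

theorem intertwiner_E (hω : ∀ a b, ω (a + b) = ω a * ω b)
    (hM : IsSimpleHighestWeight χ π (weightLM χ ω lam mu) v) (k : Fin l) :
    (gen χ π (.E k) ⊗ₜ 1 + gen χ π (.K (π k)) ⊗ₜ act χ π M (gen χ π (.E k))) *
        intertwiner χ π ω lam mu hW =
      intertwiner χ π ω lam mu hW * (gen χ π (.K (π k)) ⊗ₜ act χ π M (gen χ π (.E k)) +
        (((ω (π k))⁻¹ : Kˣ) : K) • (gen χ π (.E k) ⊗ₜ 1)) := by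
  have h1 := finsum_intertwine (finite_quasiR χ π hM) (π k) fun β => by
    have := congrArg (actRight χ π M) (gen_E_mul_quasiR χ π k β)
    simp only [map_mul, map_add, map_sub, actRight_tmul, map_one] at this
    exact this
  have h2 := finsum_intertwine (finite_twistedR χ π hM ω) (π k) fun γ => by
    have := congrArg (actRight χ π M) (gen_E_mul_twistedR χ π hω k γ)
    simp only [map_mul, map_add, map_sub, map_smul, actRight_tmul, torus₂, map_one, ← K_eq_KL,
      gen_K_zero, Algebra.TensorProduct.tmul_mul_tmul, mul_one, one_mul] at this
    exact this
  rw [intertwiner, ← mul_assoc, ← mul_assoc, h1, mul_assoc (∑ᶠ β, _) _ (torusPart _ _ _ _ _),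
    E_torusPart χ π hW hM, ← mul_assoc, mul_assoc _ _ (∑ᶠ γ, _), h2, ← mul_assoc]

theorem intertwiner_F (hω : ∀ a b, ω (a + b) = ω a * ω b)
    (hM : IsSimpleHighestWeight χ π (weightLM χ ω lam mu) v) (k : Fin l) :
    (1 ⊗ₜ act χ π M (gen χ π (.F k)) + gen χ π (.F k) ⊗ₜ act χ π M (gen χ π (.L (π k)))) *
        intertwiner χ π ω lam mu hW =
      intertwiner χ π ω lam mu hW * (1 ⊗ₜ act χ π M (gen χ π (.F k)) +
        (ω (π k) : K) • (gen χ π (.F k) ⊗ₜ act χ π M (gen χ π (.L (π k))))) := by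
  have h1 := finsum_intertwine (finite_quasiR χ π hM) (π k)
    (a := 1 ⊗ₜ act χ π M (gen χ π (.F k))) (b := 1 ⊗ₜ act χ π M (gen χ π (.F k)))
    (c := gen χ π (.F k) ⊗ₜ act χ π M (gen χ π (.K (π k))))
    (d := gen χ π (.F k) ⊗ₜ act χ π M (gen χ π (.L (π k)))) fun β => by
    have := congrArg (actRight χ π M) (quasiR_mul_gen_F χ π k β)
    simp only [map_mul, map_add, map_sub, actRight_tmul] at this
    rw [this]
    abel
  have h2 := finsum_intertwine (finite_twistedR χ π hM ω) (π k) fun γ => by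
    have := congrArg (actRight χ π M) (gen_F_mul_twistedR χ π hω k γ)
    simp only [map_mul, map_add, map_sub, map_smul, actRight_tmul, torus₂, ← L_eq_KL, gen_L_zero,
      Algebra.TensorProduct.tmul_mul_tmul, mul_one, one_mul] at this
    exact this
  rw [intertwiner, ← mul_assoc, ← mul_assoc, h1, mul_assoc (∑ᶠ β, _) _ (torusPart _ _ _ _ _),
    F_torusPart χ π hW hω hM, ← mul_assoc, mul_assoc _ _ (∑ᶠ γ, _), add_comm (KL _ _ _ _ ⊗ₜ[K] _), h2,
    ← mul_assoc, add_comm (_ • _)]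

theorem torusPart_mem :
    torusPart χ π lam mu hW ∈ balanced χ π (weightOrbit χ π v) :=
  Submodule.sum_mem _ fun ν _ => Submodule.subset_span
    ⟨0, _, KL_mem_homPart χ π _ _, _, shifts_wtProj hW ν, rfl⟩

theorem intertwiner_mem (hM : IsSimpleHighestWeight χ π (weightLM χ ω lam mu) v) :
    intertwiner χ π ω lam mu hW ∈ balanced χ π (weightOrbit χ π v) := by
  refine balanced_mul χ π (balanced_mul χ π ?_ (torusPart_mem χ π hW)) ?_
  · refine finsum_induction _ (zero_mem _) (fun _ _ => add_mem) fun β => ?_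
    refine actRight_mem_balanced χ π hM (d := -β) ?_
    rw [neg_neg]
    exact quasiR_mem_bihom χ π β
  · exact finsum_induction _ (zero_mem _) (fun _ _ => add_mem) fun γ =>
      actRight_mem_balanced χ π hM (twistedR_mem χ π ω γ)

theorem shifts_rhoOp : Shifts (weightOrbit χ π v) 0 (rhoOp χ π hW) := fun ν x hx => by
  rw [rhoOp_apply χ π hW hx, add_zero]
  exact Submodule.smul_mem _ _ hx

theorem centralElt_mem (hM : IsSimpleHighestWeight χ π (weightLM χ ω lam mu) v) :
    centralElt χ π ω lam mu hW ∈ homPart χ π 0 :=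
  ptrace_balanced χ π hW (balanced_mul χ π (intertwiner_mem χ π hW hM)
    (Submodule.subset_span ⟨0, 1, one_mem_homPart χ π, _, shifts_rhoOp χ π hW, rfl⟩))

theorem act_K_mul_neg (a : A) :
    act χ π M (gen χ π (.K a)) * act χ π M (gen χ π (.K (-a))) = 1 := by
  rw [← map_mul, gen_K_add, add_neg_cancel, gen_K_zero, map_one]

theorem act_L_mul_neg (a : A) :
    act χ π M (gen χ π (.L a)) * act χ π M (gen χ π (.L (-a))) = 1 := by
  rw [← map_mul, gen_L_add, add_neg_cancel, gen_L_zero, map_one]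

theorem E_centralElt (hω : ∀ a b, ω (a + b) = ω a * ω b)
    (hM : IsSimpleHighestWeight χ π (weightLM χ ω lam mu) v) (k : Fin l) :
    gen χ π (.E k) * centralElt χ π ω lam mu hW =
      (((ω (π k))⁻¹ : Kˣ) : K) • (centralElt χ π ω lam mu hW * gen χ π (.E k)) := by
  refine ptrace_skew_comm_of_left (intertwiner_E χ π hW hω hM k)
    (K_comm_balanced χ π hM (π k) (intertwiner_mem χ π hW hM)) (act_K_mul_neg χ π (π k)) ?_
  refine hW.hom_ext fun ν x hx => ?_
  have hE := shifts_gen χ π hM (.E k) ν x hx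
  have hK := shifts_gen χ π hM (.K (π k)) ν x hx
  simp only [genDeg, neg_zero, add_zero] at hE hK
  have hKE : gen χ π (.K (-π k)) * gen χ π (.E k) * gen χ π (.K (π k)) =
      ((χ (π k) (π k))⁻¹ : Kˣ) • gen χ π (.E k) := by
    rw [gen_K_E, smul_mul_assoc, mul_assoc, gen_K_add, neg_add_cancel, gen_K_zero, mul_one,
      χ.neg_left, Units.smul_def]
  simp only [Module.End.mul_apply]
  rw [rhoOp_apply χ π hW hE, rhoOp_apply χ π hW hK, map_smul, map_smul]
  simp only [act_apply, ← mul_smul]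
  rw [← mul_assoc, hKE, Units.smul_def, smul_assoc, smul_smul, ← sub_eq_add_neg]
  congr 1
  have := rhoHat_add χ π (ν - π k) (π k)
  rw [sub_add_cancel, rhoHat_basis] at this
  rw [this]
  push_cast
  field_simp

theorem F_centralElt (hω : ∀ a b, ω (a + b) = ω a * ω b)
    (hM : IsSimpleHighestWeight χ π (weightLM χ ω lam mu) v) (k : Fin l) :
    gen χ π (.F k) * centralElt χ π ω lam mu hW =
      (ω (π k) : K) • (centralElt χ π ω lam mu hW * gen χ π (.F k)) := by
  refine ptrace_skew_comm_of_right (κ' := act χ π M (gen χ π (.L (-π k))))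
    (intertwiner_F χ π hW hω hM k) (act_L_mul_neg χ π (π k)) ?_ ?_
  · refine hW.hom_ext fun ν x hx => ?_
    have hL := shifts_gen χ π hM (.L (π k)) ν x hx
    simp only [genDeg, neg_zero, add_zero] at hL
    simp only [Module.End.mul_apply]
    rw [rhoOp_apply χ π hW hL, rhoOp_apply χ π hW hx, map_smul]
    simp only [act_apply, ← mul_smul]
    rw [gen_L_add, neg_add_cancel, gen_L_zero, one_smul]
  · refine hW.hom_ext fun ν x hx => ?_
    have hF := shifts_gen χ π hM (.F k) ν x hx
    simp only [genDeg, neg_neg] at hF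
    simp only [Module.End.mul_apply]
    rw [rhoOp_apply χ π hW hF, rhoOp_apply χ π hW hx, map_smul, map_smul, map_smul]
    simp only [act_apply, ← mul_smul]
    rw [gen_L_F, smul_assoc, smul_smul, rhoHat_add, rhoHat_basis, χ.neg_right]
    congr 1
    push_cast
    field_simp

theorem centralElt_mem_skewCenter (hω : ∀ a b, ω (a + b) = ω a * ω b)
    (hM : IsSimpleHighestWeight χ π (weightLM χ ω lam mu) v) :
    centralElt χ π ω lam mu hW ∈ skewCenter χ π ω := by
  have hZ := centralElt_mem χ π hW hM
  have h0 := character_zero hω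
  have hneg : ∀ a, ω (-a) = (ω a)⁻¹ := fun a =>
    eq_inv_of_mul_eq_one_left (by rw [← hω, neg_add_cancel, h0])
  refine ⟨hZ, ?_⟩
  generalize hz : centralElt χ π ω lam mu hW = Z at hZ
  have hg : ∀ g, Z * gen χ π g = (ω (genDeg π g) : K) • (gen χ π g * Z) := by
    rintro (a | a | k | k)
    · rw [K_mul_homPart χ π a hZ, χ.zero_right, genDeg, h0]; simp
    · rw [L_mul_homPart χ π a hZ, neg_zero, χ.zero_left, genDeg, h0]; simp
    · rw [← hz, E_centralElt χ π hW hω hM, smul_smul, genDeg, ← Units.val_mul, mul_inv_cancel,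
        Units.val_one, one_smul]
    · rw [← hz, F_centralElt χ π hW hω hM, smul_smul, genDeg, hneg, ← Units.val_mul,
        inv_mul_cancel, Units.val_one, one_smul]
  intro d X hX
  induction hX using Submodule.span_induction with
  | mem x hx =>
    obtain ⟨w, rfl, rfl⟩ := hx
    induction w with
    | nil => simp [h0]
    | cons g w ih =>
      simp only [List.map_cons, List.prod_cons, List.sum_cons]
      rw [← mul_assoc, hg, smul_mul_assoc, mul_assoc, ih, mul_smul_comm, smul_smul, hω,
        Units.val_mul, mul_assoc]
  | zero => simp
  | add x y _ _ hx hy => rw [mul_add, hx, hy, add_mul, smul_add]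
  | smul r x _ hx => rw [mul_smul_comm, hx, smul_mul_assoc, smul_comm]

/-- The first factors of `Θ_β` begin with some `F_i`, unless `β = 0`. -/
theorem Sh_ptrace_quasiR {β : A} (hβ : β ≠ 0) (X : GQG χ π ⊗[K] Module.End K M) :
    Sh χ π (ptrace K M (GQG χ π) (actRight χ π M (quasiR χ π β) * X)) = 0 := by
  have : Submodule.span K
      {x | ∃ w w', wordWt π w = β ∧ wordWt π w' = β ∧ Fw χ π w ⊗ₜ[K] Ew χ π w' = x} ≤
      LinearMap.ker (Sh χ π ∘ₗ ptrace K M (GQG χ π) ∘ₗ LinearMap.mulRight K X ∘ₗ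
        (actRight χ π M).toLinearMap) := by
    refine Submodule.span_le.mpr ?_
    rintro _ ⟨w, w', hw, -, rfl⟩
    cases w with
    | nil => exact absurd hw.symm (by simpa [wordWt] using hβ)
    | cons i w =>
      simp [ptrace_tmul_mul, Fw_cons, mul_assoc, Sh_F_mul]
  exact this (quasiR_mem χ π β)

/-- The first factors of `Θ''_γ` end with some `E_i`, up to the torus, unless `γ = 0`. -/
theorem Sh_ptrace_twistedR (ω : A → Kˣ) {γ : A} (hγ : γ ≠ 0) (X : GQG χ π ⊗[K] Module.End K M)
    (φ : Module.End K M) :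
    Sh χ π (ptrace K M (GQG χ π) (X * actRight χ π M (twistedR χ π ω γ) * (1 ⊗ₜ φ))) = 0 := by
  have : Submodule.span K
      {x | ∃ w w', wordWt π w = γ ∧ wordWt π w' = γ ∧ Ew χ π w ⊗ₜ[K] Fw χ π w' = x} ≤
      LinearMap.ker (Sh χ π ∘ₗ ptrace K M (GQG χ π) ∘ₗ LinearMap.mulRight K (1 ⊗ₜ φ) ∘ₗ
        LinearMap.mulLeft K X ∘ₗ (actRight χ π M).toLinearMap ∘ₗ
        LinearMap.mulRight K (torus₂ χ π (-γ) 0 0 (-γ))) := by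
    refine Submodule.span_le.mpr ?_
    rintro _ ⟨w, w', hw, -, rfl⟩
    rcases List.eq_nil_or_concat w with rfl | ⟨w, i, rfl⟩
    · exact absurd hw.symm (by simpa [wordWt] using hγ)
    · rw [SetLike.mem_coe, LinearMap.mem_ker]
      simp only [LinearMap.comp_apply, LinearMap.mulLeft_apply, LinearMap.mulRight_apply,
        AlgHom.toLinearMap_apply, torus₂, Algebra.TensorProduct.tmul_mul_tmul, actRight_tmul,
        List.concat_eq_append, Ew_append, mul_assoc, mul_one]
      rw [ptrace_mul_tmul, ← mul_assoc _ (Ew χ π w), Sh, LinearMap.comp_apply,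
        shCoeff_E_KL, map_zero]
  rw [twistedR, map_smul, mul_smul_comm, smul_mul_assoc, map_smul, map_smul]
  have h := this (quasiRflip_mem_span χ π γ)
  rw [LinearMap.mem_ker] at h
  refine Eq.trans (congrArg _ ?_) (smul_zero _)
  exact h

theorem map_finsum_eq_map_zero {R N : Type*} [AddCommGroup R] [AddCommGroup N] (f : R →+ N)
    {X : A → R} (hX : X.HasFiniteSupport) (h : ∀ β, β ≠ 0 → f (X β) = 0) :
    f (∑ᶠ β, X β) = f (X 0) := by
  rw [AddMonoidHom.map_finsum f hX]
  exact finsum_eq_single _ 0 h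

theorem Sh_centralElt (hω : ∀ a b, ω (a + b) = ω a * ω b)
    (hM : IsSimpleHighestWeight χ π (weightLM χ ω lam mu) v) :
    Sh χ π (centralElt χ π ω lam mu hW) = ∑ ν ∈ hW.finite.toFinset,
      ((rhoHat χ π ν : K) * (Module.finrank K (weightOrbit χ π v ν) : K)) •
        KL χ π (lam + ν) (mu - ν) := by
  have h0 := character_zero hω
  let f : GQG χ π ⊗[K] Module.End K M →ₗ[K] GQG χ π := Sh χ π ∘ₗ ptrace K M (GQG χ π)
  have h1 := map_finsum_eq_map_zero (f ∘ₗ LinearMap.mulRight K (torusPart χ π lam mu hW *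
      ((∑ᶠ γ, actRight χ π M (twistedR χ π ω γ)) * (1 ⊗ₜ rhoOp χ π hW)))).toAddMonoidHom
    (finite_quasiR χ π hM) (fun β hβ => Sh_ptrace_quasiR χ π hβ _)
  have h2 := map_finsum_eq_map_zero (f ∘ₗ LinearMap.mulRight K (1 ⊗ₜ rhoOp χ π hW) ∘ₗ
      LinearMap.mulLeft K (torusPart χ π lam mu hW)).toAddMonoidHom
    (finite_twistedR χ π hM ω) (fun γ hγ => Sh_ptrace_twistedR χ π ω hγ _ _)
  have hq : twistedR χ π ω 0 = 1 := by
    rw [twistedR, quasiRflip, quasiR_zero, torus₂, neg_zero, KL_zero, twistScalar, h0,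
      χ.zero_left, map_one, ← Algebra.TensorProduct.one_def]
    simp
  simp only [quasiR_zero, hq, map_one, LinearMap.toAddMonoidHom_coe, LinearMap.comp_apply,
    LinearMap.mulRight_apply, LinearMap.mulLeft_apply, mul_one, one_mul] at h1 h2
  have h3 : Sh χ π (centralElt χ π ω lam mu hW) =
      f (torusPart χ π lam mu hW * (1 ⊗ₜ rhoOp χ π hW)) := by
    rw [← h2, mul_assoc, ← h1, centralElt, intertwiner]
    simp only [mul_assoc]
    rfl
  rw [h3, torusPart, diag, Finset.sum_mul, map_sum]
  refine Finset.sum_congr rfl fun ν _ => ?_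
  have h4 : wtProj hW ν * rhoOp χ π hW = (rhoHat χ π ν : K) • wtProj hW ν := by
    refine hW.hom_ext fun ν' x hx => ?_
    rw [Module.End.mul_apply, rhoOp_apply χ π hW hx, map_smul, LinearMap.smul_apply]
    by_cases h : ν' = ν
    · rw [h]
    · rw [wtProj_ne hW h hx, smul_zero, smul_zero]
  rw [Algebra.TensorProduct.tmul_mul_tmul, mul_one, h4]
  simp only [f, LinearMap.comp_apply, ptrace_tmul, map_smul, Sh_KL, trace_wtProj, smul_eq_mul]

end Central

end GenQuantumGroup

end

open GenQuantumGroup in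
theorem mainTheorem1 {K : Type*} [Field K] {A : Type*} [AddCommGroup A] {l : ℕ} (hl : 1 ≤ l)
    (π : Module.Basis (Fin l) ℤ A) (χ : Bicharacter A K)
    (ω : A → Kˣ) (hω : ∀ a b, ω (a + b) = ω a * ω b) (lam mu : A)
    {M : Type*} [AddCommGroup M] [Module K M] [Module (GQG χ π) M]
    [IsScalarTower K (GQG χ π) M] (v : M)
    (hM : IsSimpleHighestWeight χ π (weightLM χ ω lam mu) v) (hfin : FiniteDimensional K M) :
    {ν : A | ν ∈ posCone π ∧ weightOrbit χ π v ν ≠ ⊥}.Finite ∧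
    ∃ Z ∈ skewCenter χ π ω,
      Sh χ π Z = ∑ᶠ ν ∈ posCone π,
        ((rhoHat χ π ν : K) * (Module.finrank K (weightOrbit χ π v ν) : K)) •
          KL χ π (lam + ν) (mu - ν) := by
  have hW := isGrading_weightOrbit χ π hM
  refine ⟨hW.finite.subset fun ν hν => hν.2, centralElt χ π ω lam mu hW,
    centralElt_mem_skewCenter χ π hW hω hM, ?_⟩
  rw [Sh_centralElt χ π hW hω hM]
  refine (finsum_mem_eq_sum_of_inter_support_eq _ ?_).symm
  ext ν
  simp only [Set.mem_inter_iff, SetLike.mem_coe, Set.Finite.coe_toFinset, Set.mem_ofPred_eq]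
  refine and_congr_left fun h => ⟨fun _ h' => h ?_, fun h' => ?_⟩
  · simp [Submodule.finrank_eq_zero.mpr h']
  · by_contra hν
    exact h' (weightOrbit_eq_bot χ π v hν)
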